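/- Let $X$ be an irreducible (reduced, separated, finite type) algebraic variety of dimension $n$ over $\mathbb C$, and let $\mathcal E=(E_1,\dots,E_{n+1})$ be a collection of base-point free linear series on $X$: each $E_i\subset H^0(X,\mathcal L_i)$ is a finite-dimensional subspace of sections of a line bundle $\mathcal L_i$ with no common zero on $X$. Put $\mathbf E=E_1\times\dots\times E_{n+1}$, and for $\mathbf s\in\mathbf E$ let $Z_{\mathbf s}\subset X$ be the set of (closed) points at which $s_1=\dots=s_{n+1}=0$. The *consistency variety* $R_{\mathcal E}\subset\mathbf E$ is the Zariski closure of $\{\mathbf s\in\mathbf E : Z_{\mathbf s}\neq\varnothing\}$. For $J\subset\{1,\dots,n+1\}$ let $E_J\subset H^0(X,\bigotimes_{j\in J}\mathcal L_j)$ be the span of the products $\bigotimes_{j\in J}s_j$ with $s_j\in E_j$ (so $E_\varnothing=\mathbb C$), let $\Phi_J:X\to\mathbb P(E_J^*)$ be the Kodaira map, sending $x$ to the hyperplane of sections in $E_J$ vanishing at $x$, and put $\tau_J=\dim\Phi_J(X)$. The *defect* of $J$ is $\operatorname{def}(E_J)=\tau_J-|J|$, and the *minimal defect* is $d(\mathcal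 E)=\min_J\operatorname{def}(E_J)$ over all $J\subset\{1,\dots,n+1\}$. A subcollection $J$ is *essential* if $\operatorname{def}(E_J)=d(\mathcal E)$ and $\operatorname{def}(E_I)>\operatorname{def}(E_J)$ for every proper subset $I\subsetneq J$. If $R_{\mathcal E}$ has codimension $1$ in $\mathbf E$, a *resultant* $\mathrm{Res}_{\mathcal E}$ is a polynomial function on $\mathbf E$ of the form $c f^m$, where $c\in\mathbb C\setminus\{0\}$, $f$ is an irreducible polynomial whose zero locus is $R_{\mathcal E}$, and $m$ is the number of points of $Z_{\mathbf s}$ for all $\mathbf s$ in some non-empty Zariski open subset of $R_{\mathcal E}$. **Theorem.** The consistency variety $R_{\mathcal E}$ has codimension $1$ in $\mathbf E$ if and only if $d(\mathcal E)=-1$. Moreover, in that case a resultant $\mathrm{Res}_{\mathcal E}$ exists, and if $J$ is an essential subcollection of $\mathcal E$, then $\mathrm{Res}_{\mathcal E}$ depends only on the sections $s_i\in E_i$ with $i\in J$: if $\mathbf s,\mathbf s'\in\mathbf E$ satisfy $s_i=s'_i$ for all $i\in J$, then $\mathrm{Res}_{\mathcal E}(\mathbf s)=\mathrm{Res}_{\mathcal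 E}(\mathbf s')$. -/

import Mathlib

open CategoryTheory AlgebraicGeometry TopologicalSpace
open scoped LinearAlgebra.Projectivization TensorProduct Topology

noncomputable section

namespace LinearSeries

/-! ### Polynomial functions and the Zariski topology on finite dimensional spaces -/

/-- The algebra of polynomial functions on a complex vector space: the subalgebra of all functions
generated by the linear forms. -/
def polyFun (V : Type*) [AddCommGroup V] [Module ℂ V] : Subalgebra ℂ (V → ℂ) :=
  Algebra.adjoin ℂ (Set.range fun l : Module.Dual ℂ V => (l : V → ℂ))

/-- The Zariski topology on a finite dimensional complex vector space: the principal open sets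
`{v | f v ≠ 0}`, for polynomial functions `f`, form a basis. -/
@[reducible]
def zariski (V : Type*) [AddCommGroup V] [Module ℂ V] : TopologicalSpace V :=
  TopologicalSpace.generateFrom {U | ∃ f ∈ polyFun V, U = {v | f v ≠ 0}}

/-- The Zariski topology on the projective space `ℙ(V)` of lines in `V`: the quotient topology
from `V \ {0}`, so that a set is closed iff the cone over it is closed in `V \ {0}`. -/
@[reducible]
def projZariski (V : Type*) [AddCommGroup V] [Module ℂ V] : TopologicalSpace (ℙ ℂ V) :=
  TopologicalSpace.coinduced (Projectivization.mk' ℂ)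
    ((zariski V).induced (Subtype.val : {v : V // v ≠ 0} → V))

/-- The Krull dimension of a subset `S` of a space `T` with topology `t`, for the subspace
topology. -/
def krullDimOf {T : Type*} (t : TopologicalSpace T) (S : Set T) : WithBot ℕ∞ :=
  @topologicalKrullDim S (t.induced Subtype.val)

/-- `S ⊆ V` has codimension `c`, i.e. `dim S + c = dim V`. -/
def HasCodim {V : Type*} [AddCommGroup V] [Module ℂ V] (S : Set V) (c : ℕ) : Prop :=
  krullDimOf (zariski V) S + c = krullDimOf (zariski V) Set.univ

/-! ### Line bundles and their sections on a scheme over `ℂ` -/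

variable {X : Scheme.{0}}

/-- A line bundle: an `𝒪_X`-module which is locally isomorphic to `𝒪_X`. -/
def IsLineBundle (L : X.Modules) : Prop :=
  ∀ x : X, ∃ U : X.Opens, x ∈ U ∧
    Nonempty (L.restrict U.ι ≅
      (SheafOfModules.unit U.toScheme.ringCatSheaf : U.toScheme.Modules))

/-- The local ring `𝒪_{X,x}` acts on the stalk `L_x`. -/
instance stalkModule (L : X.Modules) (x : X) :
    Module (X.presheaf.stalk x) (L.presheaf.stalk x) :=
  let M : PresheafOfModules.{0} (X.presheaf ⋙ forget₂ CommRingCat RingCat) := L.val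
  inferInstanceAs (Module (X.presheaf.stalk x) ↑(TopCat.Presheaf.stalk M.presheaf x))

/-- The germ at `x` of a global section of `L`. -/
def germ (L : X.Modules) (x : X) (s : Γ(L, ⊤)) : L.presheaf.stalk x :=
  L.presheaf.germ ⊤ x trivial s

/-- An element of a module over a local ring vanishes at the closed point if it is zero in the
fibre `N / 𝔪 N`. -/
def Vanishes (R : Type*) [CommRing R] [IsLocalRing R] {N : Type*} [AddCommGroup N] [Module R N]
    (a : N) : Prop :=
  a ∈ IsLocalRing.maximalIdeal R • (⊤ : Submodule R N)

variable [X.Over (Spec (.of ℂ))]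

/-- The structure homomorphism `ℂ → Γ(X, 𝒪_X)`. -/
def scalars (X : Scheme.{0}) [X.Over (Spec (.of ℂ))] : ℂ →+* Γ(X, ⊤) :=
  ((Scheme.ΓSpecIso (.of ℂ)).inv ≫ (X ↘ Spec (.of ℂ)).appTop).hom

instance sectionsModule (L : X.Modules) : Module ℂ Γ(L, ⊤) :=
  Module.compHom Γ(L, ⊤) (scalars X)

instance stalkAlgebra (x : X) : Algebra ℂ (X.presheaf.stalk x) :=
  ((X.presheaf.germ ⊤ x trivial).hom.comp (scalars X)).toAlgebra

/-! ### Collections of linear series -/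

variable {k : ℕ} {L : Fin k → X.Modules}

/-- No closed point of `X` is a common zero of all the sections in `E`. -/
def BasePointFree {L : X.Modules} (E : Submodule ℂ Γ(L, ⊤)) : Prop :=
  ∀ x ∈ closedPoints X, ∃ s ∈ E, ¬ Vanishes (X.presheaf.stalk x) (germ L x s)

variable (E : ∀ i, Submodule ℂ Γ(L i, ⊤))

/-- The set of (closed) points of `X` at which the system `s₁ = ⋯ = s_k = 0` holds. -/
def zeroSet (s : ∀ i, E i) : Set X :=
  {x | x ∈ closedPoints X ∧ ∀ i, Vanishes (X.presheaf.stalk x) (germ (L i) x (s i))}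

/-- The incidence variety. -/
def incidence : Set (X × ∀ i, E i) :=
  {p | p.1 ∈ zeroSet E p.2}

/-- The consistency variety: the Zariski closure of the projection of the incidence variety to
`E₁ × ⋯ × E_k`, i.e. of the set of systems with at least one root. -/
def consistencyVariety : Set (∀ i, E i) :=
  closure[zariski (∀ i, E i)] (Prod.snd '' incidence E)

/-- The stalk at `x` of the tensor product of the line bundles `L j`, `j ∈ J`. -/
abbrev tensorStalk (L : Fin k → X.Modules) (J : Finset (Fin k)) (x : X) : Type :=
  ⨂[X.presheaf.stalk x] j : J, (L j).presheaf.stalk x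

/-- The global section `⨂_{j ∈ J} s j` of `⨂_{j ∈ J} L j`, given by its germs
(a section of a sheaf is determined by its germs). -/
def tensorSection (L : Fin k → X.Modules) (J : Finset (Fin k)) (s : ∀ j : J, Γ(L j, ⊤)) :
    ∀ x : X, tensorStalk L J x :=
  fun x => PiTensorProduct.tprod (X.presheaf.stalk x) fun j => germ (L j) x (s j)

/-- The product `E_J` of the linear series `E j`, `j ∈ J`: the space of sections of
`⨂_{j ∈ J} L j` spanned by the products `⨂_{j ∈ J} s j` with `s j ∈ E j`. -/
def prodSeries (J : Finset (Fin k)) : Submodule ℂ (∀ x : X, tensorStalk L J x) :=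
  Submodule.span ℂ {φ | ∃ s : ∀ j : J, E j, φ = tensorSection L J fun j => (s j : Γ(L j, ⊤))}

/-- The graph of the Kodaira map `Φ_J : X → ℙ(E_J^*)`, where points of `ℙ(E_J^*)` are identified
with hyperplanes in `E_J`: the image of a closed point `x` is the hyperplane of all sections in
`E_J` which vanish at `x`. -/
def IsKodairaValue (J : Finset (Fin k)) (x : X)
    (p : ℙ ℂ (Module.Dual ℂ (prodSeries E J))) : Prop :=
  ∀ g : prodSeries E J, p.rep g = 0 ↔ Vanishes (X.presheaf.stalk x) (g.1 x)

/-- The image `Y_J` of the Kodaira map `Φ_J`. -/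
def kodairaImage (J : Finset (Fin k)) : Set (ℙ ℂ (Module.Dual ℂ (prodSeries E J))) :=
  {p | ∃ x ∈ closedPoints X, IsKodairaValue E J x p}

/-- The dimension `τ_J` of `Y_J`. -/
def tau (J : Finset (Fin k)) : ℕ :=
  ((krullDimOf (projZariski (Module.Dual ℂ (prodSeries E J)))
    (kodairaImage E J)).unbotD 0).toNat

/-- The defect `τ_J - |J|` of a subcollection. -/
def defect (J : Finset (Fin k)) : ℤ :=
  (tau E J : ℤ) - J.card

/-- The minimal defect over all subcollections (including the empty one). -/
def minDefect : ℤ :=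
  Finset.univ.inf' ⟨∅, Finset.mem_univ _⟩ (defect E)

/-- `J` is an essential subcollection: it has minimal defect, and all its proper subsets have
strictly larger defect. -/
def IsEssential (J : Finset (Fin k)) : Prop :=
  defect E J = minDefect E ∧ ∀ I, I ⊂ J → defect E J < defect E I

/-- `P` is a resultant of the collection `E`: a polynomial which defines the hypersurface `R_E`
with multiplicity `m`, where `m` is the number of points of the zero set of a generic system in
`R_E`. That is, `P = c f ^ m` with `c ≠ 0` and `f` an irreducible polynomial whose zero locus
is `R_E`. -/
def IsResultant (P : polyFun (∀ i, E i)) : Prop :=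
  ∃ (f : polyFun (∀ i, E i)) (m : ℕ) (c : ℂ), Irreducible f ∧
    consistencyVariety E = {s | f.1 s = 0} ∧
    (∃ U : Set (∀ i, E i), IsOpen[zariski (∀ i, E i)] U ∧ (U ∩ consistencyVariety E).Nonempty ∧
      ∀ s ∈ U ∩ consistencyVariety E, (zeroSet E s).encard = m) ∧
    c ≠ 0 ∧ P = c • f ^ m

end LinearSeries

end

/-! Everything is read off at the generic point of `X`. On a small affine open `U` each `E_j` has a
basis section without zeros (`PivotChart`). Dividing by it turns the basis of `E_j` into functions
`φ_j` on `U`, and a system vanishing at a point of `U` is given by arbitrary values of the other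
coordinates, the pivot coordinates being solved for. So the incidence variety over `U` is `U` times
an affine space, with ring `Tot`, and `R_E` is the closure of its image: its ideal is the kernel of
`genHom`, and its dimension `genRk` is the transcendence degree of the coordinates `genPt` of its
generic point (`mem_consistencyVariety_iff`, `krullDimOf_consistencyVariety`). Likewise `τ_J` is the
transcendence degree of the functions `φ_j`, `j ∈ J` (`tau_eq`).

Let `N` be the dimension of `E_1 × ⋯ × E_{n+1}`. Counting parameters gives `genRk + |J| ≤ N + τ_J`
for every `J` (`algRk_range_genPt_add_card_le`); as `τ ≤ n`, the full collection yields `genRk ≤ N -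
1`. Conversely, a Rado-type theorem for generic linear forms (`card_le_algRk_genPt`) gives `genRk ≥
N - 1` once `|J| ≤ τ_J + 1` for all `J`. So the codimension is 1 exactly when no defect is below
`-1`, and the full collection always has defect at most `-1`.

In codimension 1 the kernel of `genHom` is generated by one irreducible polynomial `f`
(`exists_ker_eq_span`). The incidence variety then has the same dimension as `R_E`, so the
projection is generically finite, and a generic fibre has as many points as a separable polynomial
has roots (`exists_encard_extensions_eq`). Systems with a zero outside `U` lie in a proper closed
subset of `R_E`, because at a non-generic point the transcendence degree of the values is at most `n
- 1` (`exists_polynomial_of_not_mem`). Finally, if `τ_J < |J|`, the coordinates of `genPt` indexed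
by `J` satisfy an algebraic relation; it is a multiple of `f`, and a divisor of a nonzero polynomial
in the `J`-variables involves only these variables (`apply_eq_of_isResultant`). -/

noncomputable section

namespace LinearSeries

/-! ### Krull dimension and transcendence degree -/

section Dimension

universe u

variable {k : Type*} [Field k] {A : Type u} [CommRing A] [Algebra k A]

/-- If the degree did not drop, lifts to `A` of a transcendence basis of `A ⧸ q` would be a
transcendence basis of `A`. A nonzero element of `q` would then divide a nonzero polynomial in the
lifts, and reducing modulo `q` gives a relation among the basis. -/
lemma trdeg_quotient_lt [IsDomain A] (q : Ideal A) [q.IsPrime] (hq : q ≠ ⊥)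
    (hfin : Algebra.trdeg k A < Cardinal.aleph0) :
    Algebra.trdeg k (A ⧸ q) < Algebra.trdeg k A := by
  by_contra! hle
  have : FaithfulSMul k (A ⧸ q) :=
    (faithfulSMul_iff_algebraMap_injective k (A ⧸ q)).2 (RingHom.injective _)
  obtain ⟨s, hs⟩ := exists_isTranscendenceBasis k (A ⧸ q)
  choose x hx using fun a : s => Ideal.Quotient.mkₐ_surjective k q a.1
  have hcomp : (Ideal.Quotient.mkₐ k q) ∘ x = fun a : s => a.1 := funext hx
  have hind : AlgebraicIndependent k x :=
    AlgebraicIndependent.of_comp (Ideal.Quotient.mkₐ k q) (hcomp ▸ hs.1)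
  have hb : IsTranscendenceBasis k x :=
    hind.isTranscendenceBasis_of_trdeg_le hfin (hle.trans_eq hs.cardinalMk_eq_trdeg.symm)
  obtain ⟨b, hbq, hb0⟩ := (Submodule.ne_bot_iff q).1 hq
  have halg := hb.isAlgebraic.1 b
  obtain ⟨⟨r, hrS⟩, hr0, hr⟩ := halg.exists_nonzero_dvd (mem_nonZeroDivisors_of_ne_zero hb0)
  have hrq : r ∈ q := q.mem_of_dvd hr hbq
  obtain ⟨P, rfl⟩ := (Algebra.adjoin_range_eq_range_aeval k x).le hrS
  have : MvPolynomial.aeval (fun a : s => a.1) P = 0 := by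
    rw [← hcomp, ← Ideal.Quotient.eq_zero_iff_mem.2 hrq]
    exact (MvPolynomial.comp_aeval_apply (f := x) (Ideal.Quotient.mkₐ k q) P).symm
  apply hr0
  have := hs.1.eq_zero_of_aeval_eq_zero _ this
  subst this
  exact Subtype.ext (map_zero _)

/-- The transcendence degree of `A ⧸ p` strictly decreases along a chain of primes and starts at no
more than `d`. -/
lemma ringKrullDim_le_of_trdeg {d : ℕ} (h : Algebra.trdeg k A = d) : ringKrullDim A ≤ d := by
  have hfin : ∀ p : PrimeSpectrum A, Algebra.trdeg k (A ⧸ p.asIdeal) ≤ d := fun p =>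
    (trdeg_le_of_surjective (Ideal.Quotient.mkₐ k p.asIdeal)
      Ideal.Quotient.mk_surjective).trans_eq h
  have hlt : ∀ p q : PrimeSpectrum A, p < q → Algebra.trdeg k (A ⧸ q.asIdeal) <
      Algebra.trdeg k (A ⧸ p.asIdeal) := fun p q hpq => by
    have hq : (q.asIdeal.map (Ideal.Quotient.mk p.asIdeal)).IsPrime :=
      Ideal.map_isPrime_of_surjective Ideal.Quotient.mk_surjective (by simpa using hpq.le)
    have hne : q.asIdeal.map (Ideal.Quotient.mk p.asIdeal) ≠ ⊥ := by
      rw [Ne, Ideal.map_eq_bot_iff_le_ker, Ideal.mk_ker]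
      exact not_le_of_gt hpq
    refine lt_of_le_of_lt (le_of_eq ?_) (trdeg_quotient_lt (k := k) _ hne
      ((hfin p).trans_lt (Cardinal.natCast_lt_aleph0)))
    exact ((DoubleQuot.quotQuotEquivQuotOfLEₐ k hpq.le).trdeg_eq).symm
  refine iSup_le fun l => ?_
  norm_cast
  -- The truncated subtraction is harmless, as every quotient has transcendence degree at most `d`.
  have hmono : StrictMono fun p : PrimeSpectrum A =>
      d - Cardinal.toNat (Algebra.trdeg k (A ⧸ p.asIdeal)) := fun p q hpq => by
    have h1 := Cardinal.toNat_lt_toNat (hlt p q hpq)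
      ((hfin p).trans_lt (Cardinal.natCast_lt_aleph0))
    have h2 := Cardinal.toNat_le_toNat (hfin p) (Cardinal.natCast_lt_aleph0)
    simp only [Cardinal.toNat_natCast] at h2
    dsimp only
    lia
  have := LTSeries.head_add_length_le_nat (l.map _ hmono)
  have h2 : (l.map _ hmono).last ≤ d := by simp
  simp only [LTSeries.map_length] at this
  lia

/-- Noether normalization: `A` is integral over a polynomial ring in `s` variables, `s` equals the
transcendence degree, and going-up lifts a chain of `s + 1` primes. -/
lemma le_ringKrullDim_of_trdeg [IsDomain A] [Algebra.FiniteType k A] {d : ℕ}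
    (h : Algebra.trdeg k A = d) : (d : WithBot ℕ∞) ≤ ringKrullDim A := by
  obtain ⟨s, g, hinj, hint⟩ := exists_integral_inj_algHom_of_fg k A
  algebraize [g.toRingHom]
  have hft : FaithfulSMul (MvPolynomial (Fin s) k) A :=
    (faithfulSMul_iff_algebraMap_injective _ _).2 hinj
  have hsd : (s : Cardinal.{u}) = d := by
    have hX := (IsTranscendenceBasis.mvPolynomial (Fin s) k).algebraMap_comp (A := A)
    have h2 := hX.lift_cardinalMk_eq_trdeg
    rw [h] at h2
    simpa using h2
  have hdim : ringKrullDim (MvPolynomial (Fin s) k) = s := by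
    rw [MvPolynomial.ringKrullDim_of_isNoetherianRing, ringKrullDim_eq_zero_of_field]; simp
  obtain ⟨l, hl⟩ := Order.le_krullDim_iff.1 hdim.ge
  have := Algebra.HasGoingUp.of_isIntegral (R := MvPolynomial (Fin s) k) (S := A)
  obtain ⟨Q, hQ, hlo⟩ := Ideal.exists_ideal_over_prime_of_isIntegral_of_isDomain
    (S := A) (RelSeries.head l).asIdeal (by
      rw [(RingHom.injective_iff_ker_eq_bot (algebraMap (MvPolynomial (Fin s) k) A)).1
        (FaithfulSMul.algebraMap_injective _ _)]; exact bot_le)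
  have : Q.LiesOver (RelSeries.head l).asIdeal := ⟨hlo.symm⟩
  obtain ⟨L, hL, -⟩ := Ideal.exists_ltSeries_of_hasGoingUp l Q
  have := Order.LTSeries.length_le_krullDim L
  rw [hL, hl] at this
  have : (s : WithBot ℕ∞) ≤ ringKrullDim A := this
  have hsd' : s = d := by exact_mod_cast hsd
  rwa [← hsd']

/-- The rank of a subset of a domain in the matroid of algebraic independence. -/
abbrev algRk (k : Type*) [Field k] {A : Type*} [CommRing A] [IsDomain A] [Algebra k A]
    (S : Set A) : ℕ∞ :=
  (AlgebraicIndependent.matroid k A).eRk S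

variable [IsDomain A]

lemma mem_algClosure_iff {S : Set A} {a : A} :
    a ∈ (AlgebraicIndependent.matroid k A).closure S ↔ IsAlgebraic (Algebra.adjoin k S) a := by
  rw [AlgebraicIndependent.matroid_closure_eq]; rfl

lemma adjoin_subset_algClosure (S : Set A) :
    (Algebra.adjoin k S : Set A) ⊆ (AlgebraicIndependent.matroid k A).closure S := fun a ha =>
  mem_algClosure_iff.2 (isAlgebraic_algebraMap (⟨a, ha⟩ : Algebra.adjoin k S))

/-- The bridge between matroid ranks, in which the combinatorics is done, and transcendence degrees,
which control dimensions. -/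
lemma trdeg_subalgebra {S : Set A} (hS : S.Finite) {B : Subalgebra k A} (hSB : S ⊆ B)
    (hB : (B : Set A) ⊆ (AlgebraicIndependent.matroid k A).closure S) :
    ∃ d : ℕ, algRk k S = d ∧ Algebra.trdeg k B = d := by
  obtain ⟨I, hI⟩ := (AlgebraicIndependent.matroid k A).exists_isBasis S
  have hIS : I ⊆ S := hI.subset
  have hIfin := hS.subset hIS
  have hrk : algRk k S = I.ncard := by rw [algRk, hI.eRk_eq_encard, hIfin.cast_ncard_eq]
  refine ⟨I.ncard, hrk, le_antisymm ?_ ?_⟩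
  · obtain ⟨u, hu⟩ := exists_isTranscendenceBasis k B
    have hind : AlgebraicIndependent k (B.val ∘ fun i : u => i.1) :=
      hu.1.map' Subtype.val_injective
    have h1 : (Set.range (B.val ∘ fun i : u => i.1)).encard ≤ I.ncard := by
      rw [← hrk, algRk, ← Matroid.eRk_closure_eq]
      refine Matroid.Indep.encard_le_eRk_of_subset ?_ (Set.range_subset_iff.2 fun i => hB i.1.2)
      exact hind.to_subtype_range
    rw [← Set.image_univ, (Function.Injective.injOn hind.injective).encard_image,
      Set.encard_univ] at h1
    rw [← hu.cardinalMk_eq_trdeg]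
    have h2 : ENat.card u ≤ I.ncard := h1
    rw [ENat.card] at h2
    exact Cardinal.toENat_le_natCast.1 h2
  · obtain ⟨h1, h2, h3⟩ := AlgebraicIndependent.matroid_isBasis_iff.1 hI
    have hind : AlgebraicIndependent k fun i : I => (⟨i.1, hSB (hIS i.2)⟩ : B) :=
      AlgebraicIndependent.of_comp B.val h1
    rw [Set.cast_ncard hIfin]
    exact hind.cardinalMk_le_trdeg

/-! ### Krull dimension of topological spaces -/

/-- All members of a chain of irreducible closed sets contain a point of the smallest one, so the
chain stays strict after intersection with an open neighbourhood of that point. -/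
lemma topologicalKrullDim_le_of_cover {T : Type*} [TopologicalSpace T] {d : WithBot ℕ∞}
    (h : ∀ x : T, ∃ U : Set T, IsOpen U ∧ x ∈ U ∧ topologicalKrullDim U ≤ d) :
    topologicalKrullDim T ≤ d := by
  refine iSup_le fun l => ?_
  obtain ⟨x, hx⟩ := l.head.2.nonempty
  obtain ⟨U, hU, hxU, hd⟩ := h x
  refine le_trans ?_ hd
  have hemb := hU.isOpenEmbedding_subtypeVal
  let e := IrreducibleCloseds.orderIsoOfIsOpenEmbedding _ hemb
  let l' : LTSeries {V : IrreducibleCloseds T | ((Subtype.val : U → T) ⁻¹' V).Nonempty} :=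
    { length := l.length
      toFun := fun i => ⟨l i, ⟨x, hxU⟩, LTSeries.head_le l i hx⟩
      step := fun i => l.step i }
  exact Order.LTSeries.length_le_krullDim (l'.map _ e.symm.strictMono)

/-- In a Jacobson space a closed set is the closure of its closed points, so restriction to closed
points is injective on irreducible closed sets. This links spectra to sets of complex points. -/
lemma topologicalKrullDim_le_closedPoints (T : Type*) [TopologicalSpace T] [JacobsonSpace T] :
    topologicalKrullDim T ≤ topologicalKrullDim (closedPoints T) := by
  have hcl : ∀ Z : IrreducibleCloseds T, closure ((Z : Set T) ∩ closedPoints T) = Z := fun Z =>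
    closure_inter_closedPoints Z.3
  have him : ∀ Z : IrreducibleCloseds T,
      Subtype.val '' (Subtype.val ⁻¹' (Z : Set T) : Set (closedPoints T)) =
        (Z : Set T) ∩ closedPoints T := fun Z => by
    rw [Subtype.image_preimage_coe, Set.inter_comm]
  let F : IrreducibleCloseds T → IrreducibleCloseds (closedPoints T) := fun Z =>
    { carrier := Subtype.val ⁻¹' (Z : Set T)
      isIrreducible' := by
        have hZ : IsIrreducible ((Z : Set T) ∩ closedPoints T) := by
          rw [← isIrreducible_iff_closure, hcl]
          exact Z.2
        rw [← him] at hZ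
        refine ⟨hZ.1.of_image, ?_⟩
        rintro _ _ ⟨U, hU, rfl⟩ ⟨V, hV, rfl⟩ ⟨u, hu, huU⟩ ⟨v, hv, hvV⟩
        obtain ⟨_, ⟨w, hw, rfl⟩, hwU, hwV⟩ := hZ.2 U V hU hV ⟨u, ⟨u, hu, rfl⟩, huU⟩
          ⟨v, ⟨v, hv, rfl⟩, hvV⟩
        exact ⟨w, hw, hwU, hwV⟩
      isClosed' := Z.3.preimage continuous_subtype_val }
  refine Order.krullDim_le_of_strictMono F (Monotone.strictMono_of_injective
    (fun Z W h => Set.preimage_mono (f := Subtype.val) h) fun Z W h => ?_)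
  have h' : (Subtype.val ⁻¹' (Z : Set T) : Set (closedPoints T)) = Subtype.val ⁻¹' (W : Set T) :=
    congrArg IrreducibleCloseds.carrier h
  apply IrreducibleCloseds.ext
  rw [← hcl Z, ← hcl W, ← him, ← him, h']

end Dimension

end LinearSeries
end

noncomputable section

namespace LinearSeries

/-! ### Complex points of finitely generated algebras -/

section Points

lemma exists_algHom_of_isMaximal {B : Type*} [CommRing B] [Algebra ℂ B] [Algebra.FiniteType ℂ B]
    (M : Ideal B) [hM : M.IsMaximal] : ∃ φ : B →ₐ[ℂ] ℂ, RingHom.ker φ = M := by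
  let := Ideal.Quotient.field M
  have := finite_of_finite_type_of_isJacobsonRing ℂ (B ⧸ M)
  have hbij := IsAlgClosed.algebraMap_bijective_of_isIntegral (k := ℂ) (K := B ⧸ M)
  let e : ℂ ≃ₐ[ℂ] B ⧸ M := AlgEquiv.ofBijective (Algebra.ofId ℂ (B ⧸ M)) hbij
  refine ⟨e.symm.toAlgHom.comp (Ideal.Quotient.mkₐ ℂ M), ?_⟩
  ext b
  simp [RingHom.mem_ker, Ideal.Quotient.eq_zero_iff_mem]

/-- Chevalley: the image of `Spec B` is constructible and contains the generic point of `Spec A`,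
hence contains a nonempty basic open set. Over a maximal ideal one can then pick a maximal ideal of
`B`, which is a complex point by the Nullstellensatz. -/
lemma exists_forall_isMaximal_exists_algHom {A B : Type*} [CommRing A] [IsDomain A] [CommRing B] [IsDomain B]
    [Algebra ℂ A] [Algebra ℂ B] [Algebra.FiniteType ℂ A] [Algebra.FiniteType ℂ B]
    (i : A →ₐ[ℂ] B) (hi : Function.Injective i) :
    ∃ a : A, a ≠ 0 ∧ ∀ P : Ideal A, P.IsMaximal → a ∉ P →
      ∃ φ : B →ₐ[ℂ] ℂ, RingHom.ker (φ.comp i) = P := by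
  algebraize [i.toRingHom]
  have hT : IsScalarTower ℂ A B := .of_algebraMap_eq fun c => (i.commutes c).symm
  have hft : Algebra.FiniteType A B := .of_restrictScalars_finiteType ℂ A B
  have : IsNoetherianRing A := Algebra.FiniteType.isNoetherianRing ℂ A
  have hfp : (algebraMap A B).FinitePresentation :=
    RingHom.FinitePresentation.of_finiteType.1 ((RingHom.finiteType_algebraMap).2 hft)
  obtain ⟨S, hS⟩ := PrimeSpectrum.exists_constructibleSetData_iff.2
    (PrimeSpectrum.isConstructible_range_comap hfp)
  have hbot : (⊥ : PrimeSpectrum A) ∈ Set.range (PrimeSpectrum.comap (algebraMap A B)) := by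
    refine ⟨⊥, PrimeSpectrum.ext ?_⟩
    exact (RingHom.injective_iff_ker_eq_bot (algebraMap A B)).1 hi
  rw [← hS, PrimeSpectrum.ConstructibleSetData.toSet] at hbot
  simp only [Set.mem_iUnion] at hbot
  obtain ⟨C, hC, hb, hb'⟩ := hbot
  -- The constructible piece containing the zero ideal is cut out by zero equations, so it is the
  -- basic open set of `C.f`.
  have hg : ∀ j, C.g j = 0 := fun j => by simpa using hb ⟨j, rfl⟩
  have hf : C.f ≠ 0 := by simpa using hb'
  refine ⟨C.f, hf, fun P hP ha => ?_⟩
  have hPr : (⟨P, hP.isPrime⟩ : PrimeSpectrum A) ∈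
      Set.range (PrimeSpectrum.comap (algebraMap A B)) := by
    rw [← hS, PrimeSpectrum.ConstructibleSetData.toSet]
    refine Set.mem_iUnion₂.2 ⟨C, hC, ?_, by simpa using ha⟩
    rintro _ ⟨j, rfl⟩
    simp [hg]
  obtain ⟨Q, hQ⟩ := hPr
  obtain ⟨M, hM, hQM⟩ := Ideal.exists_le_maximal Q.asIdeal Q.2.ne_top
  obtain ⟨φ, hφ⟩ := exists_algHom_of_isMaximal M
  refine ⟨φ, ?_⟩
  have h1 : RingHom.ker (φ.comp i) = M.comap (algebraMap A B) := by
    ext a; simp [← hφ, RingHom.mem_ker]; rfl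
  rw [h1]
  refine (hP.eq_of_le (Ideal.comap_ne_top _ hM.ne_top) ?_).symm
  exact (congrArg PrimeSpectrum.asIdeal hQ).ge.trans (Ideal.comap_mono hQM)

lemma trdeg_localizationAway {A : Type*} [CommRing A] [IsDomain A] [Algebra ℂ A] {a : A}
    (ha : a ≠ 0) : Algebra.trdeg ℂ (Localization.Away a) = Algebra.trdeg ℂ A := by
  have hle : Submonoid.powers a ≤ nonZeroDivisors A :=
    powers_le_nonZeroDivisors_of_noZeroDivisors ha
  have : IsDomain (Localization.Away a) := IsLocalization.isDomain_localization hle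
  have : Algebra.IsAlgebraic A (Localization.Away a) :=
    IsLocalization.isAlgebraic _ (Submonoid.powers a)
  have : FaithfulSMul A (Localization.Away a) :=
    (faithfulSMul_iff_algebraMap_injective _ _).2 (IsLocalization.injective _ hle)
  have : FaithfulSMul ℂ A := (faithfulSMul_iff_algebraMap_injective ℂ A).2 (RingHom.injective _)
  obtain ⟨s, hs⟩ := exists_isTranscendenceBasis ℂ A
  rw [← hs.cardinalMk_eq_trdeg, ← (hs.algebraMap_comp (A := Localization.Away a)).cardinalMk_eq_trdeg]

end Points

/-! ### Polynomial functions -/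

section PolyFun

variable {V : Type*} [AddCommGroup V] [Module ℂ V] {ι : Type*}

lemma aeval_coord_apply (b : Module.Basis ι ℂ V) (P : MvPolynomial ι ℂ) (v : V) :
    MvPolynomial.aeval (fun i => (b.coord i : V → ℂ)) P v = MvPolynomial.eval (b.repr v) P := by
  exact MvPolynomial.comp_aeval_apply (f := fun i => (b.coord i : V → ℂ))
    (Pi.evalAlgHom ℂ (fun _ : V => ℂ) v) P

/-- Polynomial functions are polynomials in the coordinates with respect to a basis. -/
def polyFunEquiv [Finite ι] (b : Module.Basis ι ℂ V) : MvPolynomial ι ℂ ≃ₐ[ℂ] polyFun V :=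
  (AlgEquiv.ofInjective (MvPolynomial.aeval fun i => (b.coord i : V → ℂ)) (by
    have := Fintype.ofFinite ι
    rw [injective_iff_map_eq_zero]
    intro P hP
    refine MvPolynomial.funext fun x => ?_
    have := congrFun hP (b.equivFun.symm x)
    rw [aeval_coord_apply] at this
    have hx : ⇑(b.repr (b.equivFun.symm x)) = x := b.equivFun.apply_symm_apply x
    rw [hx] at this
    simpa using this)).trans (Subalgebra.equivOfEq _ _ (by
    have := Fintype.ofFinite ι
    rw [← Algebra.adjoin_range_eq_range_aeval, polyFun]
    refine le_antisymm (Algebra.adjoin_mono ?_) (Algebra.adjoin_le ?_)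
    · rintro _ ⟨i, rfl⟩; exact ⟨b.coord i, rfl⟩
    · rintro _ ⟨l, rfl⟩
      have : (l : V → ℂ) = ∑ i, l (b i) • (b.coord i : V → ℂ) := by
        ext v
        conv_lhs => rw [← b.sum_repr v]
        simp only [map_sum, map_smul, Finset.sum_apply, Pi.smul_apply, smul_eq_mul,
          Module.Basis.coord_apply, mul_comm]
      change (l : V → ℂ) ∈ _
      rw [this]
      exact Subalgebra.sum_mem _ fun i _ =>
        Subalgebra.smul_mem _ (Algebra.subset_adjoin (Set.mem_range_self i)) _))

lemma polyFunEquiv_apply [Finite ι] (b : Module.Basis ι ℂ V) (P : MvPolynomial ι ℂ) (v : V) :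
    (polyFunEquiv b P).1 v = MvPolynomial.eval (b.repr v) P := by
  exact aeval_coord_apply b P v

/-- A linear form, as a polynomial function. -/
def linFun (l : Module.Dual ℂ V) : polyFun V := ⟨l, Algebra.subset_adjoin ⟨l, rfl⟩⟩

lemma polyFunEquiv_X [Finite ι] (b : Module.Basis ι ℂ V) (i : ι) :
    polyFunEquiv b (MvPolynomial.X i) = linFun (b.coord i) := by
  ext v
  rw [polyFunEquiv_apply]
  simp [linFun]

/-- Evaluation of polynomial functions at a point. -/
def evalAt (v : V) : polyFun V →ₐ[ℂ] ℂ := (Pi.evalAlgHom ℂ (fun _ : V => ℂ) v).comp (polyFun V).val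

@[simp] lemma evalAt_apply (v : V) (f : polyFun V) : evalAt v f = f.1 v := rfl

end PolyFun

/-! ### The dimension of spaces of points -/

section PointSpaces

variable {V : Type*} [AddCommGroup V] [Module ℂ V] {T : Type*} {σ : T → V}
  {D : Type*} [CommRing D] [Algebra ℂ D] {Θ : polyFun V →ₐ[ℂ] D}

/-- The evaluation at a point at which all polynomial functions in the kernel of `Θ` vanish,
as a homomorphism on the range of `Θ`. -/
def rangeEval (h : ∀ f, Θ f = 0 → ∀ t, f.1 (σ t) = 0) (t : T) : Θ.range →ₐ[ℂ] ℂ :=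
  Θ.rangeRestrict.liftOfSurjective Θ.rangeRestrict_surjective (evalAt (σ t)) (by
    intro f hf
    exact h f (congrArg Subtype.val hf) t)

lemma rangeEval_apply (h : ∀ f, Θ f = 0 → ∀ t, f.1 (σ t) = 0) (t : T) (f : polyFun V) :
    rangeEval h t ⟨Θ f, f, rfl⟩ = f.1 (σ t) :=
  AlgHom.liftOfSurjective_apply ..

/-- The point of the spectrum of the range of `Θ` given by evaluation at a point. -/
def rangePoint (h : ∀ f, Θ f = 0 → ∀ t, f.1 (σ t) = 0) (t : T) : PrimeSpectrum Θ.range :=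
  ⟨RingHom.ker (rangeEval h t), RingHom.ker_isPrime _⟩

variable [tT : TopologicalSpace T]

/-- Under `rangePoint` the basic open set of `Θ f` pulls back to the locus where `f ∘ σ` is nonzero,
and such loci generate both topologies. -/
lemma isInducing_rangePoint (hσ : tT = (zariski V).induced σ)
    (h : ∀ f, Θ f = 0 → ∀ t, f.1 (σ t) = 0) : Topology.IsInducing (rangePoint h) := by
  constructor
  rw [hσ, zariski, induced_generateFrom_eq,
    PrimeSpectrum.isTopologicalBasis_basic_opens.eq_generateFrom, induced_generateFrom_eq]
  congr 1
  ext U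
  constructor
  · rintro ⟨_, ⟨f, hf, rfl⟩, rfl⟩
    refine ⟨_, ⟨⟨Θ ⟨f, hf⟩, _, rfl⟩, rfl⟩, ?_⟩
    ext t
    exact not_congr (Eq.congr_left (rangeEval_apply h t ⟨f, hf⟩))
  · rintro ⟨_, ⟨⟨_, f, rfl⟩, rfl⟩, rfl⟩
    refine ⟨_, ⟨f.1, f.2, rfl⟩, ?_⟩
    ext t
    exact (not_congr (Eq.congr_left (rangeEval_apply h t f))).symm

lemma topologicalKrullDim_le_range (hσ : tT = (zariski V).induced σ)
    (h : ∀ f, Θ f = 0 → ∀ t, f.1 (σ t) = 0) :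
    topologicalKrullDim T ≤ ringKrullDim Θ.range :=
  (isInducing_rangePoint hσ h).topologicalKrullDim_le.trans
    (PrimeSpectrum.topologicalKrullDim_eq_ringKrullDim _).le

/-- `T` need not contain every point of the closure: it suffices that it realizes the complex points
of some `B` above the range of `Θ`. By Chevalley these hit all closed points of a basic open set of
the spectrum of the range, which already has full dimension. -/
lemma trdeg_le_topologicalKrullDim [IsDomain D] (hσ : tT = (zariski V).induced σ)
    (h : ∀ f, Θ f = 0 → ∀ t, f.1 (σ t) = 0) [Algebra.FiniteType ℂ Θ.range]
    (B : Subalgebra ℂ D) [Algebra.FiniteType ℂ B] (hB : Θ.range ≤ B)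
    (hpt : ∀ φ : B →ₐ[ℂ] ℂ, ∃ t, ∀ f, f.1 (σ t) = φ ⟨Θ f, hB ⟨f, rfl⟩⟩)
    {d : ℕ} (hd : Algebra.trdeg ℂ Θ.range = d) :
    (d : WithBot ℕ∞) ≤ topologicalKrullDim T := by
  obtain ⟨a, ha0, ha⟩ := exists_forall_isMaximal_exists_algHom (Subalgebra.inclusion hB)
    (Subalgebra.inclusion_injective hB)
  have : IsJacobsonRing Θ.range := isJacobsonRing_of_finiteType (A := ℂ)
  have : Algebra.FiniteType Θ.range (Localization.Away a) :=

    have := IsLocalization.Away.finitePresentation (S := Localization.Away a) a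
    .of_finitePresentation
  have : Algebra.FiniteType ℂ (Localization.Away a) :=
    Algebra.FiniteType.trans (S := Θ.range) inferInstance inferInstance
  have : IsJacobsonRing (Localization.Away a) := isJacobsonRing_of_finiteType (A := ℂ)
  have : IsDomain (Localization.Away a) := IsLocalization.isDomain_localization
    (powers_le_nonZeroDivisors_of_noZeroDivisors ha0)
  have hle := le_ringKrullDim_of_trdeg ((trdeg_localizationAway ha0).trans hd)
  refine hle.trans ?_
  rw [← PrimeSpectrum.topologicalKrullDim_eq_ringKrullDim]
  refine (topologicalKrullDim_le_closedPoints _).trans ?_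
  have hemb := PrimeSpectrum.localization_away_isOpenEmbedding (Localization.Away a) a
  -- Closed points of the basic open set remain closed in the Jacobson spectrum, so they lift to
  -- points of `B` and hence to points of `T`.
  have key : ∀ c : closedPoints (PrimeSpectrum (Localization.Away a)),
      ∃ t, rangePoint h t = PrimeSpectrum.comap (algebraMap _ _) c.1 := fun c => by
    have hc := hemb.preimage_closedPoints.ge c.2
    have hmax : (PrimeSpectrum.comap (algebraMap Θ.range (Localization.Away a)) c.1).asIdeal.IsMaximal :=
      (PrimeSpectrum.isClosed_singleton_iff_isMaximal _).1 hc
    have hac : a ∉ (PrimeSpectrum.comap (algebraMap Θ.range (Localization.Away a)) c.1).asIdeal := by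
      have : PrimeSpectrum.comap (algebraMap Θ.range (Localization.Away a)) c.1 ∈
          Set.range (PrimeSpectrum.comap (algebraMap Θ.range (Localization.Away a))) := ⟨_, rfl⟩
      rwa [PrimeSpectrum.localization_away_comap_range _ a] at this
    obtain ⟨φ, hφ⟩ := ha _ hmax hac
    obtain ⟨t, ht⟩ := hpt φ
    refine ⟨t, PrimeSpectrum.ext ?_⟩
    rw [← hφ]
    ext ⟨_, f, rfl⟩
    exact Eq.congr_left ((rangeEval_apply h t f).trans (ht f))
  choose τ hτ using key
  have hind : Topology.IsInducing τ := by
    rw [← (isInducing_rangePoint hσ h).of_comp_iff]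
    have : rangePoint h ∘ τ = PrimeSpectrum.comap (algebraMap _ _) ∘ Subtype.val := funext hτ
    rw [this]
    exact hemb.isInducing.comp Topology.IsInducing.subtypeVal
  exact hind.topologicalKrullDim_le

end PointSpaces

end LinearSeries
end

noncomputable section

set_option linter.unusedSectionVars false

namespace LinearSeries

/-! ### Ranks of generic linear combinations -/

section Closure

variable {k : Type*} [Field k] {A B : Type*} [CommRing A] [IsDomain A] [Algebra k A]
  [CommRing B] [IsDomain B] [Algebra k B]

lemma algClosure_map {S : Set A} {a : A} (g : A →ₐ[k] B) (hg : Function.Injective g)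
    (ha : a ∈ (AlgebraicIndependent.matroid k A).closure S) :
    g a ∈ (AlgebraicIndependent.matroid k B).closure (g '' S) := by
  rw [mem_algClosure_iff] at ha ⊢
  let g' : Algebra.adjoin k S →+* Algebra.adjoin k (g '' S) :=
    ((g.comp (Algebra.adjoin k S).val).codRestrict (Algebra.adjoin k (g '' S)) (fun x => by
      rw [← AlgHom.map_adjoin]
      exact ⟨x.1, x.2, rfl⟩)).toRingHom
  exact ha.ringHom_of_comp_eq g' g.toRingHom (fun x y h => Subtype.ext (hg (congrArg Subtype.val h)))
    rfl

lemma algRk_image_le {S : Set A} (g : A →ₐ[k] B) (hg : Function.Injective g) :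
    algRk k (g '' S) ≤ algRk k S := by
  obtain ⟨I, hI⟩ := (AlgebraicIndependent.matroid k A).exists_isBasis S
  have hS : g '' S ⊆ (AlgebraicIndependent.matroid k B).closure (g '' I) := by
    rintro _ ⟨a, ha, rfl⟩
    exact algClosure_map g hg (hI.subset_closure ha)
  calc algRk k (g '' S) ≤ algRk k (g '' I) := by
        rw [algRk, algRk, ← Matroid.eRk_closure_eq _ (g '' I)]
        exact Matroid.eRk_mono _ hS
    _ ≤ (g '' I).encard := Matroid.eRk_le_encard _ _
    _ ≤ I.encard := Set.encard_image_le _ _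
    _ = algRk k S := hI.encard_eq_eRk

lemma algRk_le_of_subset_closure {S T : Set A}
    (h : S ⊆ (AlgebraicIndependent.matroid k A).closure T) : algRk k S ≤ algRk k T := by
  rw [algRk, algRk, ← Matroid.eRk_closure_eq _ T]
  exact Matroid.eRk_mono _ h

lemma subset_algClosure (S : Set A) : S ⊆ (AlgebraicIndependent.matroid k A).closure S :=
  Algebra.subset_adjoin.trans (adjoin_subset_algClosure S)

/-- The variables are independent over `K`, so they may be added to any algebraically independent
subset of `K`. -/
lemma card_add_algRk_le {τ : Type*} [Fintype τ] {K : Type*} [Field K] [Algebra k K] (S : Set K) :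
    (Fintype.card τ : ℕ∞) + algRk k S ≤
      algRk k (Set.range (MvPolynomial.X : τ → MvPolynomial τ K) ∪ MvPolynomial.C '' S) := by
  obtain ⟨I, hI⟩ := (AlgebraicIndependent.matroid k K).exists_isBasis S
  have h1 : AlgebraicIndependent k fun i : I => i.1 := hI.indep
  have h2 := h1.sumElim_comp (MvPolynomial.algebraicIndependent_X τ K)
  rw [algRk, ← hI.encard_eq_eRk]
  have h3 := Matroid.Indep.encard_le_eRk_of_subset
    (AlgebraicIndependent.matroid_indep_iff.2 h2.to_subtype_range)
    (X := Set.range (MvPolynomial.X : τ → MvPolynomial τ K) ∪ MvPolynomial.C '' S) (by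
      rintro _ ⟨i | i, rfl⟩
      · exact Or.inl ⟨i, rfl⟩
      · exact Or.inr ⟨i.1, hI.subset i.2, rfl⟩)
  refine le_trans (le_of_eq ?_) h3
  rw [← Set.image_univ, (Function.Injective.injOn h2.injective).encard_image, Set.encard_univ,
    ENat.card_sum]
  simp [ENat.card_eq_coe_fintype_card, Set.encard, -ENat.card_coe_set_eq, add_comm]

end Closure

/-! ### Generic linear forms and a Rado-type rank theorem. -/

section Generic

variable {I : Type*} [Fintype I] [DecidableEq I] {ι : I → Type*} [∀ j, Fintype (ι j)]
  [∀ j, DecidableEq (ι j)]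

/-- The coordinates other than the distinguished ones. -/
abbrev FreeIdx (a : ∀ j, ι j) : Type _ := {p : Σ j, ι j // p.2 ≠ a p.1}

variable {R : Type*} [CommRing R] (a : ∀ j, ι j)

/-- The value of the distinguished coordinate of a generic point of the hyperplane
`∑ b, φ j b * u b = 0`, where `φ j (a j) = 1`. -/
def genForm (φ : ∀ j, ι j → R) (j : I) : MvPolynomial (FreeIdx a) R :=
  -∑ b : {b : ι j // b ≠ a j}, MvPolynomial.C (φ j b) * MvPolynomial.X ⟨⟨j, b.1⟩, b.2⟩

/-- The generic point of the product of the hyperplanes `∑ b, φ j b * u b = 0`, where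
`φ j (a j) = 1`. -/
def genPt (φ : ∀ j, ι j → R) (p : Σ j, ι j) : MvPolynomial (FreeIdx a) R :=
  if h : p.2 ≠ a p.1 then MvPolynomial.X ⟨p, h⟩ else genForm a φ p.1

variable {K : Type*} [Field K] (φ : ∀ j, ι j → K)

/-- The values of `φ j` for `j ∈ J`. -/
def valSet (J : Finset I) : Set K := {z | ∃ j ∈ J, ∃ b, z = φ j b}

variable [Algebra ℂ K]

/-- The translation of one of the variables by `c`. -/
def shift (p : FreeIdx a) (c : K) :
    MvPolynomial (FreeIdx a) K →ₐ[K] MvPolynomial (FreeIdx a) K :=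
  MvPolynomial.aeval fun q => MvPolynomial.X q + if q = p then MvPolynomial.C c else 0

lemma shift_injective (p : FreeIdx a) : Function.Injective (shift (K := K) a p 1) := by
  refine Function.LeftInverse.injective (g := shift a p (-1)) fun P => ?_
  have : (shift a p (-1)).comp (shift a p 1) = AlgHom.id K (MvPolynomial (FreeIdx a) K) := by
    ext q
    by_cases h : q = p <;> simp [shift, h]
  exact congrArg (fun g => g P) this

lemma shift_genForm_of_ne (p : FreeIdx a) {j : I} (h : j ≠ p.1.1) :
    shift a p 1 (genForm a φ j) = genForm a φ j := by
  have : ∀ b : {b : ι j // b ≠ a j}, (⟨⟨j, b.1⟩, b.2⟩ : FreeIdx a) ≠ p := by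
    rintro b rfl; exact h rfl
  simp [genForm, shift, this, MvPolynomial.algHom_C]

lemma shift_genForm_self (p : FreeIdx a) :
    shift a p 1 (genForm a φ p.1.1) = genForm a φ p.1.1 - MvPolynomial.C (φ p.1.1 p.1.2) := by
  obtain ⟨⟨j, b⟩, hb⟩ := p
  have : ∀ b' : {b : ι j // b ≠ a j}, ((⟨⟨j, b'.1⟩, b'.2⟩ : FreeIdx a) = ⟨⟨j, b⟩, hb⟩) ↔
    b' = ⟨b, hb⟩ := fun b' => by simp [Subtype.ext_iff]
  simp [genForm, shift, this, MvPolynomial.algHom_C, mul_add, Finset.sum_add_distrib]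
  ring

/-- The free variables together with some of the generic forms. -/
def formSet (J : Finset I) : Set (MvPolynomial (FreeIdx a) K) :=
  Set.range MvPolynomial.X ∪ genForm a φ '' J

/-- Translating the variable `p` by 1 is an injective endomorphism which preserves the closure of
`formSet a φ J` but subtracts `φ p` from the form with index `p.1.1`. So both the form and its
translate are algebraic over the set, and so is their difference. -/
lemma C_mem_closure_of_genForm_mem (p : FreeIdx a) (J : Finset I) (hp : p.1.1 ∉ J)
    (h : genForm a φ p.1.1 ∈ (AlgebraicIndependent.matroid ℂ _).closure (formSet a φ J)) :
    MvPolynomial.C (φ p.1.1 p.1.2) ∈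
      (AlgebraicIndependent.matroid ℂ _).closure (formSet a φ J) := by
  have h1 := algClosure_map ((shift (K := K) a p 1).restrictScalars ℂ) (shift_injective a p) h
  have h2 : ((shift (K := K) a p 1).restrictScalars ℂ) '' formSet a φ J ⊆
      (AlgebraicIndependent.matroid ℂ _).closure (formSet a φ J) := by
    rintro _ ⟨_, ⟨q, rfl⟩ | ⟨j, hj, rfl⟩, rfl⟩
    · refine adjoin_subset_algClosure _ ?_
      have : (shift a p 1) (MvPolynomial.X q : MvPolynomial (FreeIdx a) K) =
        MvPolynomial.X q + if q = p then 1 else 0 := by simp [shift]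
      change (shift a p 1) (MvPolynomial.X q) ∈ _
      rw [this]
      refine add_mem (Algebra.subset_adjoin (Or.inl ⟨q, rfl⟩)) ?_
      split_ifs
      · exact one_mem _
      · exact zero_mem _
    · have hj' : j ≠ p.1.1 := fun e => hp (e ▸ hj)
      change shift a p 1 (genForm a φ j) ∈ _
      rw [shift_genForm_of_ne a φ p hj']
      exact subset_algClosure _ (Or.inr ⟨j, hj, rfl⟩)
  have h3 := Matroid.closure_subset_closure_of_subset_closure h2 h1
  change shift a p 1 (genForm a φ p.1.1) ∈ _ at h3
  rw [shift_genForm_self] at h3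
  rw [mem_algClosure_iff] at h h3 ⊢
  simpa using h.sub h3

/-- A version of Rado's theorem for generic linear combinations of elements of a field. -/
lemma card_le_algRk_genPt (hφ : ∀ j, φ j (a j) = 1)
    (h : ∀ J : Finset I, (J.card : ℕ∞) ≤ algRk ℂ (valSet φ J) + 1) :
    (Fintype.card (Σ j, ι j) : ℕ∞) ≤ algRk ℂ (Set.range (genPt a φ)) + 1 := by
  by_contra! hlt
  let r : Finset I → ℕ∞ := fun J => algRk ℂ (formSet a φ J)
  have hcard : Fintype.card (Σ j, ι j) = Fintype.card (FreeIdx a) + Fintype.card I := by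
    rw [← Fintype.card_sum]
    refine Fintype.card_congr
      ((Equiv.sumCompl fun p : Σ j, ι j => p.2 ≠ a p.1).symm.trans (Equiv.sumCongr (Equiv.refl _) ?_))
    exact
      { toFun := fun p => p.1.1
        invFun := fun j => ⟨⟨j, a j⟩, by simp⟩
        left_inv := by
          rintro ⟨⟨j, b⟩, hb⟩
          simp only [ne_eq, not_not] at hb
          subst hb; rfl
        right_inv := fun j => rfl }
  have huniv : formSet a φ Finset.univ ⊆ Set.range (genPt a φ) := by
    rintro _ (⟨q, rfl⟩ | ⟨j, -, rfl⟩)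
    · exact ⟨q.1, by simp [genPt, q.2]⟩
    · exact ⟨⟨j, a j⟩, by simp [genPt]⟩
  have hex : ∃ J : Finset I, r J + 1 < Fintype.card (FreeIdx a) + J.card := by
    refine ⟨Finset.univ, lt_of_le_of_lt ?_ (hlt.trans_eq (by rw [hcard]; simp))⟩
    gcongr
    exact Matroid.eRk_mono _ huniv
  -- In a minimal violating `J` every form depends on the others: dropping an independent one would
  -- lower both sides by one and keep the strict inequality.
  obtain ⟨J, hJ, hmin⟩ := exists_minimal_of_wellFoundedLT _ hex
  have hrtop : r J ≠ ⊤ := fun e => by simp [e] at hJ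
  have hmem : ∀ i ∈ J, genForm a φ i ∈
      (AlgebraicIndependent.matroid ℂ _).closure (formSet a φ (J.erase i)) := fun i hi => by
    by_contra hcl
    have hins : insert (genForm a φ i) (formSet a φ (J.erase i)) = formSet a φ J := by
      rw [formSet, ← Set.union_insert, ← Set.image_insert_eq, ← Finset.coe_insert,
        Finset.insert_erase hi]; rfl
    have h1 := (AlgebraicIndependent.matroid ℂ _).eRk_insert_eq_add_one ⟨Set.mem_univ _, hcl⟩
    rw [hins] at h1
    have h2 : ¬ (J ≤ J.erase i) := fun hle => Finset.notMem_erase i J (hle hi)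
    refine h2 (hmin (y := J.erase i) ?_ (Finset.erase_subset i J))
    have h3 : r J = r (J.erase i) + 1 := h1
    rw [h3] at hJ
    have h4 := Finset.card_erase_add_one hi
    rw [← h4] at hJ
    push_cast at hJ
    rw [← add_assoc] at hJ
    exact lt_of_add_lt_add_right hJ
  -- Hence all the values `φ j b` with `j ∈ J` are algebraic over the forms and variables, which
  -- forces the rank up to `|FreeIdx| + rk (valSet φ J)` and contradicts the choice of `J`.
  have hval : Set.range (MvPolynomial.X : FreeIdx a → MvPolynomial (FreeIdx a) K) ∪
      MvPolynomial.C '' valSet φ J ⊆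
        (AlgebraicIndependent.matroid ℂ _).closure (formSet a φ J) := by
    rintro _ (⟨q, rfl⟩ | ⟨_, ⟨j, hj, b, rfl⟩, rfl⟩)
    · exact subset_algClosure _ (Or.inl ⟨q, rfl⟩)
    · by_cases hb : b = a j
      · subst hb
        rw [hφ, map_one]
        exact adjoin_subset_algClosure _ (one_mem _)
      · refine Matroid.closure_subset_closure _ ?_ (C_mem_closure_of_genForm_mem a φ ⟨⟨j, b⟩, hb⟩
          (J.erase j) (Finset.notMem_erase j J) (hmem j hj))
        exact Set.union_subset_union_right _ (Set.image_mono (Finset.erase_subset j J))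
  have h1 := (card_add_algRk_le (τ := FreeIdx a) (k := ℂ) (valSet φ J)).trans
    (algRk_le_of_subset_closure hval)
  have h2 : (Fintype.card (FreeIdx a) : ℕ∞) + J.card ≤ r J + 1 :=
    calc (Fintype.card (FreeIdx a) : ℕ∞) + J.card
        ≤ Fintype.card (FreeIdx a) + (algRk ℂ (valSet φ J) + 1) := by gcongr; exact h J
      _ = Fintype.card (FreeIdx a) + algRk ℂ (valSet φ J) + 1 := (add_assoc _ _ _).symm
      _ ≤ r J + 1 := by gcongr
  exact absurd hJ (not_lt.2 h2)

/-- The coordinates over `J` are polynomials in the values over `J` and the free variables over `J`,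
and there are `|J|` fewer free variables than coordinates. -/
lemma algRk_genPt_add_card_le (J : Finset I) :
    algRk ℂ (genPt a φ '' {p | p.1 ∈ J}) + J.card ≤
      Fintype.card {p : Σ j, ι j // p.1 ∈ J} + algRk ℂ (valSet φ J) := by
  have hcard : Fintype.card {p : Σ j, ι j // p.1 ∈ J} =
      Fintype.card {q : FreeIdx a // q.1.1 ∈ J} + J.card := by
    rw [← Fintype.card_coe J, ← Fintype.card_sum]
    refine Fintype.card_congr ?_
    exact
      { toFun := fun p => if h : p.1.2 ≠ a p.1.1 then .inl ⟨⟨p.1, h⟩, p.2⟩ else .inr ⟨p.1.1, p.2⟩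
        invFun := Sum.elim (fun q => ⟨q.1.1, q.2⟩) fun j => ⟨⟨j.1, a j.1⟩, j.2⟩
        left_inv := by
          rintro ⟨⟨j, b⟩, hj⟩
          by_cases hb : b = a j
          · subst hb; simp
          · simp [hb]
        right_inv := by
          rintro (⟨⟨⟨j, b⟩, hb⟩, hj⟩ | ⟨j, hj⟩)
          · have : b ≠ a j := hb
            simp [this]
          · simp }
  let X' : Set (MvPolynomial (FreeIdx a) K) :=
    Set.range fun q : {q : FreeIdx a // q.1.1 ∈ J} => MvPolynomial.X q.1
  have hsub : genPt a φ '' {p | p.1 ∈ J} ⊆ (AlgebraicIndependent.matroid ℂ _).closure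
      (X' ∪ MvPolynomial.C '' valSet φ J) := by
    rintro _ ⟨⟨j, b⟩, hj, rfl⟩
    refine adjoin_subset_algClosure _ ?_
    rw [genPt]
    split_ifs with hb
    · exact Algebra.subset_adjoin (Or.inl ⟨⟨⟨⟨j, b⟩, hb⟩, hj⟩, rfl⟩)
    · refine neg_mem (sum_mem fun b' _ => mul_mem ?_ ?_)
      · exact Algebra.subset_adjoin (Or.inr ⟨_, ⟨j, hj, b'.1, rfl⟩, rfl⟩)
      · exact Algebra.subset_adjoin (Or.inl ⟨⟨⟨⟨j, b'.1⟩, b'.2⟩, hj⟩, rfl⟩)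
  have h1 : algRk ℂ (genPt a φ '' {p | p.1 ∈ J}) ≤
      Fintype.card {q : FreeIdx a // q.1.1 ∈ J} + algRk ℂ (valSet φ J) := by
    refine (algRk_le_of_subset_closure hsub).trans ((Matroid.eRk_union_le_eRk_add_eRk _ _ _).trans ?_)
    refine add_le_add ((Matroid.eRk_le_encard _ _).trans ?_) ?_
    · rw [← ENat.card_eq_coe_fintype_card]
      simp only [X', ← Set.image_univ, ← Set.encard_univ]
      exact Set.encard_image_le _ _
    · exact algRk_image_le (IsScalarTower.toAlgHom ℂ K (MvPolynomial (FreeIdx a) K))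
        (MvPolynomial.C_injective _ _)
  rw [hcard]
  push_cast
  rw [add_right_comm]
  gcongr

/-- Each coordinate outside `J` raises the rank by at most one. -/
lemma algRk_range_genPt_add_card_le (J : Finset I) :
    algRk ℂ (Set.range (genPt a φ)) + J.card ≤
      Fintype.card (Σ j, ι j) + algRk ℂ (valSet φ J) := by
  have h1 : Set.range (genPt a φ) ⊆
      genPt a φ '' {p | p.1 ∈ J} ∪ genPt a φ '' {p | p.1 ∉ J} := by
    rintro _ ⟨p, rfl⟩
    by_cases hp : p.1 ∈ J
    · exact Or.inl ⟨p, hp, rfl⟩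
    · exact Or.inr ⟨p, hp, rfl⟩
  have h2 : algRk ℂ (Set.range (genPt a φ)) ≤ algRk ℂ (genPt a φ '' {p | p.1 ∈ J}) +
      Fintype.card {p : Σ j, ι j // p.1 ∉ J} := by
    refine (Matroid.eRk_mono _ h1).trans ((Matroid.eRk_union_le_eRk_add_eRk _ _ _).trans ?_)
    gcongr
    refine (Matroid.eRk_le_encard _ _).trans ((Set.encard_image_le _ _).trans (le_of_eq ?_))
    rw [← ENat.card_eq_coe_fintype_card]; rfl
  have h3 : Fintype.card (Σ j, ι j) = Fintype.card {p : Σ j, ι j // p.1 ∈ J} +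
      Fintype.card {p : Σ j, ι j // p.1 ∉ J} := by
    rw [← Fintype.card_sum]
    exact Fintype.card_congr (Equiv.sumCompl _).symm
  calc algRk ℂ (Set.range (genPt a φ)) + J.card
      ≤ algRk ℂ (genPt a φ '' {p | p.1 ∈ J}) + Fintype.card {p : Σ j, ι j // p.1 ∉ J} + J.card := by
        gcongr
    _ = algRk ℂ (genPt a φ '' {p | p.1 ∈ J}) + J.card + Fintype.card {p : Σ j, ι j // p.1 ∉ J} := by
        rw [add_right_comm]
    _ ≤ Fintype.card {p : Σ j, ι j // p.1 ∈ J} + algRk ℂ (valSet φ J) +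
        Fintype.card {p : Σ j, ι j // p.1 ∉ J} := by
        exact add_le_add (algRk_genPt_add_card_le a φ J) le_rfl
    _ = Fintype.card (Σ j, ι j) + algRk ℂ (valSet φ J) := by
        rw [h3]; push_cast; rw [add_right_comm]

end Generic

end LinearSeries
end

noncomputable section

set_option linter.unusedSectionVars false

namespace LinearSeries

/-! ### The ideal of the incidence relation -/

section Incidence

variable {I : Type*} [Fintype I] [DecidableEq I] {ι : I → Type*} [∀ j, Fintype (ι j)]
  [∀ j, DecidableEq (ι j)]

section GenPt

variable {R S : Type*} [CommRing R] [CommRing S] (a : ∀ j, ι j) (φ : ∀ j, ι j → R)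

lemma map_genPt (g : R →+* S) (p : Σ j, ι j) :
    MvPolynomial.map g (genPt a φ p) = genPt a (fun j b => g (φ j b)) p := by
  rw [genPt, genPt]
  split_ifs <;> simp [genForm]

lemma sum_mul_eq_add (j : I) (u : ι j → R) :
    ∑ b, u b * φ j b = u (a j) * φ j (a j) + ∑ b : {b : ι j // b ≠ a j}, u b * φ j b := by
  rw [← Finset.add_sum_erase _ _ (Finset.mem_univ (a j))]
  congr 1
  exact Finset.sum_subtype _ (by simp) _

variable {a φ} in
lemma sum_genPt_mul (hφ : ∀ j, φ j (a j) = 1) (j : I) :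
    ∑ b, genPt a φ ⟨j, b⟩ * MvPolynomial.C (φ j b) = 0 := by
  rw [sum_mul_eq_add a (fun j b => MvPolynomial.C (φ j b)) j fun b => genPt a φ ⟨j, b⟩]
  have : ∀ b : {b : ι j // b ≠ a j}, genPt a φ ⟨j, b.1⟩ = MvPolynomial.X ⟨⟨j, b.1⟩, b.2⟩ :=
    fun b => by simp [genPt, b.2]
  simp only [this]
  simp [genPt, genForm, hφ, mul_comm]

variable {a φ} in
-- Universality of `genPt`: a solution of the linear equations is recovered from its free
-- coordinates, as the coefficient at the pivot is 1.
lemma aeval_genPt_eq (hφ : ∀ j, φ j (a j) = 1) [Algebra R S] (u : (Σ j, ι j) → S)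
    (hu : ∀ j, ∑ b, u ⟨j, b⟩ * algebraMap R S (φ j b) = 0) (p : Σ j, ι j) :
    MvPolynomial.aeval (fun q : FreeIdx a => u q.1) (genPt a φ p) = u p := by
  obtain ⟨j, b⟩ := p
  rw [genPt]
  split_ifs with hb
  · simp
  · simp only [ne_eq, not_not] at hb
    subst hb
    have := hu j
    rw [sum_mul_eq_add a (fun j b => algebraMap R S (φ j b)) j fun b => u ⟨j, b⟩] at this
    simp only [hφ, map_one, mul_one] at this
    rw [eq_neg_of_add_eq_zero_left this]
    simp [genForm, mul_comm]

end GenPt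

variable {K : Type*} [Field K] [Algebra ℂ K]

/-- The polynomials vanishing on the product of the hyperplanes `∑ b, f j b * u b = 0`. -/
def incIdeal (f : ∀ j, ι j → K) : Ideal (MvPolynomial (Σ j, ι j) ℂ) where
  carrier := {P | ∀ u : (Σ j, ι j) → K, (∀ j, ∑ b, u ⟨j, b⟩ * f j b = 0) →
    MvPolynomial.aeval u P = 0}
  add_mem' hP hQ u hu := by rw [map_add, hP u hu, hQ u hu, add_zero]
  zero_mem' u hu := map_zero _
  smul_mem' c P hP u hu := by rw [smul_eq_mul, map_mul, hP u hu, mul_zero]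

/-- Makes the ideal independent of the trivializations of the line bundles and of the division by
pivots. -/
lemma incIdeal_scale (f : ∀ j, ι j → K) (c : I → K) (hc : ∀ j, c j ≠ 0) :
    incIdeal (fun j b => c j * f j b) = incIdeal f := by
  ext P
  refine forall_congr' fun u => imp_congr_left (forall_congr' fun j => ?_)
  have : ∑ b, u ⟨j, b⟩ * (c j * f j b) = c j * ∑ b, u ⟨j, b⟩ * f j b := by
    simp only [Finset.mul_sum, mul_left_comm]
  rw [this, mul_eq_zero_iff_left (hc j)]

/-- The solutions are parametrized by the free coordinates, and over an infinite field a polynomial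
in these is zero once all its values are. -/
lemma incIdeal_eq_ker (a : ∀ j, ι j) (φ : ∀ j, ι j → K) (hφ : ∀ j, φ j (a j) = 1) :
    incIdeal φ = RingHom.ker (MvPolynomial.aeval (R := ℂ) (genPt a φ)) := by
  have : Infinite K := Infinite.of_injective _ (algebraMap ℂ K).injective
  ext P
  rw [RingHom.mem_ker]
  constructor
  · intro hP
    refine MvPolynomial.funext fun w => ?_
    let g : MvPolynomial (FreeIdx a) K →ₐ[ℂ] K := (MvPolynomial.aeval w).restrictScalars ℂ
    have h1 : MvPolynomial.aeval (fun p => g (genPt a φ p)) P = 0 := hP _ fun j => by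
      have := congrArg g (sum_genPt_mul hφ j)
      simpa [g] using this
    rw [← MvPolynomial.comp_aeval_apply] at h1
    simpa [g] using h1
  · intro hP u hu
    let g : MvPolynomial (FreeIdx a) K →ₐ[ℂ] K :=
      (MvPolynomial.aeval fun q : FreeIdx a => u q.1).restrictScalars ℂ
    have h1 := congrArg g hP
    rw [MvPolynomial.comp_aeval_apply, map_zero] at h1
    rw [← h1]
    congr 2
    ext p
    exact (aeval_genPt_eq (S := K) hφ u hu p).symm

/-- Specialization from the target of `sp` to the closed point. The point `s` solves the equations
only modulo the maximal ideal; changing its pivot coordinates by elements of that ideal gives an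
exact solution `u` over `O`. Then `P(u)` is killed by `sp`, hence is no unit, and its residue `P(s)`
is zero. -/
lemma eval_eq_zero_of_mem_incIdeal {O : Type*} [CommRing O] [IsLocalRing O] [Algebra ℂ O]
    (sp : O →ₐ[ℂ] K) (f : ∀ j, ι j → O) (hf : ∀ j, ∃ b, IsUnit (f j b))
    {P : MvPolynomial (Σ j, ι j) ℂ} (hP : P ∈ incIdeal fun j b => sp (f j b))
    (s : (Σ j, ι j) → ℂ)
    (hs : ∀ j, ∑ b, s ⟨j, b⟩ • f j b ∈ IsLocalRing.maximalIdeal O) :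
    MvPolynomial.eval s P = 0 := by
  choose a ha using hf
  choose v hv using fun j => (ha j).exists_left_inv
  let u : (Σ j, ι j) → O := fun p => algebraMap ℂ O (s p) -
    if p.2 = a p.1 then v p.1 * ∑ b, s ⟨p.1, b⟩ • f p.1 b else 0
  have hu : ∀ j, ∑ b, u ⟨j, b⟩ * f j b = 0 := fun j => by
    simp only [u, sub_mul, Finset.sum_sub_distrib, ite_mul, zero_mul, Finset.sum_ite_eq',
      Finset.mem_univ, if_true]
    rw [mul_right_comm, hv, one_mul, sub_eq_zero]
    simp only [Algebra.smul_def]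
  have h1 : sp (MvPolynomial.aeval u P) = 0 := by
    rw [MvPolynomial.comp_aeval_apply]
    refine hP _ fun j => ?_
    have := congrArg sp (hu j)
    simpa using this
  have h2 : MvPolynomial.aeval u P ∈ IsLocalRing.maximalIdeal O := by
    rw [IsLocalRing.mem_maximalIdeal, mem_nonunits_iff]
    intro hunit
    exact (hunit.map sp).ne_zero h1
  rw [← IsLocalRing.residue_eq_zero_iff] at h2
  have h3 : ∀ p, IsLocalRing.residue O (u p) = algebraMap ℂ (IsLocalRing.ResidueField O) (s p) := by
    intro p
    have h0 := (IsLocalRing.residue_eq_zero_iff _).2 (hs p.1)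
    simp only [u, map_sub]
    split_ifs
    · rw [map_mul, h0, mul_zero, sub_zero]; rfl
    · rw [map_zero, sub_zero]; rfl
  let g : O →ₐ[ℂ] IsLocalRing.ResidueField O := IsScalarTower.toAlgHom ℂ O _
  have h4 : g (MvPolynomial.aeval u P) = algebraMap ℂ _ (MvPolynomial.eval s P) := by
    rw [MvPolynomial.comp_aeval_apply]
    have : (fun p => g (u p)) = algebraMap ℂ (IsLocalRing.ResidueField O) ∘ s :=
      funext h3
    rw [this, MvPolynomial.aeval_algebraMap_apply]; rfl
  have h5 : g (MvPolynomial.aeval u P) = 0 := h2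
  rw [h4] at h5
  exact (map_eq_zero _).1 h5

end Incidence

end LinearSeries
end

noncomputable section

set_option linter.unusedSectionVars false

namespace LinearSeries

/-! ### The number of points in a generic fibre of a generically finite morphism -/

section GenericFibre

open Polynomial

lemma exists_map_eq_C_mul {A F : Type*} [CommRing A] [IsDomain A] [Field F] [Algebra A F]
    [IsFractionRing A F] (p : F[X]) :
    ∃ b : A, b ≠ 0 ∧ ∃ q : A[X], q.map (algebraMap A F) = C (algebraMap A F b) * p := by
  obtain ⟨b, hb, h⟩ := IsLocalization.integerNormalization_spec (nonZeroDivisors A) p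
  refine ⟨b, nonZeroDivisors.ne_zero hb, _, h.trans ?_⟩
  rw [← IsScalarTower.algebraMap_smul F b p, Polynomial.smul_eq_C_mul]

/-- The primitive element theorem without denominators: `h` is a multiple of the minimal polynomial
of `θ`, and the Bézout identity with constant `b` keeps it separable at every specialization where
`b` is nonzero. -/
lemma exists_generator_aux (A R F L : Type*) [CommRing A] [IsDomain A] [CommRing R]
    [IsDomain R] [Algebra A R] [Field F] [Field L] [Algebra A F] [IsFractionRing A F]
    [Algebra R L] [IsFractionRing R L] [Algebra A L] [Algebra F L] [IsScalarTower A R L]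
    [IsScalarTower A F L] [CharZero F] [FiniteDimensional F L] [Algebra.IsAlgebraic A R]
    [FaithfulSMul A R] :
    ∃ (θ : R) (h U W : A[X]) (b : A), b ≠ 0 ∧ h.leadingCoeff ≠ 0 ∧ aeval θ h = 0 ∧
      U * h + W * derivative h = Polynomial.C b ∧
      (∀ p : A[X], aeval θ p = 0 → ∃ c : A, c ≠ 0 ∧ h ∣ Polynomial.C c * p) ∧
      ∀ x : R, ∃ c : A, c ≠ 0 ∧ ∃ p : A[X], algebraMap A R c * x = aeval θ p := by
  have hAF : Function.Injective (algebraMap A F) := IsFractionRing.injective A F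
  have hCL : Function.Injective (algebraMap R L) := IsFractionRing.injective R L
  have hmap : Function.Injective (Polynomial.map (algebraMap A F)) :=
    Polynomial.map_injective _ hAF
  obtain ⟨θ₀, hθ₀⟩ := Field.exists_primitive_element F L
  obtain ⟨x, y, hy, rfl⟩ := IsFractionRing.div_surjective (A := R) θ₀
  -- As `y` divides some nonzero `a` in `A`, the element `x * z` of `R` equals `a` times the
  -- primitive element and still generates the field.
  obtain ⟨a, ha, z, hz⟩ := (Algebra.IsAlgebraic.isAlgebraic (R := A) y).exists_nonzero_dvd hy
  have hy0 : algebraMap R L y ≠ 0 := by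
    rw [Ne, map_eq_zero_iff _ hCL]; exact nonZeroDivisors.ne_zero hy
  have haF : algebraMap A F a ≠ 0 := by rwa [Ne, map_eq_zero_iff _ hAF]
  let θ : R := x * z
  have hθx : algebraMap R L θ = algebraMap F L (algebraMap A F a) *
      (algebraMap R L x / algebraMap R L y) := by
    rw [← IsScalarTower.algebraMap_apply A F L, IsScalarTower.algebraMap_apply A R L, hz]
    simp only [θ, map_mul]
    field_simp
  have hθ : IntermediateField.adjoin F {algebraMap R L θ} = ⊤ := by
    rw [eq_top_iff, ← hθ₀, IntermediateField.adjoin_simple_le_iff]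
    have h1 := IntermediateField.mem_adjoin_simple_self F (algebraMap R L θ)
    have h2 := mul_mem (inv_mem ((IntermediateField.adjoin F {algebraMap R L θ}).algebraMap_mem
      (algebraMap A F a))) h1
    rw [hθx, inv_mul_cancel_left₀ (by rwa [Ne, map_eq_zero_iff _ (algebraMap F L).injective])]
      at h2
    rwa [hθx]
  have hae : ∀ p : A[X], algebraMap R L (aeval θ p) =
      aeval (algebraMap R L θ) (p.map (algebraMap A F)) := fun p => by
    rw [aeval_map_algebraMap, aeval_algebraMap_apply]
  have hint : IsIntegral F (algebraMap R L θ) := .of_finite _ _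
  set h₀ := minpoly F (algebraMap R L θ) with hh₀
  obtain ⟨b, hb, h, hh⟩ := exists_map_eq_C_mul (A := A) h₀
  obtain ⟨u, w, huw⟩ := (minpoly.irreducible hint).separable
  obtain ⟨b1, hb1, u', hu'⟩ := exists_map_eq_C_mul (A := A) u
  obtain ⟨b2, hb2, w', hw'⟩ := exists_map_eq_C_mul (A := A) w
  refine ⟨θ, h, C b2 * u', C b1 * w', b1 * b2 * b, ?_, ?_, ?_, ?_, ?_, ?_⟩
  · simp [hb, hb1, hb2]
  · rw [Ne, leadingCoeff_eq_zero]
    rintro rfl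
    refine mul_ne_zero (a := C (algebraMap A F b)) (b := h₀) ?_ (minpoly.ne_zero hint) ?_
    · rwa [Ne, C_eq_zero, map_eq_zero_iff _ hAF]
    · rw [← hh, Polynomial.map_zero]
  · apply hCL
    rw [hae, hh, map_mul, minpoly.aeval, mul_zero, map_zero]
  · apply hmap
    simp only [Polynomial.map_add, Polynomial.map_mul, map_C, hu', hw', hh, ← derivative_map,
      derivative_mul, derivative_C, zero_mul, zero_add, map_mul]
    linear_combination (C (algebraMap A F b1) * C (algebraMap A F b2) * C (algebraMap A F b)) * huw
  · intro p hp
    have h1 : h₀ ∣ p.map (algebraMap A F) := minpoly.dvd _ _ (by rw [← hae, hp, map_zero])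
    obtain ⟨q, hq⟩ := h1
    obtain ⟨b3, hb3, q', hq'⟩ := exists_map_eq_C_mul (A := A) q
    refine ⟨b * b3, mul_ne_zero hb hb3, q', hmap ?_⟩
    simp only [Polynomial.map_mul, map_C, hq', hh, hq, map_mul]
    ring
  · intro x
    have h1 : algebraMap R L x ∈ (IntermediateField.adjoin F {algebraMap R L θ}).toSubalgebra := by
      rw [hθ]; trivial
    rw [IntermediateField.adjoin_simple_toSubalgebra_of_isAlgebraic hint.isAlgebraic,
      Algebra.adjoin_singleton_eq_range_aeval] at h1
    obtain ⟨p, hp⟩ := h1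
    obtain ⟨c, hc, p', hp'⟩ := exists_map_eq_C_mul (A := A) p
    refine ⟨c, hc, p', hCL ?_⟩
    rw [hae, hp', map_mul, map_mul, aeval_C, ← IsScalarTower.algebraMap_apply A F L,
      ← IsScalarTower.algebraMap_apply A R L]
    exact congrArg _ hp.symm

lemma exists_generator (A R : Type*) [CommRing A] [IsDomain A] [CommRing R] [CharZero A]
    [IsDomain R] [Algebra A R] [Algebra.IsAlgebraic A R] [Algebra.FiniteType A R]
    [FaithfulSMul A R] :
    ∃ (θ : R) (h U W : A[X]) (b : A), b ≠ 0 ∧ h.leadingCoeff ≠ 0 ∧ aeval θ h = 0 ∧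
      U * h + W * derivative h = Polynomial.C b ∧
      (∀ p : A[X], aeval θ p = 0 → ∃ c : A, c ≠ 0 ∧ h ∣ Polynomial.C c * p) ∧
      ∀ x : R, ∃ c : A, c ≠ 0 ∧ ∃ p : A[X], algebraMap A R c * x = aeval θ p := by
  let : Algebra (FractionRing A) (FractionRing R) := FractionRing.liftAlgebra A _
  have := FractionRing.isScalarTower_liftAlgebra A (FractionRing R)
  have := (IsFractionRing.isAlgebraic_iff' A R (FractionRing R)).1 inferInstance
  have : Algebra.IsAlgebraic (FractionRing A) (FractionRing R) :=
    ⟨fun _ => (IsFractionRing.isAlgebraic_iff A (FractionRing A) (FractionRing R)).1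
    (Algebra.IsAlgebraic.isAlgebraic _)⟩
  have : Algebra.EssFiniteType R (FractionRing R) := .of_isLocalization _ (nonZeroDivisors R)
  have : Algebra.EssFiniteType A (FractionRing R) := .comp A R _
  have : Algebra.EssFiniteType (FractionRing A) (FractionRing R) := .of_comp A _ _
  have := Algebra.finite_of_essFiniteType_of_isAlgebraic
    (F := FractionRing A) (E := FractionRing R)
  have : CharZero (FractionRing A) :=
    charZero_of_injective_algebraMap (IsFractionRing.injective A (FractionRing A))
  exact exists_generator_aux A R (FractionRing A) (FractionRing R)

/-- For generic `ψ`, extensions `φ` correspond to the roots of the specialization of `h`, by `φ ↦ φ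
θ`. So the count is the degree of `h`. -/
theorem exists_encard_extensions_eq (A R : Type*) [CommRing A] [IsDomain A] [CommRing R]
    [IsDomain R] [Algebra ℂ A] [Algebra ℂ R] [Algebra A R] [IsScalarTower ℂ A R]
    [FaithfulSMul A R] [Algebra.FiniteType ℂ A] [Algebra.FiniteType ℂ R]
    [Algebra.IsAlgebraic A R] :
    ∃ a : A, a ≠ 0 ∧ ∃ m : ℕ, ∀ ψ : A →ₐ[ℂ] ℂ, ψ a ≠ 0 →
      {φ : R →ₐ[ℂ] ℂ | ∀ x, φ (algebraMap A R x) = ψ x}.encard = m := by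
  have : CharZero A := charZero_of_injective_algebraMap (algebraMap ℂ A).injective
  have hft : Algebra.FiniteType A R := .of_restrictScalars_finiteType ℂ A R
  have : IsNoetherianRing A := Algebra.FiniteType.isNoetherianRing ℂ A
  have hAC : Function.Injective (algebraMap A R) := FaithfulSMul.algebraMap_injective A R
  obtain ⟨θ, h, U, W, b, hb, hlc, hθh, hbez, hker, hgen⟩ := exists_generator A R
  obtain ⟨s, hs⟩ := (RingHom.ker (aeval (R := A) θ)).fg_of_isNoetherianRing
  -- The kernel of evaluation at `θ` is finitely generated, so a single denominator serves all its
  -- elements.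
  have hker' : ∃ c : A, c ≠ 0 ∧ ∀ p, aeval θ p = 0 → h ∣ Polynomial.C c * p := by
    choose! c hc hcd using hker
    refine ⟨∏ p ∈ s, c p, Finset.prod_ne_zero_iff.2 fun p hp => hc p ?_, fun p hp => ?_⟩
    · exact (RingHom.mem_ker).1 (hs ▸ Ideal.subset_span hp)
    · have hp' : p ∈ Ideal.span (s : Set A[X]) := hs ▸ hp
      induction hp' using Submodule.span_induction with
      | mem x hx =>
        have hx' : aeval θ x = 0 := (RingHom.mem_ker).1 (hs ▸ Ideal.subset_span hx)
        refine (hcd x hx').trans (mul_dvd_mul_right ?_ _)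
        exact map_dvd Polynomial.C (Finset.dvd_prod_of_mem c hx)
      | zero => simp
      | add x y hx hy h1 h2 =>
        have hx' : aeval θ x = 0 := (RingHom.mem_ker).1 (hs ▸ hx)
        have hy' : aeval θ y = 0 := (RingHom.mem_ker).1 (hs ▸ hy)
        rw [mul_add]; exact dvd_add (h1 hx') (h2 hy')
      | smul r x hx h1 =>
        have hx' : aeval θ x = 0 := (RingHom.mem_ker).1 (hs ▸ hx)
        rw [smul_eq_mul, mul_left_comm]; exact (h1 hx').mul_left r
  obtain ⟨c₁, hc₁, hker₁⟩ := hker'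
  obtain ⟨t, ht⟩ := hft.out
  choose c₂ hc₂ q hq using hgen
  -- the subalgebra generated by `θ`
  let S : Subalgebra ℂ R := ((aeval (R := A) θ).restrictScalars ℂ).range
  have hSft : Algebra.FiniteType ℂ S := by
    have : Algebra.FiniteType ℂ A[X] := Algebra.FiniteType.trans (S := A) inferInstance inferInstance
    exact .of_surjective ((aeval (R := A) θ).restrictScalars ℂ).rangeRestrict
      (AlgHom.rangeRestrict_surjective _)
  obtain ⟨s₀, hs₀, hext⟩ := exists_forall_isMaximal_exists_algHom S.val Subtype.val_injective
  obtain ⟨a₃, ha₃, z, hz⟩ :=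
    (Algebra.IsAlgebraic.isAlgebraic (R := A) (s₀ : R)).exists_nonzero_dvd
      (mem_nonZeroDivisors_of_ne_zero (by simpa using hs₀))
  obtain ⟨p₄, hp₄⟩ : ∃ p : A[X], aeval θ p = z * algebraMap A R (c₂ z) :=
    ⟨q z, by rw [← hq, mul_comm]⟩
  -- The factors preserve, in order, the degree of `h`, its separability, the possibility of
  -- defining a homomorphism on `A[θ]` from a root, the determination of `φ` by `φ θ`, and the
  -- nonvanishing of the Chevalley obstruction `s₀`.
  refine ⟨h.leadingCoeff * b * c₁ * (∏ x ∈ t, c₂ x) * (a₃ * c₂ z), ?_, h.natDegree, ?_⟩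
  · simp only [ne_eq, mul_eq_zero, not_or]
    exact ⟨⟨⟨⟨hlc, hb⟩, hc₁⟩, Finset.prod_ne_zero_iff.2 fun p _ => hc₂ p⟩, ha₃, hc₂ z⟩
  intro ψ hψ
  simp only [map_mul, ne_eq, mul_eq_zero, not_or, map_prod, Finset.prod_eq_zero_iff,
    not_exists, not_and] at hψ
  obtain ⟨⟨⟨⟨hψl, hψb⟩, hψc⟩, hψt⟩, hψ3, hψ4⟩ := hψ
  set H : ℂ[X] := h.map ψ.toRingHom with hH
  have hHdeg : H.natDegree = h.natDegree := natDegree_map_of_leadingCoeff_ne_zero _ hψl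
  have hsep : H.Separable := by
    have h1 := congrArg (Polynomial.map ψ.toRingHom) hbez
    simp only [Polynomial.map_add, Polynomial.map_mul, map_C, ← derivative_map] at h1
    refine ⟨C (ψ b)⁻¹ * U.map ψ.toRingHom, C (ψ b)⁻¹ * W.map ψ.toRingHom, ?_⟩
    have h2 : C (ψ b)⁻¹ * C (ψ b) = 1 := by rw [← C_mul, inv_mul_cancel₀ hψb, C_1]
    have h3 : ψ.toRingHom b = ψ b := rfl
    rw [h3] at h1
    linear_combination C (ψ b)⁻¹ * h1 + h2
  have hcard : (H.rootSet ℂ).encard = h.natDegree := by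
    rw [← hHdeg, Set.encard_eq_coe_toFinset_card, Set.toFinset_card,
      card_rootSet_eq_natDegree hsep (IsAlgClosed.splits _)]
  have hev : ∀ φ : R →ₐ[ℂ] ℂ, (∀ x, φ (algebraMap A R x) = ψ x) → ∀ p : A[X],
      φ (aeval θ p) = (p.map ψ.toRingHom).eval (φ θ) := fun φ hφ p => by
    rw [aeval_def, Polynomial.eval_map, ← AlgHom.coe_toRingHom φ, hom_eval₂]
    congr 1
    ext x; exact hφ x
  have hH0 : H ≠ 0 := hsep.ne_zero
  rw [← hcard]
  suffices hbij : Set.BijOn (fun φ : R →ₐ[ℂ] ℂ => φ θ)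
      {φ | ∀ x, φ (algebraMap A R x) = ψ x} (H.rootSet ℂ) by
    rw [← hbij.image_eq, hbij.injOn.encard_image]
  refine ⟨?_, ?_, ?_⟩
  · intro φ hφ
    rw [mem_rootSet_of_ne hH0, coe_aeval_eq_eval, ← hev φ hφ, hθh, map_zero]
  · intro φ hφ φ' hφ' heq
    have hgenx : ∀ x ∈ t, φ x = φ' x := fun x hx => by
      have h1 := congrArg φ (hq x)
      have h2 := congrArg φ' (hq x)
      rw [map_mul, hev φ hφ, hφ (c₂ x)] at h1
      rw [map_mul, hev φ' hφ', hφ' (c₂ x), ← show φ θ = φ' θ from heq, ← h1] at h2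
      exact (mul_left_cancel₀ (hψt x hx) h2).symm
    ext x
    have hx : x ∈ Algebra.adjoin A (t : Set R) := by rw [ht]; trivial
    induction hx using Algebra.adjoin_induction with
    | mem x hx => exact hgenx x hx
    | algebraMap r => rw [hφ, hφ']
    | add x y _ _ h1 h2 => rw [map_add, map_add, h1, h2]
    | mul x y _ _ h1 h2 => rw [map_mul, map_mul, h1, h2]
  · intro r hr
    rw [mem_rootSet_of_ne hH0, coe_aeval_eq_eval] at hr
    let χ₀ : A[X] →ₐ[ℂ] ℂ :=
      { eval₂RingHom ψ.toRingHom r with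
        commutes' := fun c => by simp [IsScalarTower.algebraMap_apply ℂ A A[X]] }
    have hχ₀ : ∀ p, χ₀ p = (p.map ψ.toRingHom).eval r := fun p => (Polynomial.eval_map _ _).symm
    let χ : S →ₐ[ℂ] ℂ := AlgHom.liftOfSurjective
      ((aeval (R := A) θ).restrictScalars ℂ).rangeRestrict (AlgHom.rangeRestrict_surjective _) χ₀
      (fun p hp => by
        have hp' : aeval θ p = 0 := congrArg Subtype.val hp
        obtain ⟨q, hq⟩ := hker₁ p hp'
        have h1 := congrArg χ₀ hq
        rw [map_mul, map_mul, hχ₀ h, hr, zero_mul, hχ₀, map_C, eval_C] at h1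
        exact (mul_eq_zero.1 h1).resolve_left hψc)
    have hχ : ∀ p : A[X], ∀ hp : aeval θ p ∈ S, χ ⟨aeval θ p, hp⟩ = χ₀ p := fun p hp =>
      AlgHom.liftOfSurjective_apply _ _ _ _ p
    have hχsurj : Function.Surjective χ := fun c => ⟨algebraMap ℂ S c, by simp⟩
    have hmax : (RingHom.ker χ).IsMaximal := RingHom.ker_isMaximal_of_surjective _ hχsurj
    -- In `R` the element `s₀` divides `a₃`; multiplication by `c₂ z` moves the cofactor into `S`,
    -- where `χ` is defined.
    have hns : s₀ ∉ RingHom.ker χ := by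
      rw [RingHom.mem_ker]
      intro h0
      have hz' : aeval θ p₄ ∈ S := ⟨p₄, rfl⟩
      have ha' : aeval θ (C (a₃ * c₂ z)) ∈ S := ⟨_, rfl⟩
      have h1 : (⟨_, ha'⟩ : S) = s₀ * ⟨_, hz'⟩ := by
        apply Subtype.ext
        change aeval θ (C (a₃ * c₂ z)) = (s₀ : R) * aeval θ p₄
        rw [hp₄, aeval_C, map_mul, hz, mul_assoc]
      have h2 := congrArg χ h1
      rw [map_mul χ, h0, zero_mul, hχ, hχ₀, map_C, eval_C] at h2
      have h3 : ψ (a₃ * c₂ z) = 0 := h2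
      rw [map_mul] at h3
      exact (mul_eq_zero.1 h3).elim hψ3 hψ4
    obtain ⟨φ, hφ⟩ := hext _ hmax hns
    have hφχ : ∀ x : S, φ x = χ x := fun x => by
      have h1 : x - algebraMap ℂ S (χ x) ∈ RingHom.ker χ := by simp [RingHom.mem_ker]
      rw [← hφ, RingHom.mem_ker, map_sub, sub_eq_zero, AlgHom.commutes] at h1
      exact h1
    refine ⟨φ, fun x => ?_, ?_⟩
    · have hC : aeval θ (C x : A[X]) ∈ S := ⟨C x, rfl⟩
      have := hφχ ⟨_, hC⟩
      rw [hχ, hχ₀, map_C, eval_C] at this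
      simpa using this
    · have hX : aeval θ (X : A[X]) ∈ S := ⟨X, rfl⟩
      have := hφχ ⟨_, hX⟩
      rw [hχ, hχ₀, map_X, eval_X] at this
      simpa using this

end GenericFibre

end LinearSeries
end

noncomputable section

set_option linter.unusedSectionVars false

namespace LinearSeries

/-! ### Zariski closures and hypersurfaces -/

section Zariski

variable {V : Type*} [AddCommGroup V] [Module ℂ V]

lemma isOpen_zariski_ne (f : polyFun V) : IsOpen[zariski V] {v | f.1 v ≠ 0} :=
  isOpen_generateFrom_of_mem ⟨f.1, f.2, rfl⟩

lemma exists_of_isOpen_zariski {U : Set V} (hU : IsOpen[zariski V] U) {v : V} (hv : v ∈ U) :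
    ∃ f : polyFun V, f.1 v ≠ 0 ∧ {v | f.1 v ≠ 0} ⊆ U := by
  induction hU with
  | basic s hs =>
    obtain ⟨f, hf, rfl⟩ := hs
    exact ⟨⟨f, hf⟩, hv, subset_rfl⟩
  | univ => exact ⟨1, by simp, Set.subset_univ _⟩
  | inter s t _ _ hs ht =>
    obtain ⟨f, hf, hfs⟩ := hs hv.1
    obtain ⟨g, hg, hgt⟩ := ht hv.2
    refine ⟨f * g, mul_ne_zero hf hg, fun w hw => ?_⟩
    have hw' : f.1 w * g.1 w ≠ 0 := hw
    exact ⟨hfs (left_ne_zero_of_mul hw'), hgt (right_ne_zero_of_mul hw')⟩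
  | sUnion S _ h =>
    obtain ⟨s, hs, hvs⟩ := hv
    obtain ⟨f, hf, hfs⟩ := h s hs hvs
    exact ⟨f, hf, hfs.trans (Set.subset_sUnion_of_mem hs)⟩

lemma mem_closure_zariski_iff {S : Set V} {v : V} :
    v ∈ closure[zariski V] S ↔ ∀ f : polyFun V, (∀ s ∈ S, f.1 s = 0) → f.1 v = 0 := by
  rw [@mem_closure_iff V (zariski V)]
  constructor
  · intro h f hf
    by_contra hv
    obtain ⟨s, hs, hsS⟩ := h _ (isOpen_zariski_ne f) hv
    exact hs (hf s hsS)
  · intro h U hU hv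
    obtain ⟨f, hf, hfU⟩ := exists_of_isOpen_zariski hU hv
    by_contra hne
    refine hf (h f fun s hs => ?_)
    by_contra hs'
    exact hne ⟨s, hfU hs', hs⟩

end Zariski

/-! ### Kernels of codimension one and the variables occurring in their equations. -/

section Hypersurface

variable {σ : Type*} [Fintype σ] {D : Type*} [CommRing D] [IsDomain D] [Algebra ℂ D]

lemma algRk_range_eq_trdeg (ψ : MvPolynomial σ ℂ →ₐ[ℂ] D) :
    ∃ d : ℕ, algRk ℂ (Set.range fun p => ψ (MvPolynomial.X p)) = d ∧
      Algebra.trdeg ℂ ψ.range = d := by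
  have h : ψ.range = Algebra.adjoin ℂ (Set.range fun p => ψ (MvPolynomial.X p)) := by
    rw [Algebra.adjoin_range_eq_range_aeval]
    congr 1
    ext p; simp
  refine trdeg_subalgebra (Set.finite_range _) ?_ ?_
  · rintro _ ⟨p, rfl⟩; exact ⟨_, rfl⟩
  · rw [h]; exact adjoin_subset_algClosure _

lemma trdeg_mvPolynomial_eq : Algebra.trdeg ℂ (MvPolynomial σ ℂ) = Fintype.card σ := by
  rw [MvPolynomial.trdeg_of_isDomain]; simp

/-- The kernel is a nonzero prime of a factorial ring, so it contains a prime element `f`. Were it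
larger than `(f)`, the transcendence degree would drop at least twice between the polynomial ring
and the image, but it drops only by one. -/
lemma exists_ker_eq_span (ψ : MvPolynomial σ ℂ →ₐ[ℂ] D)
    (h : algRk ℂ (Set.range fun p => ψ (MvPolynomial.X p)) + 1 = Fintype.card σ) :
    ∃ f : MvPolynomial σ ℂ, Irreducible f ∧ RingHom.ker ψ = Ideal.span {f} := by
  obtain ⟨d, hd, htr⟩ := algRk_range_eq_trdeg ψ
  rw [hd] at h
  have hcard : d + 1 = Fintype.card σ := by exact_mod_cast h
  have hprime : (RingHom.ker ψ).IsPrime := RingHom.ker_isPrime _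
  have hbot : RingHom.ker ψ ≠ ⊥ := by
    intro h0
    have hinj : Function.Injective ψ := (RingHom.injective_iff_ker_eq_bot _).2 h0
    have h2 := lift_trdeg_le_of_injective (AlgEquiv.ofInjective ψ hinj).toAlgHom
      (AlgEquiv.ofInjective ψ hinj).injective
    rw [trdeg_mvPolynomial_eq, htr] at h2
    simp only [Cardinal.lift_natCast] at h2
    have := Nat.cast_le.1 h2
    omega
  obtain ⟨f, hfmem, hf⟩ := hprime.exists_mem_prime_of_ne_bot hbot
  refine ⟨f, hf.irreducible, le_antisymm ?_ (by simpa using hfmem)⟩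
  by_contra hle
  have hspan : (Ideal.span {f}).IsPrime := (Ideal.span_singleton_prime hf.ne_zero).2 hf
  have hfin : Algebra.trdeg ℂ (MvPolynomial σ ℂ) < Cardinal.aleph0 := by
    rw [trdeg_mvPolynomial_eq]; exact Cardinal.natCast_lt_aleph0
  have h1 := trdeg_quotient_lt (Ideal.span {f})
    (by simpa using hf.ne_zero) hfin
  let g : (MvPolynomial σ ℂ ⧸ Ideal.span {f}) →ₐ[ℂ] D := Ideal.Quotient.liftₐ _ ψ (by
    intro x hx
    obtain ⟨y, rfl⟩ := Ideal.mem_span_singleton.1 hx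
    rw [map_mul, (RingHom.mem_ker).1 hfmem, zero_mul])
  have hgk : RingHom.ker g ≠ ⊥ := by
    obtain ⟨x, hx, hx'⟩ := Set.not_subset.1 hle
    intro h0
    refine hx' (Ideal.Quotient.eq_zero_iff_mem.1 ?_)
    have : Ideal.Quotient.mk (Ideal.span {f}) x ∈ RingHom.ker g := hx
    rwa [h0] at this
  have hgp : (RingHom.ker g).IsPrime := RingHom.ker_isPrime _
  have h2 := trdeg_quotient_lt (k := ℂ) (RingHom.ker g) hgk (h1.trans hfin)
  have hgr : g.range = ψ.range := by
    apply le_antisymm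
    · rintro _ ⟨x, rfl⟩
      obtain ⟨x, rfl⟩ := Ideal.Quotient.mk_surjective x
      exact ⟨x, rfl⟩
    · rintro _ ⟨x, rfl⟩
      exact ⟨Ideal.Quotient.mk _ x, rfl⟩
  let e : ((MvPolynomial σ ℂ ⧸ Ideal.span {f}) ⧸ RingHom.ker g) ≃ₐ[ℂ] ψ.range :=
    (Ideal.quotientKerEquivRange g).trans (Subalgebra.equivOfEq _ _ hgr)
  have h3 := (AlgEquiv.lift_trdeg_eq (R := ℂ) (A := ψ.range)
    (A' := (MvPolynomial σ ℂ ⧸ Ideal.span {f}) ⧸ RingHom.ker g) e.symm).le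
  rw [htr] at h3
  have h4 := h2.trans h1
  have h5 : Algebra.trdeg ℂ (MvPolynomial σ ℂ ⧸ Ideal.span {f}) < (Fintype.card σ : ℕ) := by
    rw [← trdeg_mvPolynomial_eq]; exact h1
  obtain ⟨m, hm⟩ := Cardinal.lt_aleph0.1 (h1.trans hfin)
  obtain ⟨m', hm'⟩ := Cardinal.lt_aleph0.1 (h2.trans (h1.trans hfin))
  rw [hm'] at h2 h3
  rw [hm] at h2 h5
  simp only [Cardinal.lift_natCast, Nat.cast_le, Nat.cast_lt] at h2 h3 h5
  omega

lemma exists_aeval_eq_zero_of_algRk_lt {τ : Type*} [Fintype τ] (x : τ → D)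
    (h : algRk ℂ (Set.range x) < Fintype.card τ) :
    ∃ g : MvPolynomial τ ℂ, g ≠ 0 ∧ MvPolynomial.aeval x g = 0 := by
  by_contra! hne
  have hx : AlgebraicIndependent ℂ x := by
    rw [algebraicIndependent_iff]
    intro p hp
    by_contra h0
    exact hne p h0 hp
  have hind := AlgebraicIndependent.matroid_indep_iff.2 hx.coe_range
  rw [algRk, hind.eRk_eq_encard, ← Set.image_univ, hx.injective.injOn.encard_image] at h
  simp at h

/-- The degree in each variable is additive on products of nonzero polynomials. -/
lemma mem_supported_of_dvd {J : Set σ} {f g : MvPolynomial σ ℂ}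
    (hg : g ∈ MvPolynomial.supported ℂ J) (hg0 : g ≠ 0) (h : f ∣ g) :
    f ∈ MvPolynomial.supported ℂ J := by
  classical
  obtain ⟨q, rfl⟩ := h
  rw [MvPolynomial.mem_supported] at hg ⊢
  intro p hp
  by_contra hpJ
  have h0 : MvPolynomial.degreeOf p (f * q) = 0 := by
    by_contra h0
    refine hpJ (hg ?_)
    exact MvPolynomial.mem_vars_iff_degreeOf_ne_zero.2 h0
  rw [MvPolynomial.degreeOf_mul_eq (left_ne_zero_of_mul hg0) (right_ne_zero_of_mul hg0)] at h0
  have h1 : MvPolynomial.degreeOf p f = 0 := by omega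
  exact MvPolynomial.mem_vars_iff_degreeOf_ne_zero.1 hp h1

lemma eval_eq_of_mem_supported {J : Set σ} {f : MvPolynomial σ ℂ}
    (hf : f ∈ MvPolynomial.supported ℂ J) {s s' : σ → ℂ} (h : ∀ p ∈ J, s p = s' p) :
    MvPolynomial.eval s f = MvPolynomial.eval s' f := by
  refine MvPolynomial.eval₂Hom_congr' rfl (fun p hp _ => h p ?_) rfl
  exact MvPolynomial.mem_supported.1 hf hp

end Hypersurface

/-! ### The dimension of the ambient vector space. -/

section DimUniv

variable {V : Type*} [AddCommGroup V] [Module ℂ V] {σ : Type*} [Fintype σ]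

lemma exists_eval_eq_of_algHom (b : Module.Basis σ ℂ V) (φ : polyFun V →ₐ[ℂ] ℂ) :
    ∃ v : V, ∀ f, f.1 v = φ f := by
  refine ⟨b.equivFun.symm fun p => φ (linFun (b.coord p)), fun f => ?_⟩
  obtain ⟨P, rfl⟩ := (polyFunEquiv b).surjective f
  rw [polyFunEquiv_apply]
  have h1 : ⇑(b.repr (b.equivFun.symm fun p => φ (linFun (b.coord p)))) =
      fun p => φ (linFun (b.coord p)) := b.equivFun.apply_symm_apply _
  have h2 : φ (polyFunEquiv b P) = MvPolynomial.aeval (fun p => φ (linFun (b.coord p))) P := by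
    have : (φ.comp (polyFunEquiv b).toAlgHom) =
        MvPolynomial.aeval (fun p => φ (linFun (b.coord p))) := by
      ext p
      simp [polyFunEquiv_X]
    exact congrArg (fun g => g P) this
  rw [h1, h2]; rfl

lemma krullDimOf_univ (b : Module.Basis σ ℂ V) :
    krullDimOf (zariski V) (Set.univ : Set V) = (Fintype.card σ : ℕ∞) := by
  let e := polyFunEquiv b
  have hdom : IsDomain (polyFun V) := e.symm.toMulEquiv.isDomain _
  let Θ := AlgHom.id ℂ (polyFun V)
  have hr : Function.Injective (Θ.rangeRestrict) := fun x y h => congrArg Subtype.val h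
  let e' : polyFun V ≃ₐ[ℂ] Θ.range :=
    AlgEquiv.ofBijective Θ.rangeRestrict ⟨hr, Θ.rangeRestrict_surjective⟩
  have hft : Algebra.FiniteType ℂ Θ.range :=
    .of_surjective ((e.trans e').toAlgHom) (e.trans e').surjective
  have htr : Algebra.trdeg ℂ Θ.range = (Fintype.card σ : ℕ) := by
    have h1 := AlgEquiv.lift_trdeg_eq (R := ℂ) (A := MvPolynomial σ ℂ) (A' := Θ.range) (e.trans e')
    rw [trdeg_mvPolynomial_eq] at h1
    simpa using h1.symm
  have hσ : ((zariski V).induced Subtype.val : TopologicalSpace (Set.univ : Set V)) =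
    (zariski V).induced Subtype.val := rfl
  have h0 : ∀ f, Θ f = 0 → ∀ t : (Set.univ : Set V), f.1 t.1 = 0 := fun f hf t => by
    have : f = 0 := hf
    rw [this]; rfl
  refine le_antisymm ?_ ?_
  · refine (topologicalKrullDim_le_range (tT := (zariski V).induced Subtype.val) hσ h0).trans ?_
    exact ringKrullDim_le_of_trdeg htr
  · refine trdeg_le_topologicalKrullDim (tT := (zariski V).induced Subtype.val) hσ h0
      Θ.range le_rfl ?_ htr
    intro φ
    obtain ⟨v, hv⟩ := exists_eval_eq_of_algHom b (φ.comp Θ.rangeRestrict)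
    exact ⟨⟨v, trivial⟩, hv⟩

end DimUniv

end LinearSeries
end

noncomputable section

set_option linter.unusedSectionVars false

namespace LinearSeries

/-! ### Local frames of line bundles -/

section Frames

variable {X : Scheme.{0}}

lemma app_inv_app_hom {M N : X.Modules} (φ : M ≅ N) (W : X.Opens) (t : Γ(M, W)) :
    φ.inv.app W (φ.hom.app W t) = t := by
  have := congrArg (fun f => Scheme.Modules.Hom.app f W) φ.hom_inv_id
  exact congrArg (fun f => f t) this

lemma map_hom_app {M N : X.Modules} (φ : M ⟶ N) {W W' : X.Opens} (i : W ⟶ W') (t : Γ(M, W')) :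
    N.presheaf.map i.op (φ.app W' t) = φ.app W (M.presheaf.map i.op t) := by
  have := φ.mapPresheaf.naturality i.op
  exact congrArg (fun f => f t) this.symm

/-- A section `e` over `U` is a frame if over every open `V ⊆ U` each section is uniquely
a multiple of `e`. -/
def IsFrame {L : X.Modules} {U : X.Opens} (e : Γ(L, U)) : Prop :=
  ∀ (V : X.Opens) (h : V ≤ U) (t : Γ(L, V)),
    ∃! r : Γ(X, V), t = r • L.presheaf.map (homOfLE h).op e

/-- The frame is the section corresponding to 1 under a local trivialization. -/
lemma exists_frame {L : X.Modules} (hL : IsLineBundle L) (x : X) :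
    ∃ (U : X.Opens) (_ : x ∈ U) (e : Γ(L, U)), IsFrame e := by
  obtain ⟨U, hxU, ⟨φ⟩⟩ := hL x
  let O : U.toScheme.Modules := SheafOfModules.unit U.toScheme.ringCatSheaf
  let φ' : L.restrict U.ι ≅ O := φ
  let e : Γ(L, U.ι ''ᵁ ⊤) := φ'.inv.app ⊤ (1 : Γ(U, ⊤))
  refine ⟨U.ι ''ᵁ ⊤, by simpa using hxU, e, fun V hV t => ?_⟩
  obtain ⟨W, rfl⟩ : ∃ W, V = U.ι ''ᵁ W :=
    ⟨U.ι ⁻¹ᵁ V, by rw [Scheme.Hom.image_preimage_eq_opensRange_inf]; simpa using hV⟩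
  have he : L.presheaf.map (homOfLE hV).op e = φ'.inv.app W (1 : Γ(U, W)) := by
    refine (map_hom_app φ'.inv (homOfLE le_top : W ⟶ ⊤) (1 : Γ(U, ⊤))).trans ?_
    congr 1
    exact map_one (U.toScheme.presheaf.map (homOfLE le_top : W ⟶ ⊤).op).hom
  have hs : ∀ r : Γ(X, U.ι ''ᵁ W), r • L.presheaf.map (homOfLE hV).op e = φ'.inv.app W (r : Γ(U, W)) := by
    intro r
    rw [he]
    let r' : Γ(U, W) := r
    have h1 := Scheme.Modules.Hom.app_smul φ'.inv r' (1 : Γ(U, W))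
    have h2 : r' • (1 : Γ(U, W)) = r' := mul_one r'
    have h3 := (congrArg (φ'.inv.app W) h2).symm.trans h1
    refine Eq.trans ?_ h3.symm
    let y : Γ(L, U.ι ''ᵁ W) := φ'.inv.app W (1 : Γ(U, W))
    let r₂ : Γ(X, U.ι ''ᵁ W) := (U.ι.appIso W).inv r'
    have hr : r₂ = r := by
      simp only [r₂, Scheme.Opens.ι_appIso]
      rfl
    change r • y = r₂ • y
    rw [hr]
  refine ⟨φ'.hom.app W t, ?_, fun r hr => ?_⟩
  · exact ((hs _).trans (app_inv_app_hom φ' W t)).symm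
  · have h1 := congrArg (φ'.hom.app W) (hr.trans (hs r))
    exact ((h1.trans (app_inv_app_hom φ'.symm W r))).symm

lemma germ_smul (L : X.Modules) (U : X.Opens) (x : X) (hx : x ∈ U) (r : Γ(X, U)) (m : Γ(L, U)) :
    L.presheaf.germ U x hx (r • m) = X.presheaf.germ U x hx r • L.presheaf.germ U x hx m :=
  PresheafOfModules.germ_smul (R := X.presheaf) L.val x U hx r m

lemma IsFrame.restrict {L : X.Modules} {U : X.Opens} {e : Γ(L, U)} (he : IsFrame e)
    {W : X.Opens} (h : W ≤ U) : IsFrame (L.presheaf.map (homOfLE h).op e) := by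
  intro V hV t
  have := he V (hV.trans h) t
  rw [← ConcreteCategory.comp_apply, ← L.presheaf.map_comp]
  exact this

/-- The stalk is free of rank one on the germ of the frame, which reduces vanishing of sections to
membership of a function in the maximal ideal. -/
lemma IsFrame.bijective {L : X.Modules} {U : X.Opens} {e : Γ(L, U)} (he : IsFrame e)
    (y : X) (hy : y ∈ U) : Function.Bijective
      fun r : X.presheaf.stalk y => r • L.presheaf.germ U y hy e := by
  constructor
  · have : ∀ r : X.presheaf.stalk y, r • L.presheaf.germ U y hy e = 0 → r = 0 := by
      intro r hr
      obtain ⟨V, hyV, r, rfl⟩ := X.presheaf.exists_germ_eq r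
      have hW : y ∈ V ⊓ U := ⟨hyV, hy⟩
      rw [← X.presheaf.germ_res_apply (homOfLE inf_le_left : V ⊓ U ⟶ V) y hW,
        ← L.presheaf.germ_res_apply (homOfLE inf_le_right : V ⊓ U ⟶ U) y hW, ← germ_smul,
        ← map_zero (L.presheaf.germ (V ⊓ U) y hW).hom] at hr
      obtain ⟨W, hyW, i, j, hij⟩ := L.presheaf.germ_eq y hW hW _ _ hr
      rw [Scheme.Modules.map_smul, map_zero,
        ← ConcreteCategory.comp_apply (L.presheaf.map _) (L.presheaf.map _),
        ← L.presheaf.map_comp] at hij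
      obtain ⟨r₀, -, huniq⟩ := he W ((leOfHom i).trans inf_le_right) 0
      have h1 := huniq _ hij.symm
      have h2 := huniq 0 (zero_smul _ _).symm
      have h3 := h1.trans h2.symm
      rw [← X.presheaf.germ_res_apply (homOfLE inf_le_left : V ⊓ U ⟶ V) y hW,
        ← X.presheaf.germ_res_apply i y hyW, h3, map_zero]
    intro r r' h
    rw [← sub_eq_zero]
    refine this _ ?_
    rw [sub_smul, sub_eq_zero]
    exact h
  · intro t
    obtain ⟨V, hyV, t, rfl⟩ := L.presheaf.exists_germ_eq t
    have hW : y ∈ V ⊓ U := ⟨hyV, hy⟩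
    obtain ⟨r, hr, -⟩ := he (V ⊓ U) inf_le_right (L.presheaf.map (homOfLE inf_le_left).op t)
    refine ⟨X.presheaf.germ _ y hW r, ?_⟩
    change X.presheaf.germ _ y hW r • _ = _
    rw [← L.presheaf.germ_res_apply (homOfLE inf_le_right : V ⊓ U ⟶ U) y hW, ← germ_smul, ← hr,
      L.presheaf.germ_res_apply]

lemma vanishes_smul_iff {R N : Type*} [CommRing R] [IsLocalRing R] [AddCommGroup N] [Module R N]
    {e : N} (he : Function.Bijective fun r : R => r • e) (r : R) :
    Vanishes R (r • e) ↔ r ∈ IsLocalRing.maximalIdeal R := by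
  constructor
  · intro h
    let ε : R ≃ₗ[R] N := LinearEquiv.ofBijective (LinearMap.toSpanSingleton R N e) he
    have h1 : ε.symm (r • e) = r := ε.symm_apply_apply r
    rw [← h1]
    have h2 : (IsLocalRing.maximalIdeal R • (⊤ : Submodule R N)).map (ε.symm : N →ₗ[R] R) ≤
        IsLocalRing.maximalIdeal R := by
      rw [Submodule.map_smul'']
      exact Ideal.mul_le_left
    exact h2 (Submodule.mem_map_of_mem h)
  · intro h
    exact Submodule.smul_mem_smul h trivial

end Frames

/-! ### Charts -/

section Charts

variable {X : Scheme.{0}} [X.Over (Spec (.of ℂ))]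

instance sectionsAlgebra (U : X.Opens) : Algebra ℂ Γ(X, U) :=
  ((X.presheaf.map (homOfLE le_top : U ⟶ ⊤).op).hom.comp (scalars X)).toAlgebra

/-- The germ at a point, as a homomorphism of `ℂ`-algebras. -/
def germAlg {U : X.Opens} (y : X) (hy : y ∈ U) : Γ(X, U) →ₐ[ℂ] X.presheaf.stalk y :=
  { (X.presheaf.germ U y hy).hom with
    commutes' := fun c => X.presheaf.germ_res_apply (homOfLE le_top : U ⟶ ⊤) y hy (scalars X c) }

/-- An affine open subset with a frame of each of the line bundles `L j`. -/
structure Chart {I : Type*} (L : I → X.Modules) where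
  /-- The underlying open subset. -/
  U : X.Opens
  isAffineOpen : IsAffineOpen U
  /-- The frames. -/
  e : ∀ j, Γ(L j, U)
  isFrame : ∀ j, IsFrame (e j)

variable {I : Type*} {L : I → X.Modules}

lemma exists_chart [Finite I] (hL : ∀ j, IsLineBundle (L j)) (x : X) (V : X.Opens) (hV : x ∈ V) :
    ∃ c : Chart L, x ∈ c.U ∧ c.U ≤ V := by
  choose U hU e he using fun j => exists_frame (hL j) x
  have hO : IsOpen ((⋂ j, (U j : Set X)) ∩ V) :=
    (isOpen_iInter_of_finite fun j => (U j).2).inter V.2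
  obtain ⟨W, hW, hxW, hWU⟩ := exists_isAffineOpen_mem_and_subset (x := x)
    (U := ⟨_, hO⟩) ⟨Set.mem_iInter.2 hU, hV⟩
  have hWj : ∀ j, W ≤ U j := fun j y hy => Set.mem_iInter.1 (hWU hy).1 j
  exact ⟨⟨W, hW, fun j => (L j).presheaf.map (homOfLE (hWj j)).op (e j),
    fun j => (he j).restrict (hWj j)⟩, hxW, fun y hy => (hWU hy).2⟩

namespace Chart

variable (c : Chart L)

/-- The coordinate function of a global section. -/
def coord (j : I) : Γ(L j, ⊤) →ₗ[ℂ] Γ(X, c.U) where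
  toFun s := (c.isFrame j c.U le_rfl ((L j).presheaf.map (homOfLE le_top).op s)).choose
  map_add' s t := by
    refine ((c.isFrame j c.U le_rfl _).choose_spec.2 _ ?_).symm
    dsimp only
    rw [add_smul, ← (c.isFrame j c.U le_rfl _).choose_spec.1,
      ← (c.isFrame j c.U le_rfl _).choose_spec.1, map_add]
  map_smul' a s := by
    refine ((c.isFrame j c.U le_rfl _).choose_spec.2 _ ?_).symm
    dsimp only
    rw [RingHom.id_apply, Algebra.smul_def, mul_smul,
      ← (c.isFrame j c.U le_rfl _).choose_spec.1]
    exact Scheme.Modules.map_smul (L j) _ (scalars X a) s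

lemma germ_eq (j : I) (s : Γ(L j, ⊤)) (y : X) (hy : y ∈ c.U) :
    germ (L j) y s = germAlg y hy (c.coord j s) • (L j).presheaf.germ c.U y hy (c.e j) := by
  have h := (c.isFrame j c.U le_rfl ((L j).presheaf.map (homOfLE le_top).op s)).choose_spec.1
  have h1 := congrArg ((L j).presheaf.germ c.U y hy) h
  dsimp only at h1
  rw [germ_smul, (L j).presheaf.germ_res_apply, (L j).presheaf.germ_res_apply] at h1
  exact h1

lemma vanishes_iff (j : I) (s : Γ(L j, ⊤)) (y : X) (hy : y ∈ c.U) :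
    Vanishes (X.presheaf.stalk y) (germ (L j) y s) ↔
      germAlg y hy (c.coord j s) ∈ IsLocalRing.maximalIdeal (X.presheaf.stalk y) := by
  rw [c.germ_eq j s y hy]
  exact vanishes_smul_iff ((c.isFrame j).bijective y hy) _

/-- The unit is the transition function between the two frames; it does not depend on the section.
-/
lemma exists_unit (c' : Chart L) (y : X) (hy : y ∈ c.U) (hy' : y ∈ c'.U) (j : I) :
    ∃ u : X.presheaf.stalk y, IsUnit u ∧ ∀ s : Γ(L j, ⊤),
      germAlg y hy (c.coord j s) = u * germAlg y hy' (c'.coord j s) := by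
  obtain ⟨u, hu⟩ := ((c.isFrame j).bijective y hy).2 ((L j).presheaf.germ c'.U y hy' (c'.e j))
  obtain ⟨v, hv⟩ := ((c'.isFrame j).bijective y hy').2 ((L j).presheaf.germ c.U y hy (c.e j))
  have hu' : u • (L j).presheaf.germ c.U y hy (c.e j) =
    (L j).presheaf.germ c'.U y hy' (c'.e j) := hu
  have hv' : v • (L j).presheaf.germ c'.U y hy' (c'.e j) =
    (L j).presheaf.germ c.U y hy (c.e j) := hv
  refine ⟨u, .of_mul_eq_one v ?_, fun s => ?_⟩
  · refine ((c'.isFrame j).bijective y hy').1 ?_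
    change (u * v) • _ = (1 : X.presheaf.stalk y) • _
    rw [mul_smul, hv', hu', one_smul]
  · refine ((c.isFrame j).bijective y hy).1 ?_
    change _ • _ = (u * _) • _
    rw [← c.germ_eq, mul_comm, mul_smul, hu', ← c'.germ_eq]

end Chart

end Charts

end LinearSeries
end

noncomputable section

set_option linter.unusedSectionVars false

namespace LinearSeries

/-! ### Points of a variety and their residue fields -/

section Residue

variable {X : Scheme.{0}} [X.Over (Spec (.of ℂ))]

/-- The residue field at a point. -/
abbrev resField (y : X) : Type := IsLocalRing.ResidueField (X.presheaf.stalk y)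

/-- The value of a function at a point. -/
def resAlg {U : X.Opens} (y : X) (hy : y ∈ U) : Γ(X, U) →ₐ[ℂ] resField y :=
  (IsScalarTower.toAlgHom ℂ (X.presheaf.stalk y) (resField y)).comp (germAlg y hy)

lemma resAlg_eq_zero_iff {U : X.Opens} {y : X} {hy : y ∈ U} {g : Γ(X, U)} :
    resAlg y hy g = 0 ↔ germAlg y hy g ∈ IsLocalRing.maximalIdeal (X.presheaf.stalk y) :=
  IsLocalRing.residue_eq_zero_iff _

lemma resAlg_eq_zero_iff_not_isUnit {U : X.Opens} {y : X} {hy : y ∈ U} {g : Γ(X, U)} :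
    resAlg y hy g = 0 ↔ ¬ IsUnit (germAlg y hy g) :=
  resAlg_eq_zero_iff

/-- The locus where a function is invertible is open, hence stable under generization. -/
lemma resAlg_specializes {U : X.Opens} {y ζ : X} (h : ζ ⤳ y) (hy : y ∈ U) (hζ : ζ ∈ U)
    {g : Γ(X, U)} (hg : resAlg ζ hζ g = 0) : resAlg y hy g = 0 := by
  rw [resAlg_eq_zero_iff_not_isUnit] at hg ⊢
  intro hu
  have h1 : y ∈ X.basicOpen g := (X.mem_basicOpen _ _ hy).2 hu
  exact hg ((X.mem_basicOpen _ _ hζ).1 (h.mem_open (X.basicOpen g).2 h1))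

/-- The specialization of germs at `y` to the residue field at a generization of `y`. -/
def spAlg {y ζ : X} (h : ζ ⤳ y) : X.presheaf.stalk y →ₐ[ℂ] resField ζ :=
  (IsScalarTower.toAlgHom ℂ (X.presheaf.stalk ζ) (resField ζ)).comp
    { (X.presheaf.stalkSpecializes h).hom with
      commutes' := fun c => by
        have := congrArg (fun g => g (scalars X c))
          (X.presheaf.germ_stalkSpecializes (U := ⊤) (y := y) trivial h)
        exact this }

lemma spAlg_germAlg {U : X.Opens} {y ζ : X} (h : ζ ⤳ y) (hy : y ∈ U) (hζ : ζ ∈ U) (g : Γ(X, U)) :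
    spAlg h (germAlg y hy g) = resAlg ζ hζ g := by
  have := congrArg (fun φ => φ g) (X.presheaf.germ_stalkSpecializes (U := U) (y := y) hy h)
  exact congrArg (IsLocalRing.residue _) this

lemma Chart.vanishes_iff_resAlg {I : Type*} {L : I → X.Modules} (c : Chart L) (j : I)
    (s : Γ(L j, ⊤)) (y : X) (hy : y ∈ c.U) :
    Vanishes (X.presheaf.stalk y) (germ (L j) y s) ↔ resAlg y hy (c.coord j s) = 0 :=
  (c.vanishes_iff j s y hy).trans resAlg_eq_zero_iff.symm

lemma ker_resAlg {U : X.Opens} (hU : IsAffineOpen U) (y : X) (hy : y ∈ U) :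
    RingHom.ker (resAlg y hy) = (hU.primeIdealOf ⟨y, hy⟩).asIdeal := by
  rw [hU.primeIdealOf_eq_map_closedPoint]
  ext g
  exact resAlg_eq_zero_iff

lemma eq_of_ker_resAlg {U : X.Opens} (hU : IsAffineOpen U) {y z : X} (hy : y ∈ U) (hz : z ∈ U)
    (h : RingHom.ker (resAlg y hy) = RingHom.ker (resAlg z hz)) : y = z := by
  rw [ker_resAlg hU, ker_resAlg hU] at h
  exact (hU.fromSpec_primeIdealOf ⟨y, hy⟩).symm.trans
    ((congrArg _ (PrimeSpectrum.ext h)).trans (hU.fromSpec_primeIdealOf ⟨z, hz⟩))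

/-- The residue field is the fraction field of the quotient of the sections by a prime, so its
transcendence degree is bounded by the dimension of the ring. -/
lemma exists_resAlg_div {U : X.Opens} (hU : IsAffineOpen U) (y : X) (hy : y ∈ U)
    (z : resField y) : ∃ a b : Γ(X, U), z = resAlg y hy a / resAlg y hy b := by
  obtain ⟨z, rfl⟩ := IsLocalRing.residue_surjective z
  let := X.presheaf.algebra_section_stalk ⟨y, hy⟩
  have hloc := hU.isLocalization_stalk ⟨y, hy⟩
  obtain ⟨a, b, hb⟩ := IsLocalization.exists_mk'_eq (hU.primeIdealOf ⟨y, hy⟩).asIdeal.primeCompl z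
  refine ⟨a, b, ?_⟩
  have hb0 : resAlg y hy b.1 ≠ 0 := by
    intro h0
    have : b.1 ∈ RingHom.ker (resAlg y hy) := h0
    rw [ker_resAlg hU] at this
    exact b.2 this
  rw [eq_div_iff hb0]
  have h1 : z * germAlg y hy b.1 = germAlg y hy a := by
    rw [← hb]
    exact IsLocalization.mk'_spec _ a b
  have h2 := congrArg (IsLocalRing.residue _) h1
  rw [map_mul] at h2
  exact h2

section FiniteType

variable [LocallyOfFiniteType (X ↘ Spec (.of ℂ))]

lemma finiteType_sections {U : X.Opens} (hU : IsAffineOpen U) : Algebra.FiniteType ℂ Γ(X, U) := by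
  rw [← RingHom.finiteType_algebraMap]
  have h1 := (X ↘ Spec (.of ℂ)).finiteType_appLE (isAffineOpen_top _) hU le_top
  have h2 := h1.comp (RingHom.FiniteType.of_surjective
    (Scheme.ΓSpecIso (.of ℂ)).inv.hom (Scheme.ΓSpecIso (.of ℂ)).symm.commRingCatIsoToRingEquiv.surjective)
  exact h2

lemma jacobsonSpace : JacobsonSpace X :=
  have : IsJacobsonRing (CommRingCat.of ℂ) := inferInstanceAs (IsJacobsonRing ℂ)
  LocallyOfFiniteType.jacobsonSpace (X ↘ Spec (.of ℂ))

lemma exists_algHom_of_mem_closedPoints {U : X.Opens} (hU : IsAffineOpen U) {y : X} (hy : y ∈ U)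
    (hyc : y ∈ closedPoints X) :
    ∃ χ : Γ(X, U) →ₐ[ℂ] ℂ, ∀ g, χ g = 0 ↔ resAlg y hy g = 0 := by
  have := finiteType_sections hU
  have hmax := hU.primeIdealOf_isMaximal_of_isClosed ⟨y, hy⟩ hyc
  obtain ⟨χ, hχ⟩ := exists_algHom_of_isMaximal (hU.primeIdealOf ⟨y, hy⟩).asIdeal
  rw [← ker_resAlg hU] at hχ
  exact ⟨χ, fun g => by rw [← RingHom.mem_ker, hχ, RingHom.mem_ker]⟩

lemma exists_mem_closedPoints_of_algHom {U : X.Opens} (hU : IsAffineOpen U)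
    (χ : Γ(X, U) →ₐ[ℂ] ℂ) :
    ∃ (y : X) (hy : y ∈ U), y ∈ closedPoints X ∧ ∀ g, χ g = 0 ↔ resAlg y hy g = 0 := by
  have := jacobsonSpace (X := X)
  have hsurj : Function.Surjective χ := fun c => ⟨algebraMap ℂ _ c, by simp⟩
  have hmax : (RingHom.ker χ).IsMaximal := RingHom.ker_isMaximal_of_surjective _ hsurj
  let p : PrimeSpectrum Γ(X, U) := ⟨RingHom.ker χ, hmax.isPrime⟩
  have hy : hU.fromSpec p ∈ U := by
    rw [← SetLike.mem_coe, ← hU.range_fromSpec]; exact ⟨p, rfl⟩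
  refine ⟨hU.fromSpec p, hy, ?_, fun g => ?_⟩
  · have h1 := hU.fromSpec.isOpenEmbedding.preimage_closedPoints
    have h2 : p ∈ closedPoints (Spec Γ(X, U)) :=
      (PrimeSpectrum.isClosed_singleton_iff_isMaximal p).2 hmax
    rw [← h1] at h2
    exact h2
  · have h1 : hU.primeIdealOf ⟨hU.fromSpec p, hy⟩ = p :=
      hU.fromSpec.isOpenEmbedding.injective (hU.fromSpec_primeIdealOf ⟨_, hy⟩)
    have h2 := ker_resAlg hU _ hy
    rw [h1] at h2
    rw [← RingHom.mem_ker, ← RingHom.mem_ker, h2]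

lemma noetherianSpace [QuasiCompact (X ↘ Spec (.of ℂ))] : NoetherianSpace X := by
  have : IsNoetherianRing (CommRingCat.of ℂ) := inferInstanceAs (IsNoetherianRing ℂ)
  have h1 : IsLocallyNoetherian X := LocallyOfFiniteType.isLocallyNoetherian (X ↘ Spec (.of ℂ))
  have h2 : CompactSpace X := QuasiCompact.compactSpace_of_compactSpace (X ↘ Spec (.of ℂ))
  have h3 : IsNoetherian X := {}
  infer_instance

end FiniteType

section Integral

variable [AlgebraicGeometry.IsIntegral X]

lemma genericPoint_mem {U : X.Opens} {y : X} (hy : y ∈ U) : genericPoint X ∈ U :=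
  (genericPoint_specializes y).mem_open U.2 hy

lemma resAlg_genericPoint_injective {U : X.Opens} (hη : genericPoint X ∈ U) :
    Function.Injective (resAlg (genericPoint X) hη) := by
  rw [injective_iff_map_eq_zero]
  intro g hg
  rw [resAlg_eq_zero_iff_not_isUnit] at hg
  have h0 : germAlg (genericPoint X) hη g = 0 := by
    by_contra h0
    exact hg (isUnit_iff_ne_zero (a := (germAlg (genericPoint X) hη g : X.functionField)).2 h0)
  exact germ_injective_of_isIntegral (X := X) (genericPoint X) hη (h0.trans (map_zero (X.presheaf.germ U _ hη).hom).symm)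

lemma isDomain_sections {U : X.Opens} {y : X} (hy : y ∈ U) : IsDomain Γ(X, U) :=
  (resAlg_genericPoint_injective (genericPoint_mem hy)).isDomain (resAlg _ _).toRingHom

lemma eq_genericPoint_of_ker_resAlg {U : X.Opens} (hU : IsAffineOpen U) {y : X} (hy : y ∈ U)
    (h : RingHom.ker (resAlg y hy) = ⊥) : y = genericPoint X := by
  refine eq_of_ker_resAlg hU hy (genericPoint_mem hy) (h.trans ?_)
  exact ((RingHom.injective_iff_ker_eq_bot _).1
    (resAlg_genericPoint_injective (genericPoint_mem hy))).symm

end Integral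

lemma ringKrullDim_sections_le {U : X.Opens} (hU : IsAffineOpen U) :
    ringKrullDim Γ(X, U) ≤ topologicalKrullDim X := by
  rw [← PrimeSpectrum.topologicalKrullDim_eq_ringKrullDim]
  exact hU.fromSpec.isOpenEmbedding.isInducing.topologicalKrullDim_le

end Residue

/-! ### Transcendence degree of residue fields. -/

section Rank

variable {A F : Type*} [CommRing A] [IsDomain A] [Algebra ℂ A] [Algebra.FiniteType ℂ A] [Field F]
  [Algebra ℂ F]

/-- `F` is algebraic over the image of `A`, whose transcendence degree is at most that of `A`, and
strictly less when `π` has a kernel. The strict case is what separates non-generic points from the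
generic one. -/
lemma algRk_le_of_forall_div (π : A →ₐ[ℂ] F) (hπ : ∀ z, ∃ a b, z = π a / π b) {n : ℕ}
    (hn : ringKrullDim A ≤ n) (S : Set F) :
    algRk ℂ S ≤ n ∧ (RingHom.ker π ≠ ⊥ → algRk ℂ S + 1 ≤ n) := by
  obtain ⟨t, ht⟩ := (inferInstance : Algebra.FiniteType ℂ A).out
  have hr : π.range = Algebra.adjoin ℂ (π '' t) := by
    rw [← AlgHom.map_adjoin, ht, Algebra.map_top]
  obtain ⟨d, hd, hdr⟩ := trdeg_subalgebra (S := π '' t) (B := π.range) (t.finite_toSet.image _)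
    (by rw [hr]; exact Algebra.subset_adjoin) (by rw [hr]; exact adjoin_subset_algClosure _)
  have hS : algRk ℂ S ≤ d := by
    rw [← hd]
    refine algRk_le_of_subset_closure fun z _ => ?_
    obtain ⟨a, b, rfl⟩ := hπ z
    have ha := adjoin_subset_algClosure (k := ℂ) (π '' t) (hr.le ⟨a, rfl⟩)
    have hb := adjoin_subset_algClosure (k := ℂ) (π '' t) (hr.le ⟨b, rfl⟩)
    rw [mem_algClosure_iff] at ha hb ⊢
    rw [div_eq_mul_inv]
    exact ha.mul hb.inv
  obtain ⟨e, he⟩ : ∃ e : ℕ, Algebra.trdeg ℂ A = e := by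
    obtain ⟨e, -, he⟩ := trdeg_subalgebra (k := ℂ) (S := (t : Set A)) (B := ⊤) t.finite_toSet
      (fun _ _ => trivial) (by rw [← ht]; exact adjoin_subset_algClosure _)
    exact ⟨e, by rw [← he]; exact (Subalgebra.topEquiv (R := ℂ) (A := A)).trdeg_eq.symm⟩
  have hen : e ≤ n := by
    have := (le_ringKrullDim_of_trdeg he).trans hn
    exact_mod_cast this
  have hker := lift_trdeg_le_of_surjective π.rangeRestrict π.rangeRestrict_surjective
  rw [he, hdr] at hker
  simp only [Cardinal.lift_natCast, Nat.cast_le] at hker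
  refine ⟨hS.trans (by exact_mod_cast hker.trans hen), fun hne => ?_⟩
  have hp : (RingHom.ker π).IsPrime := RingHom.ker_isPrime _
  have h1 := trdeg_quotient_lt (k := ℂ) (RingHom.ker π) hne (by rw [he]; exact Cardinal.natCast_lt_aleph0)
  have h2 := AlgEquiv.lift_trdeg_eq (R := ℂ) (A := A ⧸ RingHom.ker π) (A' := π.range)
    (Ideal.quotientKerEquivRange π)
  obtain ⟨m, hm⟩ := Cardinal.lt_aleph0.1 (h1.trans (by rw [he]; exact Cardinal.natCast_lt_aleph0))
  rw [hm, he] at h1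
  rw [hm, hdr] at h2
  simp only [Cardinal.lift_natCast, Nat.cast_inj, Nat.cast_lt] at h1 h2
  have h3 : d + 1 ≤ n := by omega
  exact (add_le_add hS le_rfl).trans (by exact_mod_cast h3)

end Rank

end LinearSeries
end

noncomputable section

set_option linter.unusedSectionVars false

namespace LinearSeries

lemma mem_algClosure_of_map {k : Type*} [Field k] {A B : Type*} [CommRing A] [IsDomain A]
    [Algebra k A] [CommRing B] [IsDomain B] [Algebra k B] {S : Set A} {a : A} (g : A →ₐ[k] B)
    (hg : Function.Injective g)
    (ha : g a ∈ (AlgebraicIndependent.matroid k B).closure (g '' S)) :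
    a ∈ (AlgebraicIndependent.matroid k A).closure S := by
  rw [mem_algClosure_iff] at ha ⊢
  let g' : Algebra.adjoin k S →+* Algebra.adjoin k (g '' S) :=
    ((g.comp (Algebra.adjoin k S).val).codRestrict (Algebra.adjoin k (g '' S)) (fun x => by
      rw [← AlgHom.map_adjoin]
      exact ⟨x.1, x.2, rfl⟩)).toRingHom
  refine ha.of_ringHom_of_comp_eq g' g.toRingHom ?_ hg rfl
  rintro ⟨x, hx⟩
  rw [← AlgHom.map_adjoin] at hx
  obtain ⟨y, hy, rfl⟩ := hx
  exact ⟨⟨y, hy⟩, rfl⟩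

lemma exists_algHom_apply_ne_zero {A : Type*} [CommRing A] [IsDomain A] [Algebra ℂ A]
    [Algebra.FiniteType ℂ A] {x : A} (hx : x ≠ 0) : ∃ χ : A →ₐ[ℂ] ℂ, χ x ≠ 0 := by
  have : IsDomain (Localization.Away x) :=
    IsLocalization.isDomain_localization (powers_le_nonZeroDivisors_of_noZeroDivisors hx)
  have : Algebra.FiniteType A (Localization.Away x) :=
    have := IsLocalization.Away.finitePresentation (S := Localization.Away x) x
    .of_finitePresentation
  have : Algebra.FiniteType ℂ (Localization.Away x) :=
    Algebra.FiniteType.trans (S := A) inferInstance inferInstance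
  obtain ⟨M, hM⟩ := Ideal.exists_maximal (Localization.Away x)
  obtain ⟨φ, -⟩ := exists_algHom_of_isMaximal M
  refine ⟨φ.comp (IsScalarTower.toAlgHom ℂ A _), ?_⟩
  exact ((IsLocalization.Away.algebraMap_isUnit (S := Localization.Away x) x).map φ).ne_zero

lemma algHom_eq_of_ker_eq {A : Type*} [CommRing A] [Algebra ℂ A] {χ χ' : A →ₐ[ℂ] ℂ}
    (h : ∀ g, χ g = 0 → χ' g = 0) : χ = χ' := by
  ext x
  have h1 := h (x - algebraMap ℂ A (χ x)) (by simp)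
  rw [map_sub, sub_eq_zero, AlgHom.commutes] at h1
  exact h1.symm

/-! ### The coordinates of a collection of linear series -/

section Coordinates

variable {X : Scheme.{0}} [X.Over (Spec (.of ℂ))] {k : ℕ} {L : Fin k → X.Modules}
  {E : ∀ i, Submodule ℂ Γ(L i, ⊤)} {ι : Fin k → Type} [∀ j, Fintype (ι j)]
  [∀ j, DecidableEq (ι j)] (b : ∀ j, Module.Basis (ι j) ℂ (E j))

/-- The basis of `E₁ × ⋯ × E_k` given by bases of the factors. -/
def piBasis : Module.Basis (Σ j, ι j) ℂ (∀ j, E j) := Pi.basis b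

lemma piBasis_repr (s : ∀ j, E j) (j : Fin k) (β : ι j) :
    (piBasis b).repr s ⟨j, β⟩ = (b j).repr (s j) β := Pi.basis_repr _ _ _

/-- The coordinate functions of the basis sections in a chart. -/
def Chart.basisCoord (c : Chart L) (j : Fin k) (β : ι j) : Γ(X, c.U) :=
  c.coord j (b j β : Γ(L j, ⊤))

lemma Chart.coord_eq_sum (c : Chart L) (s : ∀ j, E j) (j : Fin k) :
    c.coord j (s j : Γ(L j, ⊤)) = ∑ β, (piBasis b).repr s ⟨j, β⟩ • c.basisCoord b j β := by
  have h1 : ((s j : E j) : Γ(L j, ⊤)) = ∑ β, (b j).repr (s j) β • (b j β : Γ(L j, ⊤)) := by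
    conv_lhs => rw [← (b j).sum_repr (s j)]
    rw [Submodule.coe_sum]; rfl
  rw [h1, map_sum]
  simp only [map_smul, piBasis_repr, Chart.basisCoord]

lemma Chart.mem_zeroSet_iff (c : Chart L) {s : ∀ j, E j} {y : X} (hyc : y ∈ closedPoints X)
    (hy : y ∈ c.U) : y ∈ zeroSet E s ↔
      ∀ j, ∑ β, (piBasis b).repr s ⟨j, β⟩ • resAlg y hy (c.basisCoord b j β) = 0 := by
  have : ∀ j, Vanishes (X.presheaf.stalk y) (germ (L j) y (s j)) ↔
      ∑ β, (piBasis b).repr s ⟨j, β⟩ • resAlg y hy (c.basisCoord b j β) = 0 := fun j => by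
    rw [c.vanishes_iff_resAlg j _ y hy, c.coord_eq_sum b, map_sum]
    simp only [map_smul]
  simp only [← this]
  exact ⟨fun h => h.2, fun h => ⟨hyc, h⟩⟩

/-- Base-point freeness speaks of closed points only. A non-closed `y` specializes to a closed point
inside the chart, and if all basis sections vanished at `y` they would vanish there too. -/
lemma Chart.exists_basisCoord_ne_zero [LocallyOfFiniteType (X ↘ Spec (.of ℂ))]
    (hE : ∀ j, BasePointFree (E j)) (c : Chart L) (y : X) (hy : y ∈ c.U) (j : Fin k) :
    ∃ β, resAlg y hy (c.basisCoord b j β) ≠ 0 := by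
  have := jacobsonSpace (X := X)
  obtain ⟨z, ⟨hz1, hz2⟩, hzc⟩ := nonempty_inter_closedPoints (Z := closure {y} ∩ c.U)
    ⟨y, subset_closure rfl, hy⟩ (isClosed_closure.isLocallyClosed.inter c.U.2.isLocallyClosed)
  have hyz : y ⤳ z := specializes_iff_mem_closure.2 hz1
  obtain ⟨t, ht, hv⟩ := hE j z hzc
  rw [c.vanishes_iff_resAlg j t z hz2] at hv
  by_contra! h
  refine hv ?_
  have h1 : t = ∑ β, (b j).repr ⟨t, ht⟩ β • (b j β : Γ(L j, ⊤)) := by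
    have := congrArg Subtype.val ((b j).sum_repr ⟨t, ht⟩)
    rw [Submodule.coe_sum] at this
    exact this.symm
  rw [h1, map_sum, map_sum]
  refine Finset.sum_eq_zero fun β _ => ?_
  rw [map_smul, map_smul]
  have h2 : resAlg z hz2 (c.coord j (b j β : Γ(L j, ⊤))) = 0 :=
    resAlg_specializes hyz hz2 hy (h β)
  rw [h2, smul_zero]

/-- The ideal of the polynomials vanishing on the systems which vanish at the point `ζ`,
computed in a chart. -/
def Chart.pointIdeal (c : Chart L) (ζ : X) (hζ : ζ ∈ c.U) :
    Ideal (MvPolynomial (Σ j, ι j) ℂ) :=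
  incIdeal fun j β => resAlg ζ hζ (c.basisCoord b j β)

lemma Chart.pointIdeal_eq (c c' : Chart L) (ζ : X) (hζ : ζ ∈ c.U) (hζ' : ζ ∈ c'.U) :
    c.pointIdeal b ζ hζ = c'.pointIdeal b ζ hζ' := by
  choose u hu hcu using fun j => c.exists_unit c' ζ hζ hζ' j
  refine Eq.trans ?_ (incIdeal_scale (fun j β => resAlg ζ hζ' (c'.basisCoord b j β))
    (fun j => IsLocalRing.residue _ (u j)) fun j => ((hu j).map (IsLocalRing.residue _)).ne_zero)
  rw [Chart.pointIdeal]
  congr 1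
  ext j β
  exact (congrArg (IsLocalRing.residue _) (hcu j _)).trans (map_mul _ _ _)

/-- The chart `c` may miss `y`; a chart around `y` also contains its generization `ζ` and gives the
same ideal, so the specialization lemma applies at the local ring of `y`. -/
lemma Chart.eval_eq_zero_of_mem_pointIdeal [LocallyOfFiniteType (X ↘ Spec (.of ℂ))]
    (hL : ∀ j, IsLineBundle (L j)) (hE : ∀ j, BasePointFree (E j)) (c : Chart L) {ζ y : X}
    (hζ : ζ ∈ c.U) (h : ζ ⤳ y) {s : ∀ j, E j} (hy : y ∈ zeroSet E s)
    {P : MvPolynomial (Σ j, ι j) ℂ} (hP : P ∈ c.pointIdeal b ζ hζ) :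
    MvPolynomial.eval ((piBasis b).repr s) P = 0 := by
  obtain ⟨c', hyc', -⟩ := exists_chart hL y ⊤ trivial
  have hζ' := h.mem_open c'.U.2 hyc'
  rw [c.pointIdeal_eq b c' ζ hζ hζ', Chart.pointIdeal] at hP
  refine eval_eq_zero_of_mem_incIdeal (spAlg h) (fun j β => germAlg y hyc' (c'.basisCoord b j β))
    (fun j => ?_) ?_ _ fun j => ?_
  · obtain ⟨β, hβ⟩ := c'.exists_basisCoord_ne_zero b hE y hyc' j
    exact ⟨β, not_not.1 fun h => hβ (resAlg_eq_zero_iff_not_isUnit.2 h)⟩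
  · simp only [spAlg_germAlg h hyc' hζ']
    exact hP
  · have h1 := (c'.mem_zeroSet_iff b hy.1 hyc').1 hy j
    have h2 : resAlg y hyc' (∑ β, (piBasis b).repr s ⟨j, β⟩ • c'.basisCoord b j β) = 0 := by
      rw [map_sum]; simpa only [map_smul] using h1
    rw [resAlg_eq_zero_iff, map_sum] at h2
    simpa only [map_smul] using h2

/-- A chart in which some basis section of each of the linear series vanishes nowhere. -/
structure PivotChart extends Chart L where
  /-- The indices of the basis sections vanishing nowhere. -/
  a : ∀ j, ι j
  isUnit : ∀ j, IsUnit (toChart.basisCoord b j (a j))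
  /-- The chart is not empty. -/
  genericPoint_mem : ∀ [IrreducibleSpace X], genericPoint X ∈ toChart.U

lemma exists_pivotChart [AlgebraicGeometry.IsIntegral X] [LocallyOfFiniteType (X ↘ Spec (.of ℂ))]
    (hL : ∀ j, IsLineBundle (L j)) (hE : ∀ j, BasePointFree (E j)) :
    Nonempty (PivotChart b) := by
  obtain ⟨c, hc, -⟩ := exists_chart hL (genericPoint X) ⊤ trivial
  choose a ha using c.exists_basisCoord_ne_zero b hE (genericPoint X) hc
  have hO : IsOpen (⋂ j, (X.basicOpen (c.basisCoord b j (a j)) : Set X)) :=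
    isOpen_iInter_of_finite fun j => (X.basicOpen _).2
  have hmem : ∀ {y : X} (hy : y ∈ c.U) {g : Γ(X, c.U)}, y ∈ X.basicOpen g ↔ resAlg y hy g ≠ 0 :=
    fun {y} hy {g} => (X.mem_basicOpen _ _ hy).trans
      (not_not.symm.trans (not_congr resAlg_eq_zero_iff_not_isUnit).symm)
  -- Shrinking around the generic point to the locus where the chosen basis sections are nonzero
  -- makes them units in the new chart.
  obtain ⟨c', hc', hle⟩ := exists_chart hL (genericPoint X) (⟨_, hO⟩ ⊓ c.U)
    ⟨Set.mem_iInter.2 fun j => (hmem hc).2 (ha j), hc⟩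
  refine ⟨⟨c', a, fun j => ?_, hc'⟩⟩
  refine RingedSpace.isUnit_of_isUnit_germ X.toRingedSpace c'.U _ fun y hy => ?_
  obtain ⟨u, hu, hcu⟩ := c'.exists_unit c y hy (hle hy).2 j
  have h1 : germAlg y hy (c'.basisCoord b j (a j)) = _ := hcu (b j (a j))
  have h2 : IsUnit (germAlg y (hle hy).2 (c.basisCoord b j (a j))) := by
    by_contra h
    exact (hmem (hle hy).2).1 (Set.mem_iInter.1 (hle hy).1 j) (resAlg_eq_zero_iff_not_isUnit.2 h)
  have h3 : IsUnit (germAlg y hy (c'.basisCoord b j (a j))) := by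
    rw [h1]; exact hu.mul h2
  exact h3

end Coordinates

end LinearSeries
end

noncomputable section

set_option linter.unusedSectionVars false

namespace LinearSeries

/-! ### The consistency variety -/

section Consistency

variable {X : Scheme.{0}} [X.Over (Spec (.of ℂ))] {k : ℕ} {L : Fin k → X.Modules}
  {E : ∀ i, Submodule ℂ Γ(L i, ⊤)} {ι : Fin k → Type} [∀ j, Fintype (ι j)]
  [∀ j, DecidableEq (ι j)] {b : ∀ j, Module.Basis (ι j) ℂ (E j)}

namespace PivotChart

variable (p : PivotChart b)

/-- The quotients of the basis sections by the sections vanishing nowhere. -/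
def quot (j : Fin k) (β : ι j) : Γ(X, p.U) :=
  ((p.isUnit j).unit⁻¹ : Γ(X, p.U)ˣ) * p.basisCoord b j β

lemma quot_a (j : Fin k) : p.quot j (p.a j) = 1 := (p.isUnit j).val_inv_mul

lemma basisCoord_eq (j : Fin k) (β : ι j) :
    p.basisCoord b j β = p.basisCoord b j (p.a j) * p.quot j β := by
  rw [quot, ← mul_assoc, (p.isUnit j).mul_val_inv, one_mul]

/-- The polynomial functions on the total space of the incidence variety over the chart. -/
abbrev Tot : Type := MvPolynomial (FreeIdx p.a) Γ(X, p.U)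

/-- The projection of the incidence variety. -/
def genHom : MvPolynomial (Σ j, ι j) ℂ →ₐ[ℂ] p.Tot :=
  MvPolynomial.aeval (genPt p.a p.quot)

lemma genHom_X (q : Σ j, ι j) : p.genHom (MvPolynomial.X q) = genPt p.a p.quot q := by
  simp [genHom]

/-- A complex point of `Tot` is a closed point of the chart together with a system vanishing there;
`exists_algHom_of_mem_zeroSet` is the converse. -/
lemma mem_zeroSet_of_algHom (χ : p.Tot →ₐ[ℂ] ℂ) {s : ∀ j, E j}
    (hs : ∀ q, (piBasis b).repr s q = χ (genPt p.a p.quot q)) {y : X} (hy : y ∈ p.U)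
    (hyc : y ∈ closedPoints X) (h : ∀ g, χ (MvPolynomial.C g) = 0 ↔ resAlg y hy g = 0) :
    y ∈ zeroSet E s := by
  rw [p.mem_zeroSet_iff b hyc hy]
  intro j
  have h1 : ∑ β, (piBasis b).repr s ⟨j, β⟩ • resAlg y hy (p.basisCoord b j β) =
      resAlg y hy (∑ β, (piBasis b).repr s ⟨j, β⟩ • p.basisCoord b j β) := by
    rw [map_sum]; simp only [map_smul]
  have hC : ∀ (x : ℂ) (g : Γ(X, p.U)),
      χ (MvPolynomial.C (x • g)) = x * χ (MvPolynomial.C g) := fun x g => by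
    rw [Algebra.smul_def, map_mul, map_mul]
    congr 1
    exact χ.commutes x
  rw [h1, ← h, map_sum, map_sum]
  simp only [hC, hs, ← map_mul]
  rw [← map_sum]
  have h2 : ∑ β, genPt p.a p.quot ⟨j, β⟩ * MvPolynomial.C (p.basisCoord b j β) =
      MvPolynomial.C (p.basisCoord b j (p.a j)) *
        ∑ β, genPt p.a p.quot ⟨j, β⟩ * MvPolynomial.C (p.quot j β) := by
    rw [Finset.mul_sum]
    refine Finset.sum_congr rfl fun β _ => ?_
    rw [p.basisCoord_eq j β, map_mul]
    ring
  rw [h2, sum_genPt_mul p.quot_a, mul_zero, map_zero]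

section FiniteType

variable [LocallyOfFiniteType (X ↘ Spec (.of ℂ))]

lemma exists_algHom_of_mem_zeroSet {s : ∀ j, E j} {y : X} (hy : y ∈ p.U) (hys : y ∈ zeroSet E s) :
    ∃ χ : p.Tot →ₐ[ℂ] ℂ, (∀ q, χ (genPt p.a p.quot q) = (piBasis b).repr s q) ∧
      ∀ g, χ (MvPolynomial.C g) = 0 ↔ resAlg y hy g = 0 := by
  obtain ⟨χ, hχ⟩ := exists_algHom_of_mem_closedPoints p.isAffineOpen hy hys.1
  let := χ.toRingHom.toAlgebra
  have htow : IsScalarTower ℂ Γ(X, p.U) ℂ := .of_algebraMap_eq fun x => (χ.commutes x).symm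
  let u : (Σ j, ι j) → ℂ := fun q => (piBasis b).repr s q
  let φ : p.Tot →ₐ[ℂ] ℂ :=
    (MvPolynomial.aeval (R := Γ(X, p.U)) fun q : FreeIdx p.a => u q.1).restrictScalars ℂ
  have hφC : ∀ g, φ (MvPolynomial.C g) = χ g := fun g => MvPolynomial.aeval_C _ g
  refine ⟨φ, fun q => ?_, fun g => by rw [hφC, hχ]⟩
  refine aeval_genPt_eq (S := ℂ) p.quot_a u (fun j => ?_) q
  have h1 := (p.mem_zeroSet_iff b hys.1 hy).1 hys j
  have h2 : resAlg y hy (∑ β, u ⟨j, β⟩ • p.basisCoord b j β) = 0 := by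
    rw [map_sum]; simpa only [map_smul] using h1
  rw [← hχ, map_sum] at h2
  have h3 : χ (p.basisCoord b j (p.a j)) * ∑ β, u ⟨j, β⟩ * χ (p.quot j β) = 0 := by
    rw [← h2, Finset.mul_sum]
    refine Finset.sum_congr rfl fun β _ => ?_
    rw [map_smul, p.basisCoord_eq j β, map_mul, smul_eq_mul]
    ring
  exact (mul_eq_zero.1 h3).resolve_left ((p.isUnit j).map χ).ne_zero

variable [AlgebraicGeometry.IsIntegral X]

/-- The generic values of the quotients of the basis sections. -/
def gen (j : Fin k) (β : ι j) : resField (genericPoint X) :=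
  resAlg (genericPoint X) p.genericPoint_mem (p.quot j β)

lemma gen_a (j : Fin k) : p.gen j (p.a j) = 1 := by rw [gen, quot_a, map_one]

/-- The passage to the generic point. -/
def totGen : p.Tot →ₐ[ℂ] MvPolynomial (FreeIdx p.a) (resField (genericPoint X)) :=
  MvPolynomial.mapAlgHom (resAlg (genericPoint X) p.genericPoint_mem)

lemma totGen_injective : Function.Injective p.totGen :=
  MvPolynomial.map_injective _ (resAlg_genericPoint_injective _)

lemma totGen_genPt (q : Σ j, ι j) : p.totGen (genPt p.a p.quot q) = genPt p.a p.gen q :=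
  map_genPt p.a p.quot (resAlg (genericPoint X) p.genericPoint_mem).toRingHom q

lemma totGen_comp_genHom : p.totGen.comp p.genHom = MvPolynomial.aeval (genPt p.a p.gen) := by
  ext q
  simp [genHom_X, totGen_genPt]

/-- Functions on the chart embed in the function field, so the kernel can be computed at the generic
point, where it does not depend on the chart. -/
lemma ker_genHom :
    RingHom.ker p.genHom = p.pointIdeal b (genericPoint X) p.genericPoint_mem := by
  have h1 : RingHom.ker p.genHom = RingHom.ker (p.totGen.comp p.genHom) := by
    ext P
    rw [RingHom.mem_ker, RingHom.mem_ker, AlgHom.comp_apply,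
      map_eq_zero_iff _ p.totGen_injective]
  rw [h1, totGen_comp_genHom]
  refine (incIdeal_eq_ker p.a p.gen p.gen_a).symm.trans ?_
  refine Eq.trans ?_ (incIdeal_scale (fun j β => resAlg _ p.genericPoint_mem (p.basisCoord b j β))
    (fun j => resAlg (genericPoint X) p.genericPoint_mem ((p.isUnit j).unit⁻¹ : Γ(X, p.U)ˣ))
    fun j => (((p.isUnit j).unit⁻¹).isUnit.map
      (resAlg (genericPoint X) p.genericPoint_mem)).ne_zero)
  congr 1
  ext j β
  rw [gen, quot, map_mul]

instance : IsDomain Γ(X, p.U) := isDomain_sections p.genericPoint_mem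

instance : Algebra.FiniteType ℂ Γ(X, p.U) := finiteType_sections p.isAffineOpen

instance : Algebra.FiniteType ℂ p.Tot :=
  Algebra.FiniteType.trans (S := Γ(X, p.U)) inferInstance inferInstance

lemma exists_mem_zeroSet_of_algHom (χ : p.Tot →ₐ[ℂ] ℂ) :
    ∃ s : ∀ j, E j, (∀ q, (piBasis b).repr s q = χ (genPt p.a p.quot q)) ∧
      (zeroSet E s).Nonempty := by
  let s := (piBasis b).equivFun.symm fun q => χ (genPt p.a p.quot q)
  have hs : ∀ q, (piBasis b).repr s q = χ (genPt p.a p.quot q) :=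
    congrFun ((piBasis b).equivFun.apply_symm_apply _)
  obtain ⟨y, hy, hyc, h⟩ := exists_mem_closedPoints_of_algHom p.isAffineOpen
    (χ.comp (IsScalarTower.toAlgHom ℂ Γ(X, p.U) p.Tot))
  exact ⟨s, hs, y, p.mem_zeroSet_of_algHom χ hs hy hyc h⟩

lemma eval_repr_eq (χ : p.Tot →ₐ[ℂ] ℂ) {s : ∀ j, E j}
    (hs : ∀ q, (piBasis b).repr s q = χ (genPt p.a p.quot q)) (P : MvPolynomial (Σ j, ι j) ℂ) :
    MvPolynomial.eval ((piBasis b).repr s) P = χ (p.genHom P) := by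
  have h : ⇑((piBasis b).repr s) = fun q => χ (genPt p.a p.quot q) := funext hs
  rw [genHom, MvPolynomial.comp_aeval_apply, h]
  rfl

/-- The generic point specializes to every point of `X`, so equations found over the chart also hold
for systems whose zeros lie outside it. -/
lemma eval_eq_zero_of_mem_ker (hL : ∀ j, IsLineBundle (L j)) (hE : ∀ j, BasePointFree (E j))
    {P : MvPolynomial (Σ j, ι j) ℂ} (hP : p.genHom P = 0)
    {s : ∀ j, E j} (hs : (zeroSet E s).Nonempty) :
    MvPolynomial.eval ((piBasis b).repr s) P = 0 := by
  obtain ⟨y, hy⟩ := hs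
  refine p.eval_eq_zero_of_mem_pointIdeal b hL hE p.genericPoint_mem (genericPoint_specializes y)
    hy ?_
  rw [← ker_genHom]
  exact hP

/-- By the Nullstellensatz a nonzero element of `Tot` is nonzero at some complex point, which is a
consistent system. -/
lemma genHom_eq_zero_of_forall {P : MvPolynomial (Σ j, ι j) ℂ}
    (hP : ∀ s : ∀ j, E j, (zeroSet E s).Nonempty →
      MvPolynomial.eval ((piBasis b).repr s) P = 0) : p.genHom P = 0 := by
  by_contra h0
  obtain ⟨χ, hχ⟩ := exists_algHom_apply_ne_zero h0
  obtain ⟨s, hs, hne⟩ := p.exists_mem_zeroSet_of_algHom χ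
  exact hχ ((p.eval_repr_eq χ hs P).symm.trans (hP s hne))

end FiniteType

end PivotChart

end Consistency

end LinearSeries
end

noncomputable section

set_option linter.unusedSectionVars false

namespace LinearSeries

lemma algRk_image_eq {k : Type*} [Field k] {A B : Type*} [CommRing A] [IsDomain A]
    [Algebra k A] [CommRing B] [IsDomain B] [Algebra k B] (S : Set A) (g : A →ₐ[k] B)
    (hg : Function.Injective g) : algRk k (g '' S) = algRk k S := by
  refine le_antisymm (algRk_image_le g hg) ?_
  obtain ⟨I, hI⟩ := (AlgebraicIndependent.matroid k A).exists_isBasis S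
  have h1 : AlgebraicIndependent k fun i : I => i.1 := hI.indep
  have h2 : AlgebraicIndependent k fun i : I => g i.1 := h1.map' hg
  have h3 := Matroid.Indep.encard_le_eRk_of_subset
    (AlgebraicIndependent.matroid_indep_iff.2 h2.coe_range) (X := g '' S) (by
      rintro _ ⟨i, rfl⟩
      exact ⟨i.1, hI.subset i.2, rfl⟩)
  rw [algRk, ← hI.encard_eq_eRk]
  refine le_trans (le_of_eq ?_) h3
  rw [← Set.image_univ, h2.injective.injOn.encard_image, Set.encard_univ]
  rfl

/-- The range of `ψ` is a quotient of the range of `ψ'`. -/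
lemma algRk_range_le_of_ker_le {σ D D' : Type*} [Fintype σ] [CommRing D] [IsDomain D]
    [Algebra ℂ D] [CommRing D'] [IsDomain D'] [Algebra ℂ D'] (ψ : MvPolynomial σ ℂ →ₐ[ℂ] D)
    (ψ' : MvPolynomial σ ℂ →ₐ[ℂ] D') (h : RingHom.ker ψ' ≤ RingHom.ker ψ) :
    algRk ℂ (Set.range fun p => ψ (MvPolynomial.X p)) ≤
      algRk ℂ (Set.range fun p => ψ' (MvPolynomial.X p)) := by
  obtain ⟨d, hd, htr⟩ := algRk_range_eq_trdeg ψ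
  obtain ⟨d', hd', htr'⟩ := algRk_range_eq_trdeg ψ'
  let g : ψ'.range →ₐ[ℂ] ψ.range :=
    AlgHom.liftOfSurjective ψ'.rangeRestrict ψ'.rangeRestrict_surjective ψ.rangeRestrict
      fun P hP => Subtype.ext (h (congrArg Subtype.val hP : ψ' P = 0))
  have hg : Function.Surjective g := by
    rintro ⟨_, P, rfl⟩
    exact ⟨ψ'.rangeRestrict P, AlgHom.liftOfSurjective_apply _ _ _ _ P⟩
  have h1 := lift_trdeg_le_of_surjective g hg
  rw [htr, htr'] at h1
  simp only [Cardinal.lift_natCast, Nat.cast_le] at h1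
  rw [hd, hd']
  exact_mod_cast h1

section FreeIdx

variable {I : Type*} [Fintype I] [DecidableEq I] {ι : I → Type*} [∀ j, Fintype (ι j)]
  [∀ j, DecidableEq (ι j)] (a : ∀ j, ι j)

lemma card_freeIdx_add : Fintype.card (FreeIdx a) + Fintype.card I = Fintype.card (Σ j, ι j) := by
  rw [← Fintype.card_sum]
  refine Fintype.card_congr
    { toFun := fun q => q.elim (fun q => q.1) fun j => ⟨j, a j⟩
      invFun := fun q => if h : q.2 ≠ a q.1 then .inl ⟨q, h⟩ else .inr q.1
      left_inv := ?_
      right_inv := ?_ }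
  · rintro (⟨q, hq⟩ | j)
    · simp [hq]
    · simp
  · rintro ⟨j, β⟩
    by_cases h : β = a j
    · subst h; simp
    · simp [h]

lemma algRk_univ_mvPolynomial_le {τ : Type*} [Fintype τ] {K : Type*} [Field K] [Algebra ℂ K] :
    algRk ℂ (Set.univ : Set (MvPolynomial τ K)) ≤
      Fintype.card τ + algRk ℂ (Set.univ : Set K) := by
  have h1 : (Set.univ : Set (MvPolynomial τ K)) ⊆
      (AlgebraicIndependent.matroid ℂ (MvPolynomial τ K)).closure
        (Set.range MvPolynomial.X ∪ MvPolynomial.C '' Set.univ) := by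
    intro P hP
    refine adjoin_subset_algClosure _ ?_
    clear hP
    induction P using MvPolynomial.induction_on with
    | C x => exact Algebra.subset_adjoin (Or.inr ⟨x, trivial, rfl⟩)
    | add P Q hP hQ => exact add_mem hP hQ
    | mul_X P i hP => exact mul_mem hP (Algebra.subset_adjoin (Or.inl ⟨i, rfl⟩))
  refine (algRk_le_of_subset_closure h1).trans ((Matroid.eRk_union_le_eRk_add_eRk _ _ _).trans
    (add_le_add ?_ ?_))
  · refine (Matroid.eRk_le_encard _ _).trans ?_
    rw [← Set.image_univ]
    refine (Set.encard_image_le _ _).trans ?_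
    simp [Set.encard_univ]
  · exact algRk_image_le (IsScalarTower.toAlgHom ℂ K (MvPolynomial τ K))
      (MvPolynomial.C_injective τ K)

end FreeIdx

/-! ### The ideal and the dimension of the consistency variety. -/

section Consistency

variable {X : Scheme.{0}} [X.Over (Spec (.of ℂ))] {k : ℕ} {L : Fin k → X.Modules}
  {E : ∀ i, Submodule ℂ Γ(L i, ⊤)} {ι : Fin k → Type} [∀ j, Fintype (ι j)]
  [∀ j, DecidableEq (ι j)] {b : ∀ j, Module.Basis (ι j) ℂ (E j)}

lemma mem_snd_image_incidence {s : ∀ j, E j} :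
    s ∈ Prod.snd '' incidence E ↔ (zeroSet E s).Nonempty := by
  constructor
  · rintro ⟨⟨y, s⟩, h, rfl⟩; exact ⟨y, h⟩
  · rintro ⟨y, h⟩; exact ⟨⟨y, s⟩, h, rfl⟩

namespace PivotChart

variable (p : PivotChart b) [LocallyOfFiniteType (X ↘ Spec (.of ℂ))]
  [AlgebraicGeometry.IsIntegral X]

lemma mem_consistencyVariety_iff (hL : ∀ j, IsLineBundle (L j)) (hE : ∀ j, BasePointFree (E j))
    {s : ∀ j, E j} : s ∈ consistencyVariety E ↔
      ∀ P, p.genHom P = 0 → MvPolynomial.eval ((piBasis b).repr s) P = 0 := by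
  rw [consistencyVariety, mem_closure_zariski_iff]
  simp only [mem_snd_image_incidence]
  constructor
  · intro h P hP
    have := h (polyFunEquiv (piBasis b) P) fun s' hs' => by
      rw [polyFunEquiv_apply]; exact p.eval_eq_zero_of_mem_ker hL hE hP hs'
    rwa [polyFunEquiv_apply] at this
  · intro h f hf
    obtain ⟨P, rfl⟩ := (polyFunEquiv (piBasis b)).surjective f
    rw [polyFunEquiv_apply]
    refine h P (p.genHom_eq_zero_of_forall fun s' hs' => ?_)
    rw [← polyFunEquiv_apply]
    exact hf s' hs'

lemma zeroSet_subset_consistencyVariety {s : ∀ j, E j} (h : (zeroSet E s).Nonempty) :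
    s ∈ consistencyVariety E :=
  mem_closure_zariski_iff.2 fun _ hf => hf s (mem_snd_image_incidence.2 h)

/-- The rank of the coordinates of the generic point of the consistency variety. -/
def genRk : ℕ∞ := algRk ℂ (Set.range (genPt p.a p.gen))

lemma genRk_eq : p.genRk = algRk ℂ (Set.range fun q => p.genHom (MvPolynomial.X q)) := by
  have h : Set.range (genPt p.a p.gen) =
      p.totGen '' Set.range fun q => p.genHom (MvPolynomial.X q) := by
    rw [← Set.range_comp]
    refine congrArg Set.range (funext fun q => ?_)
    rw [Function.comp_apply, genHom_X, totGen_genPt]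
  rw [genRk, h]
  exact algRk_image_eq _ p.totGen p.totGen_injective

lemma krullDimOf_consistencyVariety (hL : ∀ j, IsLineBundle (L j))
    (hE : ∀ j, BasePointFree (E j)) :
    krullDimOf (zariski (∀ j, E j)) (consistencyVariety E) = (p.genRk : WithBot ℕ∞) := by
  obtain ⟨d, hd, htr⟩ := algRk_range_eq_trdeg p.genHom
  rw [← genRk_eq] at hd
  let Θ : polyFun (∀ j, E j) →ₐ[ℂ] p.Tot :=
    p.genHom.comp (polyFunEquiv (piBasis b)).symm.toAlgHom
  have hΘ : ∀ P, Θ (polyFunEquiv (piBasis b) P) = p.genHom P := fun P => by simp [Θ]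
  have hr : Θ.range = p.genHom.range := by
    apply le_antisymm
    · rintro _ ⟨f, rfl⟩; exact ⟨_, rfl⟩
    · rintro _ ⟨P, rfl⟩; exact ⟨_, hΘ P⟩
  have htr' : Algebra.trdeg ℂ Θ.range = d := by rw [hr]; exact htr
  have hft : Algebra.FiniteType ℂ Θ.range :=
    .of_surjective (Θ.rangeRestrict.comp (polyFunEquiv (piBasis b)).toAlgHom)
      (Θ.rangeRestrict_surjective.comp (polyFunEquiv (piBasis b)).surjective)
  have hft' : Algebra.FiniteType ℂ (⊤ : Subalgebra ℂ p.Tot) :=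
    .of_surjective (Subalgebra.topEquiv.symm.toAlgHom : p.Tot →ₐ[ℂ] _)
      Subalgebra.topEquiv.symm.surjective
  have h0 : ∀ f, Θ f = 0 → ∀ t : consistencyVariety E, f.1 t.1 = 0 := fun f hf t => by
    obtain ⟨P, rfl⟩ := (polyFunEquiv (piBasis b)).surjective f
    rw [hΘ] at hf
    rw [polyFunEquiv_apply]
    exact (p.mem_consistencyVariety_iff hL hE).1 t.2 P hf
  rw [hd]
  refine le_antisymm ?_ ?_
  · refine (topologicalKrullDim_le_range (tT := (zariski (∀ j, E j)).induced Subtype.val) rfl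
      h0).trans ?_
    exact ringKrullDim_le_of_trdeg htr'
  -- The complex points of `Tot` give systems with a zero, which belong to the consistency variety
  -- before taking the closure.
  · refine trdeg_le_topologicalKrullDim (tT := (zariski (∀ j, E j)).induced Subtype.val) rfl
      h0 ⊤ le_top ?_ htr'
    intro φ
    obtain ⟨s, hs, hne⟩ := p.exists_mem_zeroSet_of_algHom
      (φ.comp (Subalgebra.topEquiv.symm.toAlgHom : p.Tot →ₐ[ℂ] _))
    refine ⟨⟨s, zeroSet_subset_consistencyVariety hne⟩, fun f => ?_⟩
    obtain ⟨P, rfl⟩ := (polyFunEquiv (piBasis b)).surjective f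
    rw [polyFunEquiv_apply]
    refine (p.eval_repr_eq _ hs P).trans ?_
    simp only [hΘ]
    rfl

lemma hasCodim_iff (hL : ∀ j, IsLineBundle (L j)) (hE : ∀ j, BasePointFree (E j)) :
    HasCodim (consistencyVariety E) 1 ↔ p.genRk + 1 = Fintype.card (Σ j, ι j) := by
  rw [HasCodim, p.krullDimOf_consistencyVariety hL hE, krullDimOf_univ (piBasis b)]
  norm_cast

end PivotChart

end Consistency

end LinearSeries
end

noncomputable section

set_option linter.unusedSectionVars false

namespace LinearSeries

/-! ### Resultants -/

section Resultant

variable {X : Scheme.{0}} [X.Over (Spec (.of ℂ))] {k : ℕ} {L : Fin k → X.Modules}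
  {E : ∀ i, Submodule ℂ Γ(L i, ⊤)} {ι : Fin k → Type} [∀ j, Fintype (ι j)]
  [∀ j, DecidableEq (ι j)] {b : ∀ j, Module.Basis (ι j) ℂ (E j)}

namespace PivotChart

variable (p : PivotChart b) [LocallyOfFiniteType (X ↘ Spec (.of ℂ))]
  [AlgebraicGeometry.IsIntegral X]

lemma algRk_resField_le (p : PivotChart b) {n : ℕ} (hn : topologicalKrullDim X ≤ n)
    (S : Set (resField (genericPoint X))) : algRk ℂ S ≤ n :=
  (algRk_le_of_forall_div (resAlg (genericPoint X) p.genericPoint_mem)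
    (exists_resAlg_div p.isAffineOpen _ _)
    ((ringKrullDim_sections_le p.isAffineOpen).trans hn) S).1

/-- Otherwise the ideal of the systems vanishing at `ζ` is contained in the kernel of `genHom`, so
these systems form a family of dimension at least `genRk = N - 1`, where `N` is the number of
coordinates. But `ζ` is not generic, its values have rank at most `n - 1`, and parameter counting
with `n + 1` equations bounds the dimension by `N - 2`. -/
lemma exists_polynomial_of_not_mem (hL : ∀ j, IsLineBundle (L j))
    (hE : ∀ j, BasePointFree (E j)) {n : ℕ} (hn : topologicalKrullDim X ≤ n) (hk : k = n + 1)
    (hcodim : p.genRk + 1 = Fintype.card (Σ j, ι j)) {ζ : X} (hζ : ζ ∉ p.U) :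
    ∃ Q : MvPolynomial (Σ j, ι j) ℂ, p.genHom Q ≠ 0 ∧ ∀ s : ∀ j, E j,
      (∃ y ∈ zeroSet E s, ζ ⤳ y) → MvPolynomial.eval ((piBasis b).repr s) Q = 0 := by
  obtain ⟨c, hc, -⟩ := exists_chart hL ζ ⊤ trivial
  have hdom : IsDomain Γ(X, c.U) := isDomain_sections hc
  have hft : Algebra.FiniteType ℂ Γ(X, c.U) := finiteType_sections c.isAffineOpen
  by_contra! hne
  have hle : c.pointIdeal b ζ hc ≤ RingHom.ker p.genHom := by
    intro P hP
    by_contra h0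
    obtain ⟨s, ⟨y, hy, hζy⟩, hs⟩ := hne P h0
    exact hs (c.eval_eq_zero_of_mem_pointIdeal b hL hE hc hζy hy hP)
  choose a ha using c.exists_basisCoord_ne_zero b hE ζ hc
  let φ : ∀ j, ι j → resField ζ := fun j β =>
    (resAlg ζ hc (c.basisCoord b j (a j)))⁻¹ * resAlg ζ hc (c.basisCoord b j β)
  have hφ : ∀ j, φ j (a j) = 1 := fun j => inv_mul_cancel₀ (ha j)
  have hker : c.pointIdeal b ζ hc = RingHom.ker (MvPolynomial.aeval (R := ℂ) (genPt a φ)) := by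
    rw [← incIdeal_eq_ker a φ hφ]
    exact (incIdeal_scale _ _ fun j => inv_ne_zero (ha j)).symm
  rw [hker] at hle
  have h1 := algRk_range_le_of_ker_le p.genHom _ hle
  simp only [MvPolynomial.aeval_X] at h1
  rw [← genRk_eq] at h1
  have h2 := algRk_range_genPt_add_card_le a φ Finset.univ
  have h3 := (algRk_le_of_forall_div (resAlg ζ hc) (exists_resAlg_div c.isAffineOpen _ _)
    ((ringKrullDim_sections_le c.isAffineOpen).trans hn) (valSet φ Finset.univ)).2 (fun h => by
      rw [eq_genericPoint_of_ker_resAlg c.isAffineOpen hc h] at hζ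
      exact hζ p.genericPoint_mem)
  rw [Finset.card_univ, Fintype.card_fin] at h2
  have h4 : algRk ℂ (valSet φ Finset.univ) ≠ ⊤ := fun h => by
    rw [h, top_add] at h3; exact absurd h3 (by simp)
  have h5 : algRk ℂ (Set.range (genPt a φ)) ≠ ⊤ := fun h => by
    rw [h, top_add] at h2
    exact (ENat.add_lt_top.2 ⟨ENat.natCast_lt_top _, h4.lt_top⟩).ne (top_le_iff.1 h2)
  obtain ⟨r, hr⟩ := ENat.ne_top_iff_exists.1 h4
  obtain ⟨t, ht⟩ := ENat.ne_top_iff_exists.1 h5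
  rw [← ht] at h1 h2
  rw [← hr] at h2 h3
  obtain ⟨d, hd⟩ := ENat.ne_top_iff_exists.1 (ne_top_of_le_ne_top (ENat.natCast_ne_top t) h1)
  rw [← hd] at h1 hcodim
  norm_cast at h1 h2 h3 hcodim
  omega

/-- The complement of the chart has finitely many irreducible components. The polynomials attached
to their generic points are multiplied together; the product survives since `Tot` is a domain. -/
lemma exists_polynomial_of_exists_not_mem [QuasiCompact (X ↘ Spec (.of ℂ))]
    (hL : ∀ j, IsLineBundle (L j))
    (hE : ∀ j, BasePointFree (E j)) {n : ℕ} (hn : topologicalKrullDim X ≤ n) (hk : k = n + 1)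
    (hcodim : p.genRk + 1 = Fintype.card (Σ j, ι j)) :
    ∃ Q : MvPolynomial (Σ j, ι j) ℂ, p.genHom Q ≠ 0 ∧ ∀ s : ∀ j, E j,
      (∃ y ∈ zeroSet E s, y ∉ p.U) → MvPolynomial.eval ((piBasis b).repr s) Q = 0 := by
  have := noetherianSpace (X := X)
  obtain ⟨S, hS, hcl, hirr, hun⟩ :=
    NoetherianSpace.exists_finite_set_isClosed_irreducible p.U.2.isClosed_compl
  have h : ∀ Z : S, ∃ Q : MvPolynomial (Σ j, ι j) ℂ, p.genHom Q ≠ 0 ∧ ∀ s : ∀ j, E j,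
      (∃ y ∈ zeroSet E s, y ∈ Z.1) → MvPolynomial.eval ((piBasis b).repr s) Q = 0 := fun Z => by
    have hgen := (hirr Z Z.2).isGenericPoint_genericPoint_closure
    rw [(hcl Z Z.2).closure_eq] at hgen
    have hζ : (hirr Z Z.2).genericPoint ∉ p.U := fun h => by
      have : (hirr Z Z.2).genericPoint ∈ (p.U : Set X)ᶜ := hun ▸ ⟨Z, Z.2, hgen.mem⟩
      exact this h
    obtain ⟨Q, hQ, hQs⟩ := p.exists_polynomial_of_not_mem hL hE hn hk hcodim hζ
    exact ⟨Q, hQ, fun s ⟨y, hy, hyZ⟩ => hQs s ⟨y, hy, hgen.specializes hyZ⟩⟩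
  choose Q hQ hQs using h
  have := hS.fintype
  refine ⟨∏ Z, Q Z, ?_, fun s ⟨y, hy, hyU⟩ => ?_⟩
  · rw [map_prod]; exact Finset.prod_ne_zero_iff.2 fun Z _ => hQ Z
  · obtain ⟨Z, hZ, hyZ⟩ : y ∈ ⋃₀ S := hun ▸ hyU
    rw [map_prod]
    exact Finset.prod_eq_zero (Finset.mem_univ ⟨Z, hZ⟩) (hQs ⟨Z, hZ⟩ s ⟨y, hy, hyZ⟩)

/-- An extension `φ` of `ψ` amounts to a closed point of the chart at which `s` vanishes: its free
coordinates are prescribed by `s`, and a complex point is determined by its kernel. -/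
lemma encard_zeroSet (ψ : p.genHom.range →ₐ[ℂ] ℂ) {s : ∀ j, E j}
    (hψ : ∀ q, ψ (p.genHom.rangeRestrict (MvPolynomial.X q)) = (piBasis b).repr s q)
    (hs : zeroSet E s ⊆ p.U) :
    (zeroSet E s).encard =
      {φ : p.Tot →ₐ[ℂ] ℂ | ∀ x, φ (algebraMap p.genHom.range p.Tot x) = ψ x}.encard := by
  have key : ∀ φ : p.Tot →ₐ[ℂ] ℂ, (∀ x, φ (algebraMap p.genHom.range p.Tot x) = ψ x) ↔
      ∀ q, (piBasis b).repr s q = φ (genPt p.a p.quot q) := fun φ => by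
    constructor
    · intro h q
      rw [← hψ, ← h, ← genHom_X]; rfl
    · rintro h ⟨_, P, rfl⟩
      have : (φ.comp p.genHom) = ψ.comp p.genHom.rangeRestrict := by
        ext q
        rw [AlgHom.comp_apply, genHom_X, ← h, ← hψ]; rfl
      exact congrArg (fun g => g P) this
  have hpt := fun φ : p.Tot →ₐ[ℂ] ℂ => exists_mem_closedPoints_of_algHom p.isAffineOpen
    (φ.comp (IsScalarTower.toAlgHom ℂ Γ(X, p.U) p.Tot))
  choose y hy hyc hyφ using hpt
  suffices hbij : Set.BijOn y {φ | ∀ x, φ (algebraMap p.genHom.range p.Tot x) = ψ x}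
      (zeroSet E s) by
    rw [← hbij.image_eq, hbij.injOn.encard_image]
  refine ⟨fun φ hφ => ?_, fun φ hφ φ' hφ' heq => ?_, fun z hz => ?_⟩
  · exact p.mem_zeroSet_of_algHom φ ((key φ).1 hφ) (hy φ) (hyc φ) (hyφ φ)
  · have h1 : φ.comp (IsScalarTower.toAlgHom ℂ Γ(X, p.U) p.Tot) =
        φ'.comp (IsScalarTower.toAlgHom ℂ Γ(X, p.U) p.Tot) := by
      refine algHom_eq_of_ker_eq fun g hg => ?_
      rw [hyφ] at hg ⊢
      have : ∀ {z : X} (hz : z ∈ p.U), y φ = z → resAlg z hz g = 0 := by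
        rintro _ hz rfl; exact hg
      exact this _ heq
    have h2 : ∀ P, φ P = φ' P := by
      intro P
      induction P using MvPolynomial.induction_on with
      | C g => exact congrArg (fun f => f g) h1
      | add P Q hP hQ => rw [map_add, map_add, hP, hQ]
      | mul_X P q hP =>
        have h3 := ((key φ).1 hφ q.1).symm.trans ((key φ').1 hφ' q.1)
        have h4 : genPt p.a p.quot q.1 = MvPolynomial.X q := by simp [genPt, q.2]
        rw [h4] at h3
        rw [map_mul, map_mul, hP, h3]
    exact AlgHom.ext h2
  · obtain ⟨φ, hφ, hφz⟩ := p.exists_algHom_of_mem_zeroSet (hs hz) hz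
    refine ⟨φ, (key φ).2 fun q => (hφ q).symm, ?_⟩
    refine eq_of_ker_resAlg p.isAffineOpen (hy φ) (hs hz) ?_
    ext g
    rw [RingHom.mem_ker, RingHom.mem_ker, ← hyφ, ← hφz]
    rfl

/-- The ring `Tot` has rank at most `|FreeIdx| + n`. As `|FreeIdx| + n + 1` is the number of
coordinates, this equals `genRk`, so the coordinates of the generic point span everything
algebraically. -/
lemma isAlgebraic_tot {n : ℕ} (hn : topologicalKrullDim X ≤ n) (hk : k = n + 1)
    (hcodim : p.genRk + 1 = Fintype.card (Σ j, ι j)) :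
    Algebra.IsAlgebraic p.genHom.range p.Tot := by
  have h1 : Set.range (genPt p.a p.gen) =
      p.totGen '' Set.range (genPt p.a p.quot) := by
    rw [← Set.range_comp]
    exact congrArg Set.range (funext fun q => (p.totGen_genPt q).symm)
  have h2 : algRk ℂ (Set.univ : Set (MvPolynomial (FreeIdx p.a) (resField (genericPoint X)))) ≤
      p.genRk := by
    refine algRk_univ_mvPolynomial_le.trans ?_
    have h3 := p.algRk_resField_le hn Set.univ
    have h4 := card_freeIdx_add p.a
    rw [Fintype.card_fin] at h4
    have hk' : (k : ℕ∞) = n + 1 := by rw [hk]; push_cast; rfl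
    rw [← h4, Nat.cast_add, hk', ← add_assoc] at hcodim
    have h5 := ENat.add_left_injective_of_ne_top ENat.one_ne_top hcodim
    rw [h5]
    exact add_le_add le_rfl h3
  have hfin : (AlgebraicIndependent.matroid ℂ (MvPolynomial (FreeIdx p.a)
      (resField (genericPoint X)))).IsRkFinite (Set.range (genPt p.a p.gen)) :=
    Matroid.isRkFinite_of_finite _ (Set.finite_range _)
  have h3 := hfin.closure_eq_closure_of_subset_of_eRk_ge_eRk (Set.subset_univ _) h2
  have hr : p.genHom.range = Algebra.adjoin ℂ (Set.range (genPt p.a p.quot)) := by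
    rw [Algebra.adjoin_range_eq_range_aeval]; rfl
  rw [hr]
  refine ⟨fun x => ?_⟩
  rw [← mem_algClosure_iff]
  refine mem_algClosure_of_map p.totGen p.totGen_injective ?_
  rw [← h1, h3]
  exact subset_algClosure _ trivial

lemma exists_isResultant [QuasiCompact (X ↘ Spec (.of ℂ))]
    (hL : ∀ j, IsLineBundle (L j))
    (hE : ∀ j, BasePointFree (E j)) {n : ℕ} (hn : topologicalKrullDim X ≤ n) (hk : k = n + 1)
    (hcodim : p.genRk + 1 = Fintype.card (Σ j, ι j)) : ∃ P, IsResultant E P := by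
  have halg := p.isAlgebraic_tot hn hk hcodim
  have hft : Algebra.FiniteType ℂ p.genHom.range :=
    .of_surjective p.genHom.rangeRestrict p.genHom.rangeRestrict_surjective
  have hfs : FaithfulSMul p.genHom.range p.Tot :=
    (faithfulSMul_iff_algebraMap_injective _ _).2 Subtype.val_injective
  obtain ⟨⟨_, P₀, rfl⟩, ha, m, hm⟩ := exists_encard_extensions_eq p.genHom.range p.Tot
  have hP₀ : p.genHom P₀ ≠ 0 := fun h => ha (Subtype.ext h)
  obtain ⟨Q, hQ, hQs⟩ := p.exists_polynomial_of_exists_not_mem hL hE hn hk hcodim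
  rw [genRk_eq] at hcodim
  obtain ⟨f, hf, hker⟩ := exists_ker_eq_span p.genHom hcodim
  let e := polyFunEquiv (piBasis b)
  refine ⟨(1 : ℂ) • e f ^ m, e f, m, 1, ?_, ?_, ?_, one_ne_zero, rfl⟩
  · exact (MulEquiv.irreducible_iff e.toMulEquiv).2 hf
  · ext s
    rw [p.mem_consistencyVariety_iff hL hE, Set.mem_ofPred_eq, polyFunEquiv_apply]
    constructor
    · intro h
      refine h f ?_
      rw [← RingHom.mem_ker, hker]
      exact Ideal.mem_span_singleton_self f
    · intro h P hP
      rw [← RingHom.mem_ker, hker] at hP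
      obtain ⟨P, rfl⟩ := Ideal.mem_span_singleton.1 hP
      rw [map_mul, h, zero_mul]
  -- Where `P₀` is nonzero the fibre over the chart has `m` points, and where `Q` is nonzero there
  -- are no zeros outside the chart. The open set meets the consistency variety because `genHom`
  -- does not kill `P₀ * Q`.
  · refine ⟨_, isOpen_zariski_ne (e (P₀ * Q)), ?_, ?_⟩
    · by_contra hne
      refine mul_ne_zero hP₀ hQ ?_
      rw [← map_mul]
      refine p.genHom_eq_zero_of_forall fun s hs => ?_
      by_contra h
      refine hne ⟨s, ?_, zeroSet_subset_consistencyVariety hs⟩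
      rw [Set.mem_ofPred_eq, polyFunEquiv_apply]
      exact h
    · rintro s ⟨hs, hsR⟩
      rw [Set.mem_ofPred_eq, polyFunEquiv_apply, map_mul] at hs
      have hs' := (p.mem_consistencyVariety_iff hL hE).1 hsR
      let ψ : p.genHom.range →ₐ[ℂ] ℂ := p.genHom.rangeRestrict.liftOfSurjective
        p.genHom.rangeRestrict_surjective (MvPolynomial.aeval ((piBasis b).repr s))
        fun P hP => hs' P (congrArg Subtype.val hP)
      have hψ : ∀ P, ψ (p.genHom.rangeRestrict P) = MvPolynomial.eval ((piBasis b).repr s) P :=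
        fun P => AlgHom.liftOfSurjective_apply _ _ _ _ P
      rw [p.encard_zeroSet ψ (fun q => (hψ _).trans (MvPolynomial.eval_X _)) ?_]
      · refine hm ψ ?_
        rw [show (⟨_, P₀, rfl⟩ : p.genHom.range) = p.genHom.rangeRestrict P₀ from rfl, hψ]
        exact left_ne_zero_of_mul hs
      · intro y hy
        by_contra hyU
        exact right_ne_zero_of_mul hs (hQs s ⟨y, hy, hyU⟩)

lemma apply_eq_of_isResultant (hcodim : p.genRk + 1 = Fintype.card (Σ j, ι j)) {J : Finset (Fin k)}
    (hJ : algRk ℂ (valSet p.gen J) < J.card) {P : polyFun (∀ j, E j)} (hP : IsResultant E P)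
    {s s' : ∀ j, E j} (h : ∀ j ∈ J, s j = s' j) : P.1 s = P.1 s' := by
  obtain ⟨f, m, c, hf, hR, -, -, rfl⟩ := hP
  obtain ⟨F, rfl⟩ := (polyFunEquiv (piBasis b)).surjective f
  have hF : Irreducible F := (MulEquiv.irreducible_iff (polyFunEquiv (piBasis b)).toMulEquiv).1 hf
  rw [genRk_eq] at hcodim
  obtain ⟨f, hfi, hker⟩ := exists_ker_eq_span p.genHom hcodim
  -- The equation of the hypersurface is unique up to a scalar: `F` vanishes on the consistency
  -- variety, so it lies in the kernel `(f)`, and both are irreducible.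
  have hfF : f ∣ F := by
    rw [← Ideal.mem_span_singleton, ← hker, RingHom.mem_ker]
    refine p.genHom_eq_zero_of_forall fun s hs => ?_
    have h1 : s ∈ consistencyVariety E := zeroSet_subset_consistencyVariety hs
    rw [hR, Set.mem_ofPred_eq, polyFunEquiv_apply] at h1
    exact h1
  have hFf : F ∣ f := ((hfi.dvd_irreducible_iff_associated hF).1 hfF).symm.dvd
  have h1 := algRk_genPt_add_card_le p.a p.gen J
  -- Since the values over `J` have rank below `|J|`, the coordinates over `J` have rank less than
  -- their number and satisfy a nontrivial relation.
  obtain ⟨g, hg0, hg⟩ := exists_aeval_eq_zero_of_algRk_lt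
    (fun q : {q : Σ j, ι j // q.1 ∈ J} => genPt p.a p.gen q.1) (by
      have h2 : (Set.range fun q : {q : Σ j, ι j // q.1 ∈ J} => genPt p.a p.gen q.1) =
          genPt p.a p.gen '' {q | q.1 ∈ J} := by
        ext; simp
      rw [h2]
      by_contra! h3
      have h4 := (add_le_add h3 (le_refl (J.card : ℕ∞))).trans h1
      have h5 := WithTop.le_of_add_le_add_left (ENat.natCast_ne_top _) h4
      exact absurd hJ (not_lt.2 h5))
  let G : MvPolynomial (Σ j, ι j) ℂ := MvPolynomial.rename Subtype.val g
  have hG0 : G ≠ 0 := (map_ne_zero_iff _ (MvPolynomial.rename_injective _ Subtype.val_injective)).2 hg0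
  have hG : f ∣ G := by
    rw [← Ideal.mem_span_singleton, ← hker, RingHom.mem_ker]
    apply p.totGen_injective
    rw [map_zero, ← AlgHom.comp_apply, totGen_comp_genHom, MvPolynomial.aeval_rename]
    exact hg
  have hGs : G ∈ MvPolynomial.supported ℂ {q : Σ j, ι j | q.1 ∈ J} := by
    rw [MvPolynomial.supported_eq_range_rename]
    exact ⟨g, rfl⟩
  have hFs := mem_supported_of_dvd hGs hG0 (hFf.trans hG)
  have h2 := eval_eq_of_mem_supported hFs (s := (piBasis b).repr s) (s' := (piBasis b).repr s')
    (fun ⟨j, β⟩ hj => by rw [piBasis_repr, piBasis_repr, h j hj])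
  rw [← polyFunEquiv_apply, ← polyFunEquiv_apply] at h2
  change c * (polyFunEquiv (piBasis b) F).1 s ^ m = c * (polyFunEquiv (piBasis b) F).1 s' ^ m
  rw [h2]

end PivotChart

end Resultant

end LinearSeries
end

noncomputable section

set_option linter.unusedSectionVars false

namespace LinearSeries

/-! ### Affine charts of projective spaces -/

section Projective

variable {V : Type*} [AddCommGroup V] [Module ℂ V]

/-- Clearing powers of `l` replaces a function of the normalized vector by a polynomial function of
any representative. -/
lemma exists_homogenization (l : Module.Dual ℂ V) (f : polyFun V) :
    ∃ (d : ℕ) (F : polyFun V), ∀ v, l v ≠ 0 → F.1 v = l v ^ d * f.1 ((l v)⁻¹ • v) := by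
  obtain ⟨f, hf⟩ := f
  induction hf using Algebra.adjoin_induction with
  | mem x hx =>
    obtain ⟨m, rfl⟩ := hx
    refine ⟨1, linFun m, fun v hv => ?_⟩
    simp [linFun, hv]
  | algebraMap r => exact ⟨0, algebraMap ℂ _ r, fun v _ => by simp⟩
  | add x y hx hy h1 h2 =>
    obtain ⟨d, F, hF⟩ := h1
    obtain ⟨d', F', hF'⟩ := h2
    refine ⟨d + d', linFun l ^ d' * F + linFun l ^ d * F', fun v hv => ?_⟩
    change l v ^ d' * F.1 v + l v ^ d * F'.1 v =
      l v ^ (d + d') * (x ((l v)⁻¹ • v) + y ((l v)⁻¹ • v))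
    rw [hF v hv, hF' v hv]
    ring
  | mul x y hx hy h1 h2 =>
    obtain ⟨d, F, hF⟩ := h1
    obtain ⟨d', F', hF'⟩ := h2
    refine ⟨d + d', F * F', fun v hv => ?_⟩
    change F.1 v * F'.1 v = l v ^ (d + d') * (x ((l v)⁻¹ • v) * y ((l v)⁻¹ • v))
    rw [hF v hv, hF' v hv]
    ring

lemma apply_rep_ne_zero_iff (l : Module.Dual ℂ V) {v : V} (hv : v ≠ 0) :
    l (Projectivization.mk ℂ v hv).rep ≠ 0 ↔ l v ≠ 0 := by
  obtain ⟨a, ha⟩ := Projectivization.exists_smul_eq_mk_rep ℂ v hv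
  rw [← ha, Units.smul_def, map_smul, smul_eq_mul]
  simp

lemma inv_smul_rep (l : Module.Dual ℂ V) {v : V} (hv : v ≠ 0) :
    (l (Projectivization.mk ℂ v hv).rep)⁻¹ • (Projectivization.mk ℂ v hv).rep =
      (l v)⁻¹ • v := by
  obtain ⟨a, ha⟩ := Projectivization.exists_smul_eq_mk_rep ℂ v hv
  rw [← ha, Units.smul_def, map_smul, smul_eq_mul, mul_inv, smul_smul, mul_assoc, mul_comm,
    mul_assoc, mul_inv_cancel₀ a.ne_zero, mul_one]

lemma isOpen_projZariski_rep (l : Module.Dual ℂ V) :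
    IsOpen[projZariski V] {p | l p.rep ≠ 0} := by
  rw [isOpen_coinduced]
  refine ⟨_, isOpen_zariski_ne (linFun l), ?_⟩
  ext ⟨v, hv⟩
  exact (apply_rep_ne_zero_iff l hv).symm

/-- On the locus `l ≠ 0` a line is replaced by its vector with `l = 1`. Homogenization shows that
affine open sets are projectively open; conversely, an open cone is tested on the normalized
vectors. -/
lemma induced_projZariski {T : Type*} (τ : T → ℙ ℂ V) (l : Module.Dual ℂ V)
    (h : ∀ t, l (τ t).rep ≠ 0) : (projZariski V).induced τ =
      (zariski V).induced fun t => (l (τ t).rep)⁻¹ • (τ t).rep := by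
  apply le_antisymm
  · rw [zariski, induced_generateFrom_eq, le_generateFrom_iff_subset_isOpen]
    rintro _ ⟨_, ⟨f, hf, rfl⟩, rfl⟩
    obtain ⟨d, F, hF⟩ := exists_homogenization l ⟨f, hf⟩
    refine ⟨{p | l p.rep ≠ 0 ∧ f ((l p.rep)⁻¹ • p.rep) ≠ 0}, ?_, ?_⟩
    · rw [isOpen_coinduced]
      refine ⟨_, isOpen_zariski_ne (linFun l * F), ?_⟩
      ext ⟨v, hv⟩
      have h1 : (linFun l * F).1 v = l v * F.1 v := rfl
      simp only [Set.mem_preimage, Set.mem_ofPred_eq, h1]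
      change _ ↔ l (Projectivization.mk ℂ v hv).rep ≠ 0 ∧
        f ((l (Projectivization.mk ℂ v hv).rep)⁻¹ • (Projectivization.mk ℂ v hv).rep) ≠ 0
      rw [inv_smul_rep, apply_rep_ne_zero_iff, mul_ne_zero_iff]
      refine and_congr_right fun hv => ?_
      rw [hF v hv]
      simp [hv]
    · ext t
      simp [h t]
  · rintro _ ⟨O, hO, rfl⟩
    rw [isOpen_coinduced] at hO
    obtain ⟨W, hW, hWO⟩ := hO
    refine ⟨W, hW, ?_⟩
    ext t
    have h0 : (l (τ t).rep)⁻¹ • (τ t).rep ≠ 0 :=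
      smul_ne_zero (inv_ne_zero (h t)) (τ t).rep_nonzero
    have h1 : Projectivization.mk' ℂ ⟨_, h0⟩ = τ t := by
      conv_rhs => rw [← (τ t).mk_rep]
      rw [Projectivization.mk'_eq_mk, Projectivization.mk_eq_mk_iff']
      exact ⟨_, rfl⟩
    have h2 := Set.ext_iff.1 hWO ⟨_, h0⟩
    rw [Set.mem_preimage, Set.mem_preimage, h1] at h2
    exact h2

end Projective

/-! ### Specialization of relations between quotients. -/

section Ratio

variable {A K : Type*} [CommRing A] [IsDomain A] [Algebra ℂ A] [Field K] [Algebra ℂ K]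

/-- The quotients live in the localization of `A` at `g₀`, which embeds in `K` and on which `χ` is
defined. So a relation in `K` already holds there and can be specialized. -/
lemma aeval_div_eq_zero (π : A →ₐ[ℂ] K) (hπ : Function.Injective π) (χ : A →ₐ[ℂ] ℂ) {κ : Type*}
    (g : κ → A) {g₀ : A} (h₀ : χ g₀ ≠ 0) {P : MvPolynomial κ ℂ}
    (hP : MvPolynomial.aeval (fun i => π (g i) / π g₀) P = 0) :
    MvPolynomial.eval (fun i => χ (g i) / χ g₀) P = 0 := by
  have hg₀ : π g₀ ≠ 0 := fun h => h₀ (by rw [(map_eq_zero_iff π hπ).1 h, map_zero])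
  have hu : ∀ y : Submonoid.powers g₀, IsUnit (π y) := by
    rintro ⟨_, m, rfl⟩
    rw [map_pow]
    exact (pow_ne_zero _ hg₀).isUnit
  have hu' : ∀ y : Submonoid.powers g₀, IsUnit (χ y) := by
    rintro ⟨_, m, rfl⟩
    rw [map_pow]
    exact (pow_ne_zero _ h₀).isUnit
  let π' : Localization.Away g₀ →ₐ[ℂ] K := IsLocalization.liftAlgHom hu
  let χ' : Localization.Away g₀ →ₐ[ℂ] ℂ := IsLocalization.liftAlgHom hu'
  have hπ' : ∀ a, π' (algebraMap A _ a) = π a := fun a => IsLocalization.lift_eq _ _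
  have hχ' : ∀ a, χ' (algebraMap A _ a) = χ a := fun a => IsLocalization.lift_eq _ _
  let z : κ → Localization.Away g₀ := fun i => IsLocalization.mk' _ (g i)
    (⟨g₀, 1, pow_one _⟩ : Submonoid.powers g₀)
  have hz : ∀ i, z i * algebraMap A _ g₀ = algebraMap A _ (g i) := fun i =>
    IsLocalization.mk'_spec _ _ _
  have hz1 : ∀ i, π' (z i) = π (g i) / π g₀ := fun i => by
    rw [eq_div_iff hg₀, ← hπ', ← map_mul, hz, hπ']
  have hz2 : ∀ i, χ' (z i) = χ (g i) / χ g₀ := fun i => by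
    rw [eq_div_iff h₀, ← hχ', ← map_mul, hz, hχ']
  have h1 : π' (MvPolynomial.aeval z P) = 0 := by
    rw [MvPolynomial.comp_aeval_apply]
    simpa only [hz1] using hP
  have h2 : MvPolynomial.aeval z P = 0 := by
    obtain ⟨a, m, ham⟩ := IsLocalization.exists_mk'_eq (Submonoid.powers g₀)
      (MvPolynomial.aeval z P)
    have h3 : π' (MvPolynomial.aeval z P) * π' (algebraMap A _ m) = π a := by
      rw [← map_mul, ← ham, IsLocalization.mk'_spec, hπ']
    rw [h1, zero_mul, eq_comm, map_eq_zero_iff π hπ] at h3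
    rw [← ham, h3, IsLocalization.mk'_zero]
  have h3 : χ' (MvPolynomial.aeval z P) = 0 := by rw [h2, map_zero]
  rw [MvPolynomial.comp_aeval_apply] at h3
  simp only [hz2] at h3
  exact h3

end Ratio

/-! ### Products of linear series -/

section Tensor

/-- A tensor product of free modules of rank one is free on the tensor of the generators. -/
lemma bijective_smul_tprod {R ι : Type*} [CommRing R] [Fintype ι] {N : ι → Type*}
    [∀ i, AddCommGroup (N i)] [∀ i, Module R (N i)] (e : ∀ i, N i)
    (he : ∀ i, Function.Bijective fun r : R => r • e i) :
    Function.Bijective fun r : R => r • PiTensorProduct.tprod R e := by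
  classical
  let φ := (PiTensorProduct.constantBaseRingEquiv ι R).symm.toLinearEquiv.trans
    (PiTensorProduct.congr fun i =>
      LinearEquiv.ofBijective (LinearMap.toSpanSingleton R (N i) (e i)) (he i))
  convert φ.bijective using 1
  ext r
  rw [← mul_one r, ← smul_eq_mul, map_smul, smul_eq_mul, mul_one]
  congr 1
  have h1 : (PiTensorProduct.constantBaseRingEquiv ι R).symm 1 = PiTensorProduct.tprod R fun _ => 1 :=
    map_one _
  change _ = PiTensorProduct.congr _ ((PiTensorProduct.constantBaseRingEquiv ι R).symm 1)
  rw [h1, PiTensorProduct.congr_tprod]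
  exact congrArg _ (funext fun i => (one_smul R (e i)).symm)

end Tensor

/-! ### Coordinates of the sections of a product of linear series. -/

section ProdCoord

variable {X : Scheme.{0}} [X.Over (Spec (.of ℂ))] {k : ℕ} {L : Fin k → X.Modules}
  {E : ∀ i, Submodule ℂ Γ(L i, ⊤)} {J : Finset (Fin k)}

namespace Chart

variable (c : Chart L)

/-- The germs of the product of the frames. -/
def prodFrame (J : Finset (Fin k)) (y : X) (hy : y ∈ c.U) : tensorStalk L J y :=
  PiTensorProduct.tprod (X.presheaf.stalk y) fun j : J =>
    (L j).presheaf.germ c.U y hy (c.e j)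

lemma bijective_smul_prodFrame (y : X) (hy : y ∈ c.U) :
    Function.Bijective fun r : X.presheaf.stalk y => r • c.prodFrame J y hy :=
  bijective_smul_tprod _ fun j => (c.isFrame j).bijective y hy

lemma tensorSection_eq (s : ∀ j : J, Γ(L j, ⊤)) (y : X) (hy : y ∈ c.U) :
    tensorSection L J s y =
      germAlg y hy (∏ j : J, c.coord j (s j)) • c.prodFrame J y hy := by
  rw [tensorSection, prodFrame, map_prod, ← MultilinearMap.map_smul_univ]
  congr 1
  ext j
  exact c.germ_eq j (s j) y hy

lemma exists_prodCoord (g : prodSeries E J) :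
    ∃ h : Γ(X, c.U), ∀ y hy, g.1 y = germAlg y hy h • c.prodFrame J y hy := by
  obtain ⟨g, hg⟩ := g
  induction hg using Submodule.span_induction with
  | mem x hx =>
    obtain ⟨s, rfl⟩ := hx
    exact ⟨_, fun y hy => c.tensorSection_eq _ y hy⟩
  | zero => exact ⟨0, fun y hy => by rw [map_zero, zero_smul]; rfl⟩
  | add x y _ _ hx hy =>
    obtain ⟨h, hh⟩ := hx
    obtain ⟨h', hh'⟩ := hy
    refine ⟨h + h', fun z hz => ?_⟩
    rw [map_add, add_smul, ← hh, ← hh']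
    rfl
  | smul a x _ hx =>
    obtain ⟨h, hh⟩ := hx
    refine ⟨a • h, fun z hz => ?_⟩
    rw [map_smul, smul_assoc, ← hh]
    rfl

variable [AlgebraicGeometry.IsIntegral X]

lemma prodCoord_unique {h h' : Γ(X, c.U)} {y : X} (hy : y ∈ c.U)
    (hh : germAlg y hy h • c.prodFrame J y hy = germAlg y hy h' • c.prodFrame J y hy) : h = h' :=
  germ_injective_of_isIntegral X y hy ((c.bijective_smul_prodFrame y hy).1 hh)

/-- The coordinate functions of the sections of the product of linear series. -/
def prodCoord (hη : genericPoint X ∈ c.U) : prodSeries E J →ₗ[ℂ] Γ(X, c.U) where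
  toFun g := (c.exists_prodCoord g).choose
  map_add' g g' := by
    apply c.prodCoord_unique (J := J) hη
    rw [← (c.exists_prodCoord _).choose_spec, map_add, add_smul,
      ← (c.exists_prodCoord _).choose_spec, ← (c.exists_prodCoord _).choose_spec]
    rfl
  map_smul' a g := by
    apply c.prodCoord_unique (J := J) hη
    rw [← (c.exists_prodCoord _).choose_spec, map_smul, smul_assoc,
      ← (c.exists_prodCoord _).choose_spec]
    rfl

variable (hη : genericPoint X ∈ c.U)

lemma apply_eq_smul_prodFrame (g : prodSeries E J) (y : X) (hy : y ∈ c.U) :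
    g.1 y = germAlg y hy (c.prodCoord hη g) • c.prodFrame J y hy :=
  (c.exists_prodCoord g).choose_spec y hy

/-- The product of sections of the linear series. -/
def _root_.LinearSeries.prodSection (s : ∀ j : J, E j) : prodSeries E J :=
  ⟨tensorSection L J fun j => (s j : Γ(L j, ⊤)), Submodule.subset_span ⟨s, rfl⟩⟩

lemma prodCoord_prodSection (s : ∀ j : J, E j) :
    c.prodCoord hη (prodSection s) = ∏ j : J, c.coord j (s j : Γ(L j, ⊤)) := by
  apply c.prodCoord_unique (J := J) hη
  rw [← apply_eq_smul_prodFrame]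
  exact c.tensorSection_eq _ _ hη

lemma vanishes_iff_prodCoord (g : prodSeries E J) (y : X) (hy : y ∈ c.U) :
    Vanishes (X.presheaf.stalk y) (g.1 y) ↔ resAlg y hy (c.prodCoord hη g) = 0 := by
  rw [c.apply_eq_smul_prodFrame hη g y hy, resAlg_eq_zero_iff]
  exact vanishes_smul_iff (c.bijective_smul_prodFrame y hy) _

lemma exists_prodCoord_eq_mul (c' : Chart L) (hη' : genericPoint X ∈ c'.U) :
    ∃ u : resField (genericPoint X), u ≠ 0 ∧ ∀ g : prodSeries E J,
      resAlg _ hη (c.prodCoord hη g) = u * resAlg _ hη' (c'.prodCoord hη' g) := by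
  obtain ⟨u, hu⟩ := (c.bijective_smul_prodFrame (J := J) _ hη).2 (c'.prodFrame J _ hη')
  obtain ⟨v, hv⟩ := (c'.bijective_smul_prodFrame (J := J) _ hη').2 (c.prodFrame J _ hη)
  have hu' : u • c.prodFrame J _ hη = c'.prodFrame J _ hη' := hu
  have hv' : v • c'.prodFrame J _ hη' = c.prodFrame J _ hη := hv
  have huv : u * v = 1 := by
    refine (c'.bijective_smul_prodFrame (J := J) _ hη').1 ?_
    change (u * v) • _ = (1 : X.presheaf.stalk _) • _
    rw [mul_smul, hv', hu', one_smul]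
  refine ⟨IsLocalRing.residue _ u, ((IsUnit.of_mul_eq_one v huv).map _).ne_zero, fun g => ?_⟩
  have h1 : germAlg _ hη (c.prodCoord hη g) = u * germAlg _ hη' (c'.prodCoord hη' g) := by
    refine (c.bijective_smul_prodFrame (J := J) _ hη).1 ?_
    change _ • _ = (u * _) • _
    rw [← apply_eq_smul_prodFrame, mul_comm, mul_smul, hu', ← apply_eq_smul_prodFrame]
  exact (congrArg (IsLocalRing.residue _) h1).trans (map_mul _ _ _)

end Chart

end ProdCoord

section Finite

variable {X : Scheme.{0}} [X.Over (Spec (.of ℂ))] {k : ℕ} {L : Fin k → X.Modules}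
  {E : ∀ i, Submodule ℂ Γ(L i, ⊤)} {J : Finset (Fin k)}
  {ι : Fin k → Type} [∀ j, Fintype (ι j)] [∀ j, DecidableEq (ι j)]
  (b : ∀ j, Module.Basis (ι j) ℂ (E j))

lemma germ_sum_smul {ι : Type*} (t : Finset ι) (L : X.Modules) (x : X) (a : ι → ℂ)
    (s : ι → Γ(L, ⊤)) :
    germ L x (∑ i ∈ t, a i • s i) =
      ∑ i ∈ t, algebraMap ℂ (X.presheaf.stalk x) (a i) • germ L x (s i) := by
  rw [germ, map_sum]
  exact Finset.sum_congr rfl fun i _ => germ_smul L ⊤ x trivial (scalars X (a i)) (s i)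

/-- Multilinearity of the tensor product, checked on germs; it yields the finite spanning set of
`span_prodSection`. -/
lemma prodSection_eq_sum (s : ∀ j : J, E j) : prodSection s =
    ∑ r : ∀ j : J, ι j, (∏ j : J, (b j).repr (s j) (r j)) • prodSection fun j => b j (r j) := by
  apply Subtype.ext
  rw [Submodule.coe_sum]
  funext y
  rw [Finset.sum_apply]
  have h1 : ∀ j : J, germ (L j) y (s j : Γ(L j, ⊤)) = ∑ β : ι j,
      algebraMap ℂ (X.presheaf.stalk y) ((b j).repr (s j) β) •
        germ (L j) y (b j β : Γ(L j, ⊤)) := fun j => by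
    rw [← germ_sum_smul]
    conv_lhs => rw [← (b j).sum_repr (s j)]
    rw [Submodule.coe_sum]
    rfl
  change PiTensorProduct.tprod _ (fun j : J => germ (L j) y (s j : Γ(L j, ⊤))) = _
  simp only [h1]
  rw [MultilinearMap.map_sum]
  refine Finset.sum_congr rfl fun r _ => ?_
  rw [MultilinearMap.map_smul_univ, ← map_prod, algebraMap_smul]
  rfl

lemma span_prodSection : Submodule.span ℂ (Set.range fun r : ∀ j : J, ι j =>
    prodSection (E := E) fun j => b j (r j)) = ⊤ := by
  rw [eq_top_iff]
  rintro ⟨g, hg⟩ -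
  induction hg using Submodule.span_induction with
  | mem x hx =>
    obtain ⟨s, rfl⟩ := hx
    change prodSection s ∈ _
    rw [prodSection_eq_sum b s]
    exact Submodule.sum_mem _ fun r _ => Submodule.smul_mem _ _ (Submodule.subset_span ⟨r, rfl⟩)
  | zero => exact zero_mem _
  | add x y _ _ hx hy => exact add_mem hx hy
  | smul a x _ hx => exact Submodule.smul_mem _ a hx

lemma finiteDimensional_prodSeries [∀ j, FiniteDimensional ℂ (E j)] :
    FiniteDimensional ℂ (prodSeries E J) := by
  rw [FiniteDimensional, Module.finite_def,
    ← span_prodSection (J := J) fun j => Module.finBasis ℂ (E j)]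
  exact Submodule.fg_span (Set.finite_range _)

end Finite

end LinearSeries
end

noncomputable section

set_option linter.unusedSectionVars false

namespace LinearSeries

/-! ### The dimension of the image of the Kodaira map -/

section Kodaira

variable {X : Scheme.{0}} [X.Over (Spec (.of ℂ))] {k : ℕ} {L : Fin k → X.Modules}
  {E : ∀ i, Submodule ℂ Γ(L i, ⊤)} {J : Finset (Fin k)}

/-- The part of the image of the Kodaira map where the coordinate `g` does not vanish. -/
def kodairaOpen (g : prodSeries E J) : Set (kodairaImage E J) := {t | t.1.rep g ≠ 0}

/-- The affine coordinates on the set where `g` does not vanish. -/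
def affineRep (g : prodSeries E J) (t : kodairaOpen g) : Module.Dual ℂ (prodSeries E J) :=
  (t.1.1.rep g)⁻¹ • t.1.1.rep

lemma isOpen_kodairaOpen (g : prodSeries E J) :
    IsOpen[(projZariski _).induced Subtype.val] (kodairaOpen g) :=
  ⟨_, isOpen_projZariski_rep (Module.Dual.eval ℂ (prodSeries E J) g), rfl⟩

lemma induced_kodairaOpen (g : prodSeries E J) :
    ((projZariski (Module.Dual ℂ (prodSeries E J))).induced
      (Subtype.val : kodairaImage E J → _)).induced (Subtype.val : kodairaOpen g → _) =
      (zariski _).induced (affineRep g) := by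
  rw [induced_compose]
  exact induced_projZariski _ (Module.Dual.eval ℂ (prodSeries E J) g) fun t => t.2

variable [AlgebraicGeometry.IsIntegral X] [LocallyOfFiniteType (X ↘ Spec (.of ℂ))]

/-- A value of the Kodaira map is specified only by its hyperplane, but two nonzero linear forms
with the same kernel are proportional, and evaluation at the point in a chart is such a form. -/
lemma exists_of_mem_kodairaImage (hL : ∀ j, IsLineBundle (L j))
    {q : ℙ ℂ (Module.Dual ℂ (prodSeries E J))} (hq : q ∈ kodairaImage E J) :
    ∃ (c : Chart L) (hη : genericPoint X ∈ c.U) (χ : Γ(X, c.U) →ₐ[ℂ] ℂ) (a : ℂ), a ≠ 0 ∧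
      ∀ g, q.rep g = a * χ (c.prodCoord hη g) := by
  obtain ⟨y, hyc, hq⟩ := hq
  obtain ⟨c, hy, -⟩ := exists_chart hL y ⊤ trivial
  obtain ⟨χ, hχ⟩ := exists_algHom_of_mem_closedPoints c.isAffineOpen hy hyc
  have hη := genericPoint_mem hy
  let v : Module.Dual ℂ (prodSeries E J) := χ.toLinearMap ∘ₗ c.prodCoord hη
  have hv : ∀ g, q.rep g = 0 ↔ v g = 0 := fun g => by
    rw [hq g, c.vanishes_iff_prodCoord hη g y hy, ← hχ]
    rfl
  obtain ⟨g₀, hg₀⟩ : ∃ g₀, q.rep g₀ ≠ 0 := by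
    by_contra! h
    exact q.rep_nonzero (LinearMap.ext h)
  have hv₀ : v g₀ ≠ 0 := fun h => hg₀ ((hv g₀).2 h)
  refine ⟨c, hη, χ, q.rep g₀ / v g₀, div_ne_zero hg₀ hv₀, fun g => ?_⟩
  have h1 : v (q.rep g₀ • g - q.rep g • g₀) = 0 := by
    rw [← hv, map_sub, map_smul, map_smul, smul_eq_mul, smul_eq_mul]
    ring
  rw [map_sub, map_smul, map_smul, smul_eq_mul, smul_eq_mul, sub_eq_zero] at h1
  rw [div_mul_eq_mul_div, eq_div_iff hv₀]
  exact h1.symm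

variable {ι : Fin k → Type} [∀ j, Fintype (ι j)] [∀ j, DecidableEq (ι j)]
  {b : ∀ j, Module.Basis (ι j) ℂ (E j)}

namespace PivotChart

variable (p : PivotChart b)

/-- The unit relating `quot` and `basisCoord` for the products. -/
def prodUnit (J : Finset (Fin k)) : Γ(X, p.U)ˣ := ∏ j : J, (p.isUnit j).unit⁻¹

/-- The quotients of the sections of the product of linear series by a section vanishing
nowhere. -/
def prodQuot (J : Finset (Fin k)) : prodSeries E J →ₗ[ℂ] Γ(X, p.U) :=
  LinearMap.mulLeft ℂ (p.prodUnit J : Γ(X, p.U)) ∘ₗ p.prodCoord p.genericPoint_mem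

lemma prodQuot_apply (g : prodSeries E J) :
    p.prodQuot J g = p.prodUnit J * p.prodCoord p.genericPoint_mem g := rfl

lemma prodQuot_prodSection (r : ∀ j : J, ι j) :
    p.prodQuot J (prodSection fun j => b j (r j)) = ∏ j : J, p.quot j (r j) := by
  rw [prodQuot_apply, Chart.prodCoord_prodSection, prodUnit, Units.coe_prod,
    ← Finset.prod_mul_distrib]
  rfl

/-- The generic values of the sections of the product of linear series. -/
def prodGen (J : Finset (Fin k)) : prodSeries E J →ₗ[ℂ] resField (genericPoint X) :=
  (resAlg (genericPoint X) p.genericPoint_mem).toLinearMap ∘ₗ p.prodQuot J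

lemma prodGen_apply (g : prodSeries E J) :
    p.prodGen J g = resAlg (genericPoint X) p.genericPoint_mem (p.prodQuot J g) := rfl

lemma prodGen_prodSection (r : ∀ j : J, ι j) :
    p.prodGen J (prodSection fun j => b j (r j)) = ∏ j : J, p.gen j (r j) := by
  rw [prodGen_apply, prodQuot_prodSection, map_prod]
  rfl

lemma prodGen_mem_adjoin (g : prodSeries E J) :
    p.prodGen J g ∈ Algebra.adjoin ℂ (valSet p.gen J) := by
  have hg : g ∈ Submodule.span ℂ _ := (span_prodSection b).ge (Submodule.mem_top (x := g))
  induction hg using Submodule.span_induction with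
  | mem x hx =>
    obtain ⟨r, rfl⟩ := hx
    dsimp only
    rw [prodGen_prodSection]
    exact prod_mem fun j _ => Algebra.subset_adjoin ⟨j, j.2, r j, rfl⟩
  | zero => rw [map_zero]; exact zero_mem _
  | add x y _ _ hx hy => rw [map_add]; exact add_mem hx hy
  | smul a x _ hx => rw [map_smul]; exact Subalgebra.smul_mem _ hx a

/-- The section vanishing nowhere in the chart. -/
def pivot (J : Finset (Fin k)) : prodSeries E J := prodSection fun j => b j (p.a j)

lemma prodQuot_pivot : p.prodQuot J (p.pivot J) = 1 := by
  rw [pivot, prodQuot_prodSection]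
  exact Finset.prod_eq_one fun j _ => p.quot_a j

/-- Together with `prodGen_mem_adjoin` this shows that `E_J` and its factors generate the same
algebra, so the Kodaira image can be measured on the factors. -/
lemma valSet_subset_range_prodGen : valSet p.gen J ⊆ Set.range (p.prodGen J) := by
  rintro _ ⟨j, hj, β, rfl⟩
  -- The pivot section is taken in every factor except the `j`-th, so all other factors contribute
  -- 1.
  refine ⟨prodSection fun i => b i (Function.update p.a j β i), ?_⟩
  rw [prodGen_prodSection, Finset.prod_eq_single (⟨j, hj⟩ : J)]
  · rw [Function.update_self]
  · intro i _ hi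
    rw [Function.update_of_ne fun h => hi (Subtype.ext h)]
    exact p.gen_a i
  · exact fun h => absurd (Finset.mem_univ _) h

lemma exists_prodCoord_eq_mul_prodGen (c : Chart L) (hη : genericPoint X ∈ c.U) :
    ∃ u : resField (genericPoint X), u ≠ 0 ∧ ∀ g : prodSeries E J,
      resAlg _ hη (c.prodCoord hη g) = u * p.prodGen J g := by
  obtain ⟨u, hu, h⟩ := c.exists_prodCoord_eq_mul (E := E) (J := J) hη p.toChart p.genericPoint_mem
  have hv := ((p.prodUnit J).isUnit.map (resAlg (genericPoint X) p.genericPoint_mem)).ne_zero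
  refine ⟨_, mul_ne_zero hu (inv_ne_zero hv), fun g => ?_⟩
  rw [h, prodGen_apply, prodQuot_apply, map_mul, mul_assoc, inv_mul_cancel_left₀ hv]

variable {κ : Type} [Fintype κ] [DecidableEq κ] (w : Module.Basis κ ℂ (prodSeries E J))

/-- The passage from polynomials in the affine coordinates to the generic point. -/
def affineHom (g : prodSeries E J) : MvPolynomial κ ℂ →ₐ[ℂ] resField (genericPoint X) :=
  MvPolynomial.aeval fun i => p.prodGen J (w i) / p.prodGen J g

/-- The point may lie outside the pivot chart. In a chart around it the sections change by one
common factor `u`, which cancels in the quotients, and the relation specializes. -/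
lemma affineRep_eq_zero (hL : ∀ j, IsLineBundle (L j)) {g : prodSeries E J}
    {P : MvPolynomial κ ℂ} (hP : p.affineHom w g P = 0) (t : kodairaOpen g) :
    MvPolynomial.eval (w.dualBasis.repr (affineRep g t)) P = 0 := by
  obtain ⟨⟨q, hq⟩, hg⟩ := t
  obtain ⟨c, hη, χ, a, ha, hχ⟩ := exists_of_mem_kodairaImage hL hq
  obtain ⟨u, hu, h⟩ := p.exists_prodCoord_eq_mul_prodGen (J := J) c hη
  have hdom : IsDomain Γ(X, c.U) := isDomain_sections hη
  have h0 : χ (c.prodCoord hη g) ≠ 0 := by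
    have : q.rep g ≠ 0 := hg
    rw [hχ] at this
    exact right_ne_zero_of_mul this
  have h1 : (w.dualBasis.repr (affineRep g ⟨⟨q, hq⟩, hg⟩) : κ → ℂ) =
      fun i => χ (c.prodCoord hη (w i)) / χ (c.prodCoord hη g) := by
    ext i
    rw [Module.Basis.dualBasis_repr]
    change (q.rep g)⁻¹ * q.rep (w i) = _
    rw [hχ, hχ]
    field_simp
  rw [h1]
  refine aeval_div_eq_zero (resAlg _ hη) (resAlg_genericPoint_injective hη) χ _ h0 ?_
  simp only [h, mul_div_mul_left _ _ hu]
  exact hP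

lemma algRk_affineHom_le (g : prodSeries E J) :
    algRk ℂ (Set.range fun i => p.affineHom w g (MvPolynomial.X i)) ≤
      algRk ℂ (valSet p.gen J) := by
  refine algRk_le_of_subset_closure ?_
  rintro _ ⟨i, rfl⟩
  have h1 := adjoin_subset_algClosure _ (p.prodGen_mem_adjoin (w i))
  have h2 := adjoin_subset_algClosure _ (p.prodGen_mem_adjoin g)
  dsimp only
  rw [affineHom, MvPolynomial.aeval_X]
  rw [mem_algClosure_iff] at h1 h2 ⊢
  rw [div_eq_mul_inv]
  exact h1.mul h2.inv

lemma algRk_affineHom_pivot :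
    algRk ℂ (Set.range fun i => p.affineHom w (p.pivot J) (MvPolynomial.X i)) =
      algRk ℂ (valSet p.gen J) := by
  refine (p.algRk_affineHom_le w _).antisymm (algRk_le_of_subset_closure ?_)
  refine p.valSet_subset_range_prodGen.trans ?_
  rintro _ ⟨g, rfl⟩
  refine adjoin_subset_algClosure _ ?_
  rw [← w.sum_repr g, map_sum]
  refine sum_mem fun i _ => ?_
  rw [map_smul]
  refine Subalgebra.smul_mem _ (Algebra.subset_adjoin (Set.mem_range.2 ⟨i, ?_⟩)) _
  rw [affineHom, MvPolynomial.aeval_X, p.prodGen_apply (p.pivot J), prodQuot_pivot, map_one,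
    div_one]

/-- The passage from polynomial functions in the affine coordinates to the generic point. -/
def affineFunHom (g : prodSeries E J) :
    polyFun (Module.Dual ℂ (prodSeries E J)) →ₐ[ℂ] resField (genericPoint X) :=
  (p.affineHom w g).comp (polyFunEquiv w.dualBasis).symm.toAlgHom

lemma affineFunHom_apply (g : prodSeries E J) (P : MvPolynomial κ ℂ) :
    p.affineFunHom w g (polyFunEquiv w.dualBasis P) = p.affineHom w g P := by
  simp [affineFunHom]

lemma range_affineFunHom (g : prodSeries E J) :
    (p.affineFunHom w g).range = (p.affineHom w g).range := by
  apply le_antisymm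
  · rintro _ ⟨f, rfl⟩; exact ⟨_, rfl⟩
  · rintro _ ⟨P, rfl⟩; exact ⟨_, p.affineFunHom_apply w g P⟩

lemma affineFunHom_eq_zero (hL : ∀ j, IsLineBundle (L j)) {g : prodSeries E J}
    (f : polyFun (Module.Dual ℂ (prodSeries E J))) (hf : p.affineFunHom w g f = 0)
    (t : kodairaOpen g) : f.1 (affineRep g t) = 0 := by
  obtain ⟨P, rfl⟩ := (polyFunEquiv w.dualBasis).surjective f
  rw [affineFunHom_apply] at hf
  rw [polyFunEquiv_apply]
  exact p.affineRep_eq_zero w hL hf t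

/-- The bound is local: on each affine piece the coordinates are quotients of elements of the
algebra generated by the values over `J`. -/
lemma krullDimOf_kodairaImage_le (hL : ∀ j, IsLineBundle (L j))
    (w : Module.Basis κ ℂ (prodSeries E J)) :
    krullDimOf (projZariski _) (kodairaImage E J) ≤ (algRk ℂ (valSet p.gen J) : WithBot ℕ∞) := by
  let := (projZariski (Module.Dual ℂ (prodSeries E J))).induced
    (Subtype.val : kodairaImage E J → _)
  refine topologicalKrullDim_le_of_cover fun t => ?_
  obtain ⟨g, hg⟩ : ∃ g, t.1.rep g ≠ 0 := by
    by_contra! h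
    exact t.1.rep_nonzero (LinearMap.ext h)
  refine ⟨kodairaOpen g, isOpen_kodairaOpen g, hg, ?_⟩
  refine (topologicalKrullDim_le_range (induced_kodairaOpen g)
    (p.affineFunHom_eq_zero w hL)).trans ?_
  obtain ⟨d, hd, htr⟩ := algRk_range_eq_trdeg (p.affineHom w g)
  rw [← range_affineFunHom] at htr
  refine (ringKrullDim_le_of_trdeg htr).trans ?_
  have := p.algRk_affineHom_le w g
  rw [hd] at this
  exact_mod_cast this

lemma exists_affineRep_eq (χ : Γ(X, p.U) →ₐ[ℂ] ℂ) :
    ∃ t : kodairaOpen (p.pivot J), affineRep _ t = χ.toLinearMap ∘ₗ p.prodQuot J := by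
  obtain ⟨y, hy, hyc, h⟩ := exists_mem_closedPoints_of_algHom p.isAffineOpen χ
  let v : Module.Dual ℂ (prodSeries E J) := χ.toLinearMap ∘ₗ p.prodQuot J
  have hv1 : v (p.pivot J) = 1 := by
    change χ (p.prodQuot J (p.pivot J)) = 1
    rw [prodQuot_pivot, map_one]
  have hv : v ≠ 0 := fun h0 => by
    rw [h0] at hv1
    exact zero_ne_one hv1
  have hl := apply_rep_ne_zero_iff (Module.Dual.eval ℂ (prodSeries E J) (p.pivot J)) hv
  have hr := inv_smul_rep (Module.Dual.eval ℂ (prodSeries E J) (p.pivot J)) hv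
  refine ⟨⟨⟨Projectivization.mk ℂ v hv, y, hyc, fun g => ?_⟩, hl.2 ?_⟩, hr.trans ?_⟩
  · obtain ⟨a, ha⟩ := Projectivization.exists_smul_eq_mk_rep ℂ v hv
    rw [← ha, p.vanishes_iff_prodCoord p.genericPoint_mem g y hy, ← h]
    change (a : ℂ) * χ (p.prodQuot J g) = 0 ↔ _
    rw [prodQuot_apply, map_mul]
    simp [((p.prodUnit J).isUnit.map χ).ne_zero]
  · rw [Module.Dual.eval_apply, hv1]
    exact one_ne_zero
  · rw [Module.Dual.eval_apply, hv1, inv_one, one_smul]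

/-- The single affine piece of the pivot suffices, since the complex points of the chart already
supply enough points of the image. -/
lemma le_krullDimOf_kodairaImage (hL : ∀ j, IsLineBundle (L j))
    (w : Module.Basis κ ℂ (prodSeries E J)) :
    (algRk ℂ (valSet p.gen J) : WithBot ℕ∞) ≤ krullDimOf (projZariski _) (kodairaImage E J) := by
  let := (projZariski (Module.Dual ℂ (prodSeries E J))).induced
    (Subtype.val : kodairaImage E J → _)
  refine le_trans ?_ (Topology.IsInducing.subtypeVal
    (t := kodairaOpen (p.pivot J))).topologicalKrullDim_le
  obtain ⟨d, hd, htr⟩ := algRk_range_eq_trdeg (p.affineHom w (p.pivot J))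
  rw [algRk_affineHom_pivot] at hd
  rw [← range_affineFunHom] at htr
  let π : Γ(X, p.U) →ₐ[ℂ] resField (genericPoint X) :=
    resAlg (genericPoint X) p.genericPoint_mem
  have hπ : ∀ P, p.affineHom w (p.pivot J) P =
      π (MvPolynomial.aeval (fun i => p.prodQuot J (w i)) P) := fun P => by
    rw [affineHom, MvPolynomial.comp_aeval_apply, p.prodGen_apply (p.pivot J), prodQuot_pivot,
      map_one]
    simp only [div_one]
    rfl
  have hle : (p.affineFunHom w (p.pivot J)).range ≤ π.range := by
    rw [range_affineFunHom]
    rintro _ ⟨P, rfl⟩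
    exact ⟨_, (hπ P).symm⟩
  have hft : Algebra.FiniteType ℂ (p.affineFunHom w (p.pivot J)).range :=
    .of_surjective ((p.affineFunHom w (p.pivot J)).rangeRestrict.comp
      (polyFunEquiv w.dualBasis).toAlgHom)
      ((p.affineFunHom w (p.pivot J)).rangeRestrict_surjective.comp
        (polyFunEquiv w.dualBasis).surjective)
  have hft' : Algebra.FiniteType ℂ π.range :=
    .of_surjective π.rangeRestrict π.rangeRestrict_surjective
  rw [hd]
  -- The image of the sections in the residue field at the generic point plays the role of `B`, so
  -- that both algebras lie in one domain.
  refine trdeg_le_topologicalKrullDim (induced_kodairaOpen (p.pivot J))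
    (p.affineFunHom_eq_zero w hL) π.range hle (fun φ => ?_) htr
  obtain ⟨t, ht⟩ := p.exists_affineRep_eq (J := J) (φ.comp π.rangeRestrict)
  refine ⟨t, fun f => ?_⟩
  obtain ⟨P, rfl⟩ := (polyFunEquiv w.dualBasis).surjective f
  have h1 : (⟨p.affineFunHom w (p.pivot J) (polyFunEquiv w.dualBasis P), hle ⟨_, rfl⟩⟩ : π.range) =
      π.rangeRestrict (MvPolynomial.aeval (fun i => p.prodQuot J (w i)) P) :=
    Subtype.ext ((p.affineFunHom_apply w _ P).trans (hπ P))
  have h2 : (w.dualBasis.repr (affineRep _ t) : κ → ℂ) =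
      fun i => (φ.comp π.rangeRestrict) (p.prodQuot J (w i)) := by
    ext i
    rw [Module.Basis.dualBasis_repr, ht]
    rfl
  rw [h1, polyFunEquiv_apply, h2]
  change _ = (φ.comp π.rangeRestrict) _
  rw [MvPolynomial.comp_aeval_apply]
  rfl

/-- The dimension is a natural number `d`, so neither `unbotD` nor `toNat` in `tau` falls back on a
default value. -/
lemma tau_eq (hL : ∀ j, IsLineBundle (L j)) (J : Finset (Fin k)) :
    (tau E J : ℕ∞) = algRk ℂ (valSet p.gen J) := by
  have hfd : ∀ j, FiniteDimensional ℂ (E j) := fun j => .of_basis (b j)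
  have := finiteDimensional_prodSeries (E := E) (J := J)
  let w := Module.finBasis ℂ (prodSeries E J)
  have h1 := (p.krullDimOf_kodairaImage_le hL w).antisymm (p.le_krullDimOf_kodairaImage hL w)
  obtain ⟨d, hd, -⟩ := algRk_range_eq_trdeg (p.affineHom w (p.pivot J))
  rw [algRk_affineHom_pivot] at hd
  rw [tau, h1, hd]
  rfl

end PivotChart

end Kodaira

end LinearSeries
end

noncomputable section

set_option linter.unusedSectionVars false

namespace LinearSeries

/-! ### The minimal defect -/

section MinDefect

variable {X : Scheme.{0}} [X.Over (Spec (.of ℂ))] {k : ℕ} {L : Fin k → X.Modules}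
  {E : ∀ i, Submodule ℂ Γ(L i, ⊤)} [AlgebraicGeometry.IsIntegral X]
  [LocallyOfFiniteType (X ↘ Spec (.of ℂ))] {ι : Fin k → Type} [∀ j, Fintype (ι j)]
  [∀ j, DecidableEq (ι j)] {b : ∀ j, Module.Basis (ι j) ℂ (E j)}

/-- The upper bounds `hle` for all `J` force every defect to be at least `-1` in codimension 1, and
the Rado-type bound `hge` is the converse. The full collection has `n + 1` members and `τ ≤ n`,
which gives both a defect of at most `-1` and `genRk` at most one below full. -/
lemma PivotChart.genRk_add_one_eq_iff (p : PivotChart b) (hL : ∀ j, IsLineBundle (L j)) {n : ℕ}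
    (hn : topologicalKrullDim X ≤ n) (hk : k = n + 1) :
    p.genRk + 1 = Fintype.card (Σ j, ι j) ↔ minDefect E = -1 := by
  have hle : ∀ J : Finset (Fin k),
      p.genRk + J.card ≤ Fintype.card (Σ j, ι j) + (tau E J : ℕ∞) := fun J => by
    rw [p.tau_eq hL]
    exact algRk_range_genPt_add_card_le p.a p.gen J
  have hge : (∀ J : Finset (Fin k), J.card ≤ tau E J + 1) →
      (Fintype.card (Σ j, ι j) : ℕ∞) ≤ p.genRk + 1 := fun h =>
    card_le_algRk_genPt p.a p.gen p.gen_a fun J => by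
      rw [← p.tau_eq hL]
      exact_mod_cast h J
  have htau : tau E Finset.univ ≤ n := by
    have := p.algRk_resField_le hn (valSet p.gen Finset.univ)
    rw [← p.tau_eq hL] at this
    exact_mod_cast this
  have huniv : (Finset.univ : Finset (Fin k)).card = n + 1 := by simp [hk]
  obtain ⟨r, hr⟩ : ∃ r : ℕ, p.genRk = r := by
    refine (ENat.ne_top_iff_exists.1 fun h => ?_).imp fun _ => Eq.symm
    have := hle ∅
    rw [h, top_add, top_le_iff] at this
    exact absurd this (by exact_mod_cast ENat.natCast_ne_top _)
  rw [hr] at hle hge ⊢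
  norm_cast at hle hge ⊢
  have h1 := hle Finset.univ
  rw [minDefect]
  constructor
  · intro h
    refine le_antisymm ((Finset.inf'_le _ (Finset.mem_univ Finset.univ)).trans ?_)
      (Finset.le_inf' _ _ fun J _ => ?_)
    · rw [defect]
      omega
    · have := hle J
      rw [defect]
      omega
  · intro h
    have := hge fun J => by
      have := h.ge.trans (Finset.inf'_le (defect E) (Finset.mem_univ J))
      rw [defect] at this
      omega
    omega

end MinDefect

end LinearSeries
end
theorem mainTheorem10 (X : Scheme.{0}) [X.Over (Spec (.of ℂ))] [AlgebraicGeometry.IsIntegral X]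
    [IsSeparated (X ↘ Spec (.of ℂ))] [LocallyOfFiniteType (X ↘ Spec (.of ℂ))]
    [QuasiCompact (X ↘ Spec (.of ℂ))]
    (n : ℕ) (hn : topologicalKrullDim X = n)
    (L : Fin (n + 1) → X.Modules) (hL : ∀ i, LinearSeries.IsLineBundle (L i))
    (E : ∀ i, Submodule ℂ Γ(L i, ⊤)) (hfin : ∀ i, FiniteDimensional ℂ (E i))
    (hbpf : ∀ i, LinearSeries.BasePointFree (E i)) :
    (LinearSeries.HasCodim (LinearSeries.consistencyVariety E) 1 ↔
      LinearSeries.minDefect E = -1) ∧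
    (LinearSeries.HasCodim (LinearSeries.consistencyVariety E) 1 →
      (∃ P, LinearSeries.IsResultant E P) ∧
      ∀ J, LinearSeries.IsEssential E J → ∀ P, LinearSeries.IsResultant E P →
        ∀ s s' : (∀ i, E i), (∀ i ∈ J, s i = s' i) → P.1 s = P.1 s') := by
  obtain ⟨p⟩ := LinearSeries.exists_pivotChart (fun j => Module.finBasis ℂ (E j)) hL hbpf
  have hiff := p.hasCodim_iff hL hbpf
  refine ⟨hiff.trans (p.genRk_add_one_eq_iff hL hn.le rfl), fun hcodim => ?_⟩
  have hgen := hiff.1 hcodim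
  refine ⟨p.exists_isResultant hL hbpf hn.le rfl hgen, fun J hJ P hP s s' hs => ?_⟩
  refine p.apply_eq_of_isResultant hgen ?_ hP hs
  -- Defect `-1` means `τ_J = |J| - 1`, the strict inequality which makes the coordinates over `J`
  -- dependent.
  have h1 := hJ.1.trans ((p.genRk_add_one_eq_iff hL hn.le rfl).1 hgen)
  rw [← p.tau_eq hL, Nat.cast_lt]
  rw [LinearSeries.defect] at h1
  omega
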